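/- Let $c>0$ and $k>\frac16$, and consider the solitary wave profiles of the coupled KdV–linear Schrödinger system (with $s=\mathrm{sgn}(k)=+1$), that is, solutions $(U,A)\in H^2(\mathbb R)\times H^2(\mathbb R)$ (real-valued) of $$U''-cU+\tfrac12U^2+A^2=0,\qquad A''+(\Omega+kU)A=0 .\tag{1}$$ Let $U_0(\xi)=3c\,\mathrm{sech}^2\big(\tfrac{\sqrt c}{2}\xi\big)$ be the uncoupled soliton, let $L_1=-\partial_\xi^2+c-U_0$, and put $$\widetilde\Omega_c=-\frac{c}{16}\big(\sqrt{1+48k}-3\big)^2,\qquad \tilde g(\xi)=\mathrm{sech}^{q}\big(\tfrac{\sqrt c}{2}\xi\big)\tanh\big(\tfrac{\sqrt c}{2}\xi\big),\qquad q=\frac{\sqrt{1+48k}-3}{2}.$$ There is exactly one $W\in H^2_{\rm even}(\mathbb R)$ with $L_1W=\tilde g^2$; write $L_1^{-1}\tilde g^2=W$ and assume that $\langle\tilde g^2,L_1^{-1}\tilde g^2\rangle=\int_{\mathbb R}\tilde g^2\,W\,d\xi\ne0$. Then there is $C_0>0$ such that for every $C\ge C_0$ there is $\delta>0$ with the following property.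 For every $\Omega\in\mathbb R$ with $|\Omega-\widetilde\Omega_c|<\delta$ and $\mathrm{sgn}(\Omega-\widetilde\Omega_c)=-\mathrm{sgn}\,\langle\tilde g^2,L_1^{-1}\tilde g^2\rangle$, the second bifurcating branch exists at $\Omega$, i.e. there is a solution $(U,A)\in H^2_{\rm even}(\mathbb R)\times H^2_{\rm odd}(\mathbb R)$ of (1) with $$A\neq0,\qquad \|U-U_0\|_{H^2}\le C|\Omega-\widetilde\Omega_c|,\qquad \|A\|_{H^2}\le C\sqrt{|\Omega-\widetilde\Omega_c|},\tag{2}$$ and for every solution $(U,A)\in H^2_{\rm even}(\mathbb R)\times H^2_{\rm odd}(\mathbb R)$ of (1) that satisfies (2), the Hessian operator $\mathcal L:(H^2(\mathbb R))^3\subset(L^2(\mathbb R))^3\to(L^2(\mathbb R))^3$, $$\mathcal L=-\begin{pmatrix}\partial_\xi^2+U-c&2A&0\\2A&\frac2k(\partial_\xi^2+kU+\Omega)&0\\0&0&\frac2k(\partial_\xi^2+kU+\Omega)\end{pmatrix},$$ has - Morse index (number of negative eigenvalues, counted with multiplicity) equal to $3$ if $\langle\tilde g^2,L_1^{-1}\tilde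 g^2\rangle<0$ and equal to $4$ if $\langle\tilde g^2,L_1^{-1}\tilde g^2\rangle>0$; - nullity index (multiplicity of the eigenvalue $0$) equal to $2$ in both cases. -/

import Mathlib

open MeasureTheory
open scoped ContDiff

noncomputable section

namespace KdVLS

/-! ### The Sobolev space `H²(ℝ)` of real functions -/

/-- The real Hilbert space `L²(ℝ)`. -/
abbrev RealL2 : Type := Lp ℝ 2 (volume : Measure ℝ)

/-- Real measurable functions on the line, up to equality almost everywhere. -/
abbrev RealL0 : Type := ℝ →ₘ[(volume : Measure ℝ)] ℝ

/-- `f'` is the weak derivative of `f` on the line. -/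
def HasWeakDeriv (f f' : ℝ → ℝ) : Prop :=
  ∀ φ : ℝ → ℝ, ContDiff ℝ ∞ φ → HasCompactSupport φ →
    ∫ x, f x * deriv φ x = -∫ x, f' x * φ x

theorem integrable_mul_test (f : RealL2) {φ : ℝ → ℝ} (hφ : Continuous φ)
    (hs : HasCompactSupport φ) : Integrable (fun x => f x * φ x) :=
  MemLp.integrable_mul (p := 2) (q := 2) (Lp.memLp f) (hφ.memLp_of_hasCompactSupport hs)

theorem HasWeakDeriv.add {f g f' g' : RealL2} (h₁ : HasWeakDeriv f f')
    (h₂ : HasWeakDeriv g g') : HasWeakDeriv ⇑(f + g) ⇑(f' + g') := by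
  intro φ hφ hs
  have hd : Continuous (deriv φ) := hφ.continuous_deriv (by simp)
  have e₁ : ∫ x, (f + g) x * deriv φ x = ∫ x, (f x * deriv φ x + g x * deriv φ x) := by
    refine integral_congr_ae ?_
    filter_upwards [Lp.coeFn_add f g] with x hx
    rw [hx, Pi.add_apply, add_mul]
  have e₂ : ∫ x, (f' + g') x * φ x = ∫ x, (f' x * φ x + g' x * φ x) := by
    refine integral_congr_ae ?_
    filter_upwards [Lp.coeFn_add f' g'] with x hx
    rw [hx, Pi.add_apply, add_mul]
  rw [e₁, e₂, integral_add (integrable_mul_test f hd hs.deriv) (integrable_mul_test g hd hs.deriv),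
    integral_add (integrable_mul_test f' hφ.continuous hs)
      (integrable_mul_test g' hφ.continuous hs), h₁ φ hφ hs, h₂ φ hφ hs]
  ring

theorem HasWeakDeriv.smul (a : ℝ) {f f' : RealL2} (h : HasWeakDeriv f f') :
    HasWeakDeriv ⇑(a • f) ⇑(a • f') := by
  intro φ hφ hs
  have e₁ : ∫ x, (a • f) x * deriv φ x = ∫ x, a * (f x * deriv φ x) := by
    refine integral_congr_ae ?_
    filter_upwards [Lp.coeFn_smul a f] with x hx
    rw [hx, Pi.smul_apply, smul_eq_mul, mul_assoc]
  have e₂ : ∫ x, (a • f') x * φ x = ∫ x, a * (f' x * φ x) := by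
    refine integral_congr_ae ?_
    filter_upwards [Lp.coeFn_smul a f'] with x hx
    rw [hx, Pi.smul_apply, smul_eq_mul, mul_assoc]
  rw [e₁, e₂, integral_const_mul, integral_const_mul, h φ hφ hs]
  ring

theorem hasWeakDeriv_zero : HasWeakDeriv ⇑(0 : RealL2) ⇑(0 : RealL2) := by
  have h : ∀ ψ : ℝ → ℝ, ∫ x, (0 : RealL2) x * ψ x = 0 := by
    intro ψ
    rw [integral_congr_ae (g := fun _ => (0 : ℝ)), integral_zero]
    filter_upwards [Lp.coeFn_zero ℝ 2 (volume : Measure ℝ)] with x hx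
    rw [hx, Pi.zero_apply, zero_mul]
  intro φ _ _
  rw [h, h, neg_zero]

/-- The Sobolev space `H²(ℝ)`: a function of `L²(ℝ)` is stored together with its first and second
weak derivatives, which are in `L²(ℝ)` and are determined by the function. The inherited norm is
`‖u‖² = ‖u‖²_{L²} + ‖u'‖²_{L²} + ‖u''‖²_{L²}`. -/
def H2 : Submodule ℝ (PiLp 2 (fun _ : Fin 3 => RealL2)) where
  carrier := {u | HasWeakDeriv (u 0) (u 1) ∧ HasWeakDeriv (u 1) (u 2)}
  add_mem' hu hv := ⟨hu.1.add hv.1, hu.2.add hv.2⟩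
  zero_mem' := ⟨hasWeakDeriv_zero, hasWeakDeriv_zero⟩
  smul_mem' a _ hu := ⟨hu.1.smul a, hu.2.smul a⟩

/-- The `j`-th weak derivative (`j = 0, 1, 2`) of an element of `H²(ℝ)`; `D 0` is the function
itself. -/
def D (j : Fin 3) : H2 →ₗ[ℝ] RealL0 where
  toFun u := ((u : PiLp 2 (fun _ : Fin 3 => RealL2)) j : RealL0)
  map_add' _ _ := rfl
  map_smul' _ _ := rfl

/-- Membership in `H²_even(ℝ)`. -/
def IsEven (u : H2) : Prop := ∀ᵐ x : ℝ, D 0 u (-x) = D 0 u x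

/-- Membership in `H²_odd(ℝ)`. -/
def IsOdd (u : H2) : Prop := ∀ᵐ x : ℝ, D 0 u (-x) = -D 0 u x

theorem hasWeakDeriv_of_hasDerivAt {f f' : ℝ → ℝ} (h : ∀ x, HasDerivAt f (f' x) x)
    (hf : MemLp f 2) (hf' : MemLp f' 2) :
    HasWeakDeriv ⇑(hf.toLp f) ⇑(hf'.toLp f') := by
  intro φ hφ hs
  have hd : Continuous (deriv φ) := hφ.continuous_deriv (by simp)
  have hφd : ∀ x, HasDerivAt φ (deriv φ x) x := fun x =>
    (hφ.differentiable (by simp) x).hasDerivAt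
  have e₁ : ∫ x, (hf.toLp f) x * deriv φ x = ∫ x, f x * deriv φ x := by
    refine integral_congr_ae ?_
    filter_upwards [hf.coeFn_toLp] with x hx
    rw [hx]
  have e₂ : ∫ x, (hf'.toLp f') x * φ x = ∫ x, f' x * φ x := by
    refine integral_congr_ae ?_
    filter_upwards [hf'.coeFn_toLp] with x hx
    rw [hx]
  rw [e₁, e₂]
  exact integral_mul_deriv_eq_deriv_mul_of_integrable (fun x _ => h x) (fun x _ => hφd x)
    (MemLp.integrable_mul (p := 2) (q := 2) hf (hd.memLp_of_hasCompactSupport hs.deriv))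
    (MemLp.integrable_mul (p := 2) (q := 2) hf' (hφ.continuous.memLp_of_hasCompactSupport hs))
    (MemLp.integrable_mul (p := 2) (q := 2) hf (hφ.continuous.memLp_of_hasCompactSupport hs))

/-- A twice differentiable function that is in `L²(ℝ)` with its two derivatives, as an element of
`H²(ℝ)`. -/
def H2.ofHasDerivAt (f f' f'' : ℝ → ℝ) (h : ∀ x, HasDerivAt f (f' x) x)
    (h' : ∀ x, HasDerivAt f' (f'' x) x) (hf : MemLp f 2) (hf' : MemLp f' 2)
    (hf'' : MemLp f'' 2) : H2 :=
  ⟨WithLp.toLp 2 ![hf.toLp f, hf'.toLp f', hf''.toLp f''],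
    hasWeakDeriv_of_hasDerivAt h hf hf', hasWeakDeriv_of_hasDerivAt h' hf' hf''⟩

/-! ### The uncoupled soliton -/

/-- The hyperbolic secant. -/
def sech (x : ℝ) : ℝ := 1 / Real.cosh x

/-- The profile `U₀(ξ) = 3c sech²(√c ξ / 2)` of the uncoupled soliton. -/
def soliton (c x : ℝ) : ℝ := 3 * c * sech (√c / 2 * x) ^ 2

/-- The first derivative of the profile `U₀`. -/
def soliton' (c x : ℝ) : ℝ := -(√c * Real.tanh (√c / 2 * x) * soliton c x)

/-- The second derivative of the profile `U₀`. -/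
def soliton'' (c x : ℝ) : ℝ := c * soliton c x - 1 / 2 * soliton c x ^ 2

theorem hasDerivAt_arg (c x : ℝ) : HasDerivAt (fun y : ℝ => √c / 2 * y) (√c / 2) x := by
  simpa using (hasDerivAt_id x).const_mul (√c / 2)

theorem hasDerivAt_soliton (c x : ℝ) : HasDerivAt (soliton c) (soliton' c x) x := by
  have hl := hasDerivAt_arg c x
  have hne : Real.cosh (√c / 2 * x) ≠ 0 := (Real.cosh_pos _).ne'
  have h := (((hasDerivAt_const x (1 : ℝ)).div hl.cosh hne).pow 2).const_mul (3 * c)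
  refine h.congr_deriv ?_
  simp only [soliton', soliton, sech, Real.tanh_eq_sinh_div_cosh, Pi.div_apply]
  generalize Real.cosh (√c / 2 * x) = a at *
  push_cast
  field_simp
  simp [mul_assoc]

theorem hasDerivAt_soliton' {c : ℝ} (hc : 0 ≤ c) (x : ℝ) :
    HasDerivAt (soliton' c) (soliton'' c x) x := by
  have hl := hasDerivAt_arg c x
  have hne : Real.cosh (√c / 2 * x) ≠ 0 := (Real.cosh_pos _).ne'
  have hsq := Real.cosh_sq (√c / 2 * x)
  have ht : HasDerivAt (fun y : ℝ => Real.tanh (√c / 2 * y))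
      (√c / 2 * sech (√c / 2 * x) ^ 2) x := by
    have h := hl.sinh.div hl.cosh hne
    have e : (fun y : ℝ => Real.tanh (√c / 2 * y)) =
        (fun y => Real.sinh (√c / 2 * y)) / fun y => Real.cosh (√c / 2 * y) := by
      funext y
      simp [Real.tanh_eq_sinh_div_cosh]
    rw [e]
    refine h.congr_deriv ?_
    rw [sech]
    generalize Real.cosh (√c / 2 * x) = a at *
    generalize Real.sinh (√c / 2 * x) = b at *
    field_simp
    linear_combination √c * hsq
  have h := ((ht.const_mul √c).mul (hasDerivAt_soliton c x)).neg
  refine h.congr_deriv ?_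
  have hs : √c * √c = c := Real.mul_self_sqrt hc
  have htt : Real.tanh (√c / 2 * x) ^ 2 = 1 - sech (√c / 2 * x) ^ 2 := by
    rw [Real.tanh_eq_sinh_div_cosh, sech]
    generalize Real.cosh (√c / 2 * x) = a at *
    generalize Real.sinh (√c / 2 * x) = b at *
    field_simp
    linear_combination -hsq
  simp only [soliton', soliton'', soliton]
  linear_combination (3 * c * sech (√c / 2 * x) ^ 2) *
    (√c * √c * htt + (1 - 3 / 2 * sech (√c / 2 * x) ^ 2) * hs)

theorem sech_sq_le (y : ℝ) : sech y ^ 2 ≤ (1 + y ^ 2)⁻¹ := by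
  have h₁ : y ^ 2 ≤ Real.sinh y ^ 2 := by
    rw [← sq_abs y, ← sq_abs (Real.sinh y), Real.abs_sinh]
    have := Real.self_le_sinh_iff.2 (abs_nonneg y)
    gcongr
  have h₂ := Real.cosh_sq y
  rw [sech, div_pow, one_pow, one_div]
  gcongr
  linarith

theorem memLp_soliton {c : ℝ} (hc : 0 < c) : MemLp (soliton c) 2 := by
  have hcont : Continuous (soliton c) :=
    continuous_iff_continuousAt.2 fun x => (hasDerivAt_soliton c x).continuousAt
  rw [memLp_two_iff_integrable_sq hcont.aestronglyMeasurable]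
  have hr : √c / 2 ≠ 0 := by positivity
  have hi : Integrable fun x : ℝ => (3 * c) ^ 2 * (1 + (√c / 2 * x) ^ 2)⁻¹ :=
    (integrable_inv_one_add_sq.comp_mul_left' hr).const_mul _
  refine hi.mono' (hcont.pow 2).aestronglyMeasurable (Filter.Eventually.of_forall fun x => ?_)
  have h := sech_sq_le (√c / 2 * x)
  have h1 : sech (√c / 2 * x) ^ 2 ≤ 1 := h.trans (inv_le_one_of_one_le₀ (by nlinarith [sq_nonneg (√c / 2 * x)]))
  rw [Real.norm_of_nonneg (by positivity), soliton, mul_pow]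
  have h0 : 0 ≤ sech (√c / 2 * x) ^ 2 := by positivity
  gcongr
  nlinarith

theorem memLp_soliton' {c : ℝ} (hc : 0 < c) : MemLp (soliton' c) 2 := by
  have hcont : Continuous (soliton' c) :=
    continuous_iff_continuousAt.2 fun x => (hasDerivAt_soliton' hc.le x).continuousAt
  refine ((memLp_soliton hc).const_mul √c).mono hcont.aestronglyMeasurable
    (Filter.Eventually.of_forall fun x => ?_)
  have h : |Real.tanh (√c / 2 * x)| ≤ 1 := (Real.abs_tanh_lt_one _).le
  simp only [soliton', norm_neg, norm_mul, Real.norm_eq_abs]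
  gcongr
  exact mul_le_of_le_one_right (abs_nonneg _) h

theorem memLp_soliton'' {c : ℝ} (hc : 0 < c) : MemLp (soliton'' c) 2 := by
  have hcont : Continuous (soliton c) :=
    continuous_iff_continuousAt.2 fun x => (hasDerivAt_soliton c x).continuousAt
  have hcont2 : Continuous (soliton'' c) := by
    unfold soliton''
    fun_prop
  refine ((memLp_soliton hc).const_mul (5 / 2 * c)).mono hcont2.aestronglyMeasurable
    (Filter.Eventually.of_forall fun x => ?_)
  have h1 : sech (√c / 2 * x) ^ 2 ≤ 1 :=
    (sech_sq_le _).trans (inv_le_one_of_one_le₀ (by nlinarith [sq_nonneg (√c / 2 * x)]))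
  have h0 : 0 ≤ sech (√c / 2 * x) ^ 2 := by positivity
  have hu0 : 0 ≤ soliton c x := by unfold soliton; positivity
  have hu1 : soliton c x ≤ 3 * c := by
    unfold soliton
    nlinarith
  rw [Real.norm_eq_abs, Real.norm_of_nonneg (by positivity), soliton'', abs_le]
  constructor <;> nlinarith [mul_nonneg hu0 (sub_nonneg.2 hu1), mul_nonneg hc.le hu0]

/-- The uncoupled soliton `U₀` as an element of `H²(ℝ)`. -/
def U₀ {c : ℝ} (hc : 0 < c) : H2 :=
  H2.ofHasDerivAt (soliton c) (soliton' c) (soliton'' c) (hasDerivAt_soliton c)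
    (hasDerivAt_soliton' hc.le) (memLp_soliton hc) (memLp_soliton' hc) (memLp_soliton'' hc)

/-! ### The second bifurcation point -/

/-- The second bifurcation point `Ω̃_c = -(c/16) (√(1+48k) - 3)²`. -/
def Ωc2 (c k : ℝ) : ℝ := -(c / 16) * (√(1 + 48 * k) - 3) ^ 2

/-- The eigenfunction `g̃(ξ) = sech^q(√c ξ / 2) tanh(√c ξ / 2)` with `q = (√(1+48k) - 3)/2`. -/
def gTilde (c k x : ℝ) : ℝ :=
  sech (√c / 2 * x) ^ ((√(1 + 48 * k) - 3) / 2) * Real.tanh (√c / 2 * x)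

/-! ### The Hessian operator

For `U, A ∈ H²(ℝ)`, which are bounded functions, the operators below map their domains to `L²`; they
are written with values in the measurable functions, where all products make sense. -/

/-- Multiplication by the function `a`. -/
def mulBy (a : RealL0) : RealL0 →ₗ[ℝ] RealL0 where
  toFun f := a * f
  map_add' f g := by
    refine AEEqFun.ext ?_
    filter_upwards [AEEqFun.coeFn_mul a (f + g), AEEqFun.coeFn_add f g,
      AEEqFun.coeFn_add (a * f) (a * g), AEEqFun.coeFn_mul a f, AEEqFun.coeFn_mul a g]
      with x h₁ h₂ h₃ h₄ h₅
    simp only [h₁, h₂, h₃, h₄, h₅, Pi.mul_apply, Pi.add_apply, mul_add]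
  map_smul' r f := by
    refine AEEqFun.ext ?_
    filter_upwards [AEEqFun.coeFn_mul a (r • f), AEEqFun.coeFn_smul r f,
      AEEqFun.coeFn_smul r (a * f), AEEqFun.coeFn_mul a f] with x h₁ h₂ h₃ h₄
    simp only [h₁, h₂, h₃, h₄, Pi.mul_apply, Pi.smul_apply, smul_eq_mul, RingHom.id_apply]
    ring

/-- `L₁ = -∂² + c - U`. -/
def L₁ (c : ℝ) (U : H2) : H2 →ₗ[ℝ] RealL0 :=
  -D 2 + c • D 0 - mulBy (D 0 U) ∘ₗ D 0

/-- `L₂ = (2/k) (-∂² - Ω - kU)`. -/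
def L₂ (k Ω : ℝ) (U : H2) : H2 →ₗ[ℝ] RealL0 :=
  (2 / k) • (-D 2 - Ω • D 0 - k • (mulBy (D 0 U) ∘ₗ D 0))

/-- The Hessian operator
`(w, z₁, z₂) ↦ (L₁ w - 2 A z₁, -2 A w + L₂ z₁, L₂ z₂)` with domain `H²(ℝ)³`. -/
def hessian (c k Ω : ℝ) (U A : H2) : (H2 × H2 × H2) →ₗ[ℝ] (RealL0 × RealL0 × RealL0) where
  toFun v :=
    (L₁ c U v.1 - (2 : ℝ) • mulBy (D 0 A) (D 0 v.2.1),
      -((2 : ℝ) • mulBy (D 0 A) (D 0 v.1)) + L₂ k Ω U v.2.1,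
      L₂ k Ω U v.2.2)
  map_add' v v' := by
    simp only [Prod.fst_add, Prod.snd_add, map_add, Prod.mk_add_mk, Prod.mk.injEq, smul_add]
    refine ⟨?_, ?_, trivial⟩ <;> abel
  map_smul' a v := by
    simp only [Prod.smul_fst, Prod.smul_snd, map_smul, RingHom.id_apply, Prod.smul_mk,
      smul_comm (2 : ℝ) a, smul_sub, smul_add, smul_neg]

/-- The inclusion of the domain `H²(ℝ)³` in the measurable functions. -/
def incl : (H2 × H2 × H2) →ₗ[ℝ] (RealL0 × RealL0 × RealL0) :=
  (D 0).prodMap ((D 0).prodMap (D 0))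

/-- The eigenspace of the Hessian operator at the real number `μ`: the `v ∈ H²(ℝ)³` with
`𝓛 v = μ v`. -/
def eigenspace (c k Ω : ℝ) (U A : H2) (μ : ℝ) : Submodule ℝ (H2 × H2 × H2) :=
  LinearMap.ker (hessian c k Ω U A - μ • incl)

/-- The Morse index: the number of negative eigenvalues with their multiplicities, that is, the
dimension of the sum of the eigenspaces at the negative eigenvalues. (The Hessian operator is
symmetric, so its eigenspaces are independent and the dimensions add up.) -/
def morseIndex (c k Ω : ℝ) (U A : H2) : ℕ :=
  Module.finrank ℝ ↥(⨆ μ : Set.Iio (0 : ℝ), eigenspace c k Ω U A μ)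

/-- The nullity index: the multiplicity of the zero eigenvalue. -/
def nullityIndex (c k Ω : ℝ) (U A : H2) : ℕ :=
  Module.finrank ℝ ↥(eigenspace c k Ω U A 0)

/-! ### The bifurcating branch -/

/-- `W = L₁⁻¹ g̃²`, where `L₁` is taken at the uncoupled soliton and is inverted on even
functions. -/
def IsInvGTildeSq {c : ℝ} (hc : 0 < c) (k : ℝ) (W : H2) : Prop :=
  IsEven W ∧ ⇑(L₁ c (U₀ hc) W) =ᵐ[volume] fun x => gTilde c k x ^ 2

/-- The inner product `⟨g̃², W⟩` in `L²(ℝ)`. -/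
def pairing (c k : ℝ) (W : H2) : ℝ := ∫ x, gTilde c k x ^ 2 * D 0 W x

/-- The profile `(U, A) ∈ H²_even(ℝ) × H²_odd(ℝ)` is a solitary wave
`U'' - c U + U²/2 + A² = 0`, `A'' + (Ω + k U) A = 0` of the second bifurcating branch: it is
coupled (`A ≠ 0`), and it is near the uncoupled soliton in the sense of the bounds with `C`. -/
structure IsSecondBranch {c : ℝ} (hc : 0 < c) (k C Ω : ℝ) (U A : H2) : Prop where
  even : IsEven U
  odd : IsOdd A
  eq_U : D 2 U - c • D 0 U + (1 / 2 : ℝ) • D 0 U ^ 2 + D 0 A ^ 2 = 0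
  eq_A : D 2 A + Ω • D 0 A + k • (D 0 U * D 0 A) = 0
  coupled : A ≠ 0
  near_U : ‖U - U₀ hc‖ ≤ C * |Ω - Ωc2 c k|
  near_A : ‖A‖ ≤ C * √|Ω - Ωc2 c k|

end KdVLS

end

/-!
Put `κ = √c / 2`. At the uncoupled soliton the operators `L₁` and `-∂² - Ω̃ - k U₀` are the
Pöschl–Teller operators `T ν = -∂² + (ν - 1)² κ² - ν (ν + 1) κ² sech² (κ ξ)` with `ν = 3` and with
`ν (ν + 1) = 12 k`. The ladder operators `∂ + m κ tanh` factor them, and show that the ground state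
`sech ^ ν`, with energy `-(2 ν - 1) κ²`, and the excited state `sech ^ (ν - 1) tanh`, with energy
`0`, are their only modes of nonpositive energy: on the complement of the two the form of `T ν` is
coercive (`exists_poschl_form_ge`). This gives the Fredholm alternative, also within the even or the
odd functions.

For the existence of the branch, `U = U₀ + t w` and `A = √t (g̃ + t χ)` with `Ω - Ω̃ = t θ` turn the
system into a regular perturbation problem for `(w, χ, θ)`, which is solvable at `t = 0` with `w = W`
and `θ = -k P / ‖g̃‖²`, where `P = ⟨g̃², L₁⁻¹ g̃²⟩`; the implicit function theorem continues the
solution (`exists_branch`). Conversely, every solution that satisfies the bounds has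
`A = a (g̃ + o(1))` and `U - U₀ = a² (W + o(1))` for a small amplitude `a ≠ 0`
(`eventually_branch_expansion`).

At such a solution the Hessian is a small perturbation of `T 3 ⊕ (2/k) T ν ⊕ (2/k) T ν`, whose modes
of nonpositive energy are six in number. Three are negative, and remain so. Of the three in the kernel,
two stay there: `(U', A', 0)` by translation invariance (`exists_translation_mode`), and `(0, 0, A)`
by the equation for `A`. The third, `(0, g̃, 0)`, becomes an eigenvector `(ψ, z, 0)` with an
eigenvalue `μ`, in the sector of even first and odd second components. Pairing it with
`(2 (U - U₀), A, 0)`, which the Hessian maps to `(-(U - U₀)², -4 A (U - U₀), 0)`, gives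
`μ (‖g̃‖² + o(1)) = -a² (4 P + o(1))` (`eigenvalue_mul_eq_of_expansion`), so that `μ` has the sign of
`-P`. The six perturbed modes are orthogonal to each other, and the Hessian is positive on their
complement; hence they account for all nonpositive eigenvalues (`finrank_eigenspaces`).
-/

noncomputable section

namespace KdVLS

open Filter Topology Set

/-! ### Weak derivatives on the line -/

theorem locallyIntegrable_L2 (f : RealL2) : LocallyIntegrable (f : ℝ → ℝ) :=
  (Lp.memLp f).locallyIntegrable (by norm_num)

theorem exists_Ioc_of_hasCompactSupport {φ : ℝ → ℝ} (hs : HasCompactSupport φ) :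
    ∃ R : ℝ, 0 < R ∧ tsupport φ ⊆ Ioo (-R) R := by
  obtain ⟨R, hR⟩ := hs.isCompact.isBounded.subset_ball (0 : ℝ)
  refine ⟨max R 1, by positivity, hR.trans ?_⟩
  rw [Real.ball_eq_Ioo]
  apply Ioo_subset_Ioo <;> simp

/-- Integration by parts of a primitive of a locally integrable function against a test
function. -/
theorem integral_primitive_mul_deriv {g : ℝ → ℝ} (hg : LocallyIntegrable g) {φ : ℝ → ℝ}
    (hφ : ContDiff ℝ ∞ φ) (hs : HasCompactSupport φ) :
    ∫ x, (∫ t in (0 : ℝ)..x, g t) * deriv φ x = -∫ x, g x * φ x := by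
  obtain ⟨R, hR, hsub⟩ := exists_Ioc_of_hasCompactSupport hs
  have hs1 : Function.support (fun x => (∫ t in (0 : ℝ)..x, g t) * deriv φ x) ⊆ Ioc (-R) R := by
    refine (Function.support_mul_subset_right _ _).trans ?_
    exact (support_deriv_subset.trans hsub).trans Ioo_subset_Ioc_self
  have hs2 : Function.support (fun x => g x * φ x) ⊆ Ioc (-R) R := by
    refine (Function.support_mul_subset_right _ _).trans ?_
    exact ((subset_tsupport φ).trans hsub).trans Ioo_subset_Ioc_self
  rw [← intervalIntegral.integral_eq_integral_of_support_subset hs1,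
    ← intervalIntegral.integral_eq_integral_of_support_subset hs2]
  have hgi : IntervalIntegrable g volume (-R) R :=
    (hg.integrableOn_isCompact isCompact_uIcc).intervalIntegrable
  have hG : AbsolutelyContinuousOnInterval (fun x => ∫ t in (0 : ℝ)..x, g t) (-R) R :=
    hgi.absolutelyContinuousOnInterval_intervalIntegral
      (by rw [uIcc_of_le (by linarith)]; constructor <;> linarith)
  have hφ' : AbsolutelyContinuousOnInterval φ (-R) R :=
    (hφ.of_le (by simp)).contDiffOn.absolutelyContinuousOnInterval
  have hend : ∀ y, y ∉ Ioo (-R) R → φ y = 0 := fun y hy =>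
    image_eq_zero_of_notMem_tsupport fun h => hy (hsub h)
  rw [hG.integral_mul_deriv_eq_deriv_mul hφ', hend R (by simp), hend (-R) (by simp)]
  simp only [mul_zero, sub_zero, zero_sub, neg_inj]
  refine intervalIntegral.integral_congr_ae ?_
  filter_upwards [_root_.LocallyIntegrable.ae_hasDerivAt_integral hg] with x hx _
  rw [(hx 0).deriv]

/-- The du Bois-Reymond lemma: a locally integrable function with vanishing weak derivative is
constant. -/
theorem exists_ae_eq_const_of_weakDeriv_zero {h : ℝ → ℝ} (hh : LocallyIntegrable h)
    (h0 : ∀ φ : ℝ → ℝ, ContDiff ℝ ∞ φ → HasCompactSupport φ → ∫ x, h x * deriv φ x = 0) :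
    ∃ C : ℝ, ∀ᵐ x : ℝ, h x = C := by
  let b : ContDiffBump (0 : ℝ) := ⟨1, 2, by norm_num, by norm_num⟩
  set ρ : ℝ → ℝ := b.normed volume with hρ
  have hρc : ContDiff ℝ ∞ ρ := b.contDiff_normed
  have hρs : HasCompactSupport ρ := b.hasCompactSupport_normed
  have hρ1 : ∫ x, ρ x = 1 := b.integral_normed
  refine ⟨∫ x, h x * ρ x, ?_⟩
  set C := ∫ x, h x * ρ x
  have hint : ∀ ψ : ℝ → ℝ, Continuous ψ → HasCompactSupport ψ →
      Integrable (fun x => h x * ψ x) := fun ψ hψ hs => by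
    simpa [mul_comm] using hh.integrable_smul_left_of_hasCompactSupport hψ hs
  have key : ∀ᵐ x : ℝ, h x - C = 0 := by
    refine ae_eq_zero_of_integral_contDiff_smul_eq_zero
      (hh.sub (locallyIntegrable_const C)) fun ψ hψ hψs => ?_
    set I := ∫ x, ψ x
    -- `ψ - I ρ` has integral zero, so that it has a compactly supported primitive
    set θ : ℝ → ℝ := fun x => ψ x - I * ρ x with hθ
    have hθc : ContDiff ℝ ∞ θ := hψ.sub (contDiff_const.mul hρc)
    have hθs : HasCompactSupport θ := hψs.sub (hρs.mul_left)
    have hθi : Integrable θ := hθc.continuous.integrable_of_hasCompactSupport hθs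
    obtain ⟨R, hR, hsub⟩ := exists_Ioc_of_hasCompactSupport hθs
    have hz : ∀ y, y ∉ Ioo (-R) R → θ y = 0 := fun y hy =>
      image_eq_zero_of_notMem_tsupport fun h => hy (hsub h)
    set φ : ℝ → ℝ := fun x => ∫ t in (-R)..x, θ t with hφ
    have hd : ∀ x, HasDerivAt φ (θ x) x := fun x =>
      (hθc.continuous.integral_hasStrictDerivAt (-R) x).hasDerivAt
    have hderiv : deriv φ = θ := funext fun x => (hd x).deriv
    have hφc : ContDiff ℝ ∞ φ := by
      rw [contDiff_infty_iff_deriv, hderiv]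
      exact ⟨fun x => (hd x).differentiableAt, hθc⟩
    have htot : ∫ x, θ x = 0 := by
      rw [hθ, integral_sub (hψ.continuous.integrable_of_hasCompactSupport hψs)
        ((hρc.continuous.integrable_of_hasCompactSupport hρs).const_mul _),
        integral_const_mul, hρ1, mul_one, sub_self]
    have hφs : HasCompactSupport φ := by
      refine HasCompactSupport.intro (isCompact_Icc (a := -R) (b := R)) fun x hx => ?_
      simp only [mem_Icc, not_and_or, not_le] at hx
      rcases hx with hx | hx
      · have : ∀ t ∈ uIcc (-R) x, θ t = 0 := fun t ht => hz t (by
          rw [uIcc_of_ge hx.le] at ht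
          simp only [mem_Ioo, not_and_or, not_lt]; exact Or.inl ht.2)
        show ∫ t in (-R)..x, θ t = 0
        rw [intervalIntegral.integral_congr this]
        simp
      · show ∫ t in (-R)..x, θ t = 0
        rw [intervalIntegral.integral_eq_integral_of_support_subset, htot]
        refine ((subset_tsupport θ).trans hsub).trans fun y hy => ⟨hy.1, hy.2.le.trans hx.le⟩
    have e := h0 φ hφc hφs
    rw [hderiv] at e
    have e1 : ∫ x, h x * θ x = (∫ x, h x * ψ x) - I * C := by
      rw [← integral_const_mul, ← integral_sub (hint ψ hψ.continuous hψs)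
        ((hint ρ hρc.continuous hρs).const_mul I)]
      congr 1
      ext x
      simp only [hθ]
      ring
    have e2 : ∫ x, ψ x • (h x - C) = (∫ x, h x * ψ x) - I * C := by
      rw [show I * C = ∫ x, ψ x * C from (integral_mul_const _ _).symm,
        ← integral_sub (hint ψ hψ.continuous hψs)
        ((hψ.continuous.integrable_of_hasCompactSupport hψs).mul_const C)]
      congr 1
      ext x
      simp only [smul_eq_mul]
      ring
    rw [e2, ← e1, e]
  filter_upwards [key] with x hx
  linarith

/-- A function with a weak derivative is a.e. equal to a primitive of it. -/
theorem HasWeakDeriv.exists_primitive {f g : RealL2} (h : HasWeakDeriv f g) :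
    ∃ C : ℝ, ∀ᵐ x : ℝ, f x = C + ∫ t in (0 : ℝ)..x, g t := by
  have hg := locallyIntegrable_L2 g
  have hGc : Continuous (fun x => ∫ t in (0 : ℝ)..x, g t) :=
    intervalIntegral.continuous_primitive
      (fun a b => (hg.integrableOn_isCompact isCompact_uIcc).intervalIntegrable) 0
  obtain ⟨C, hC⟩ := exists_ae_eq_const_of_weakDeriv_zero
    (h := fun x => f x - ∫ t in (0 : ℝ)..x, g t)
    ((locallyIntegrable_L2 f).sub hGc.locallyIntegrable) (by
      intro φ hφ hs
      have hd : Continuous (deriv φ) := hφ.continuous_deriv (by simp)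
      have e := integral_primitive_mul_deriv hg hφ hs
      have e' := h φ hφ hs
      have hi : Integrable (fun x => (∫ t in (0 : ℝ)..x, g t) * deriv φ x) :=
        (hGc.mul hd).integrable_of_hasCompactSupport hs.deriv.mul_left
      calc ∫ x, (f x - ∫ t in (0 : ℝ)..x, g t) * deriv φ x
          = ∫ x, (f x * deriv φ x - (∫ t in (0 : ℝ)..x, g t) * deriv φ x) := by
            congr 1; ext x; ring
        _ = 0 := by rw [integral_sub (integrable_mul_test f hd hs.deriv) hi, e, e', sub_self])
  exact ⟨C, by filter_upwards [hC] with x hx; linarith⟩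

theorem integral_abs_le_norm_mul_sqrt (g : RealL2) {a b : ℝ} (hab : a ≤ b) :
    ∫ t in a..b, |g t| ≤ √(b - a) * ‖g‖ := by
  have h1 : MemLp (indicator (Ioc a b) (fun _ : ℝ => (1 : ℝ))) 2 volume :=
    memLp_indicator_const 2 measurableSet_Ioc 1 (Or.inr (by simp))
  have hg2 : MemLp (fun t => ‖g t‖) 2 volume := (Lp.memLp g).norm
  have hn : ‖hg2.toLp _‖ = ‖g‖ := by
    rw [Lp.norm_toLp, Lp.norm_def, eLpNorm_norm]
  have hn1 : ‖h1.toLp _‖ = √(b - a) := by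
    have := norm_indicatorConstLp (μ := (volume : Measure ℝ)) (p := 2)
      (hs := measurableSet_Ioc (a := a) (b := b)) (hμs := by simp) (c := (1 : ℝ))
      (by simp) (by simp)
    rw [indicatorConstLp] at this
    rw [this]
    simp [Measure.real, hab, Real.sqrt_eq_rpow]
  have h := real_inner_le_norm (h1.toLp _) (hg2.toLp _)
  rw [hn, hn1, L2.inner_def] at h
  refine le_trans (le_of_eq ?_) h
  rw [intervalIntegral.integral_of_le hab, ← integral_indicator measurableSet_Ioc]
  refine integral_congr_ae ?_
  filter_upwards [h1.coeFn_toLp, hg2.coeFn_toLp] with x h1 h2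
  rw [h1, h2]
  by_cases hx : x ∈ Ioc a b <;> simp [hx]

/-- The Sobolev bound for a continuous function with a weak derivative. -/
theorem abs_le_of_primitive {f g : RealL2} {F : ℝ → ℝ} (hF : ∀ᵐ x, f x = F x)
    (hFg : ∀ x y : ℝ, F y - F x = ∫ t in x..y, g t) (hFc : Continuous F) (x : ℝ) :
    |F x| ≤ ‖f‖ + ‖g‖ := by
  have h1 : ∀ y ∈ Icc x (x + 1), |F x| - ‖g‖ ≤ |F y| := by
    intro y hy
    have e : |F y - F x| ≤ ‖g‖ := by
      rw [hFg]
      refine (intervalIntegral.abs_integral_le_integral_abs hy.1).trans ?_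
      refine (integral_abs_le_norm_mul_sqrt g hy.1).trans ?_
      have : √(y - x) ≤ 1 := by
        rw [Real.sqrt_le_left (by norm_num)]
        linarith [hy.2]
      nlinarith [norm_nonneg g]
    have := abs_sub_abs_le_abs_sub (F x) (F y)
    rw [abs_sub_comm] at this
    linarith
  have h2 : |F x| - ‖g‖ ≤ ∫ t in x..(x + 1), |F t| := by
    have := intervalIntegral.integral_mono_on (a := x) (b := x + 1) (by linarith)
      (by simp) (hFc.abs.intervalIntegrable _ _) h1 (μ := volume) (f := fun _ => |F x| - ‖g‖)
    simpa using this
  have h3 : ∫ t in x..(x + 1), |F t| = ∫ t in x..(x + 1), |f t| := by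
    refine intervalIntegral.integral_congr_ae ?_
    filter_upwards [hF] with t ht _
    rw [ht]
  have h4 := integral_abs_le_norm_mul_sqrt f (show x ≤ x + 1 by linarith)
  simp at h4
  linarith

/-- A function with a weak derivative has a continuous representative, bounded by the Sobolev
norm. -/
theorem HasWeakDeriv.exists_continuous {f g : RealL2} (h : HasWeakDeriv f g) :
    ∃ F : ℝ → ℝ, Continuous F ∧ (∀ᵐ x, f x = F x) ∧ (∀ x y : ℝ, F y - F x = ∫ t in x..y, g t) ∧
      ∀ x, |F x| ≤ ‖f‖ + ‖g‖ := by
  obtain ⟨C, hC⟩ := h.exists_primitive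
  have hg := locallyIntegrable_L2 g
  have hgi : ∀ a b, IntervalIntegrable (g : ℝ → ℝ) volume a b :=
    fun a b => (hg.integrableOn_isCompact isCompact_uIcc).intervalIntegrable
  have hGc : Continuous (fun x => C + ∫ t in (0 : ℝ)..x, g t) :=
    continuous_const.add (intervalIntegral.continuous_primitive hgi 0)
  have hd : ∀ x y : ℝ, (C + ∫ t in (0 : ℝ)..y, g t) - (C + ∫ t in (0 : ℝ)..x, g t)
      = ∫ t in x..y, g t := fun x y => by
    rw [add_sub_add_left_eq_sub, intervalIntegral.integral_interval_sub_left (hgi _ _) (hgi _ _)]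
  exact ⟨_, hGc, hC, hd, abs_le_of_primitive hC hd hGc⟩

theorem HasWeakDeriv.hasDerivAt_of_continuous {F G : ℝ → ℝ} {g : RealL2}
    (hFg : ∀ x y : ℝ, F y - F x = ∫ t in x..y, g t) (hG : Continuous G)
    (hgG : ∀ᵐ x, g x = G x) (x : ℝ) : HasDerivAt F (G x) x := by
  have e : F = fun y => F 0 + ∫ t in (0 : ℝ)..y, G t := by
    ext y
    have : ∫ t in (0 : ℝ)..y, G t = ∫ t in (0 : ℝ)..y, g t :=
      intervalIntegral.integral_congr_ae (by filter_upwards [hgG] with t ht _; rw [ht])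
    rw [this, ← hFg]
    ring
  rw [e]
  exact (hG.integral_hasStrictDerivAt 0 x).hasDerivAt.const_add _

/-! ### The Hilbert spaces `H¹(ℝ)` and `H²(ℝ)` -/

theorem inner_L2_eq (f g : RealL2) : inner ℝ f g = ∫ x, f x * g x := by
  rw [L2.inner_def]
  congr 1
  ext x
  simp [mul_comm]

/-- A test function as an element of `L²(ℝ)`. -/
def testL2 (φ : ℝ → ℝ) (hφ : Continuous φ) (hs : HasCompactSupport φ) : RealL2 :=
  (hφ.memLp_of_hasCompactSupport hs).toLp φ

theorem inner_testL2 (f : RealL2) {φ : ℝ → ℝ} (hφ : Continuous φ) (hs : HasCompactSupport φ) :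
    inner ℝ f (testL2 φ hφ hs) = ∫ x, f x * φ x := by
  rw [inner_L2_eq]
  refine integral_congr_ae ?_
  filter_upwards [(hφ.memLp_of_hasCompactSupport (p := 2) (μ := volume) hs).coeFn_toLp] with x hx
  rw [testL2, hx]

theorem hasWeakDeriv_iff_inner {f g : RealL2} : HasWeakDeriv f g ↔
    ∀ (φ : ℝ → ℝ) (hφ : ContDiff ℝ ∞ φ) (hs : HasCompactSupport φ),
      inner ℝ f (testL2 (deriv φ) (hφ.continuous_deriv (by simp)) hs.deriv) +
        inner ℝ g (testL2 φ hφ.continuous hs) = 0 := by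
  refine forall_congr' fun φ => forall_congr' fun hφ => forall_congr' fun hs => ?_
  rw [inner_testL2, inner_testL2, eq_neg_iff_add_eq_zero]

theorem isClosed_hasWeakDeriv : IsClosed {p : RealL2 × RealL2 | HasWeakDeriv p.1 p.2} := by
  simp only [hasWeakDeriv_iff_inner, ofPred_forall]
  refine isClosed_iInter fun φ => isClosed_iInter fun hφ => isClosed_iInter fun hs => ?_
  exact isClosed_eq (by fun_prop) continuous_const

/-- The Sobolev space `H¹(ℝ)`, encoded in the same way as `H²(ℝ)`. -/
def H1 : Submodule ℝ (PiLp 2 (fun _ : Fin 2 => RealL2)) where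
  carrier := {u | HasWeakDeriv (u 0) (u 1)}
  add_mem' hu hv := hu.add hv
  zero_mem' := hasWeakDeriv_zero
  smul_mem' a _ hu := hu.smul a

theorem isClosed_H1 : IsClosed (H1 : Set (PiLp 2 (fun _ : Fin 2 => RealL2))) :=
  isClosed_hasWeakDeriv.preimage
    (f := fun u : PiLp 2 (fun _ : Fin 2 => RealL2) => (u 0, u 1)) (by fun_prop)

theorem isClosed_H2 : IsClosed (H2 : Set (PiLp 2 (fun _ : Fin 3 => RealL2))) :=
  (isClosed_hasWeakDeriv.preimage
    (f := fun u : PiLp 2 (fun _ : Fin 3 => RealL2) => (u 0, u 1)) (by fun_prop)).inter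
  (isClosed_hasWeakDeriv.preimage
    (f := fun u : PiLp 2 (fun _ : Fin 3 => RealL2) => (u 1, u 2)) (by fun_prop))

instance : CompleteSpace H1 := isClosed_H1.completeSpace_coe

instance : CompleteSpace H2 := isClosed_H2.completeSpace_coe

/-- The `j`-th weak derivative as a bounded operator from `H¹` to `L²`. -/
def d1 (j : Fin 2) : H1 →L[ℝ] RealL2 :=
  (PiLp.proj (𝕜 := ℝ) 2 (fun _ : Fin 2 => RealL2) j).comp H1.subtypeL

/-- The `j`-th weak derivative as a bounded operator from `H²` to `L²`. -/
def d2 (j : Fin 3) : H2 →L[ℝ] RealL2 :=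
  (PiLp.proj (𝕜 := ℝ) 2 (fun _ : Fin 3 => RealL2) j).comp H2.subtypeL

theorem D_eq (j : Fin 3) (u : H2) : D j u = (d2 j u : RealL0) := rfl

/-- An element of `H¹` from a function and its weak derivative. -/
def H1.mk' (f g : RealL2) (h : HasWeakDeriv f g) : H1 := ⟨WithLp.toLp 2 ![f, g], h⟩

/-- An element of `H²` from a function and its weak derivatives. -/
def H2.mk' (f g h : RealL2) (h₁ : HasWeakDeriv f g) (h₂ : HasWeakDeriv g h) : H2 :=
  ⟨WithLp.toLp 2 ![f, g, h], h₁, h₂⟩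

@[simp] theorem d1_zero_mk' {f g : RealL2} (h : HasWeakDeriv f g) : d1 0 (H1.mk' f g h) = f := rfl
@[simp] theorem d1_one_mk' {f g : RealL2} (h : HasWeakDeriv f g) : d1 1 (H1.mk' f g h) = g := rfl
@[simp] theorem d2_zero_mk' {f g h : RealL2} (h₁ : HasWeakDeriv f g) (h₂ : HasWeakDeriv g h) :
    d2 0 (H2.mk' f g h h₁ h₂) = f := rfl
@[simp] theorem d2_two_mk' {f g h : RealL2} (h₁ : HasWeakDeriv f g) (h₂ : HasWeakDeriv g h) :
    d2 2 (H2.mk' f g h h₁ h₂) = h := rfl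

theorem H1.hasWeakDeriv (u : H1) : HasWeakDeriv (d1 0 u) (d1 1 u) := u.2
theorem H2.hasWeakDeriv₁ (u : H2) : HasWeakDeriv (d2 0 u) (d2 1 u) := u.2.1
theorem H2.hasWeakDeriv₂ (u : H2) : HasWeakDeriv (d2 1 u) (d2 2 u) := u.2.2

theorem H1.norm_sq (u : H1) : ‖u‖ ^ 2 = ‖d1 0 u‖ ^ 2 + ‖d1 1 u‖ ^ 2 := by
  rw [Submodule.coe_norm, PiLp.norm_sq_eq_of_L2, Fin.sum_univ_two]
  rfl

theorem H2.norm_sq (u : H2) : ‖u‖ ^ 2 = ‖d2 0 u‖ ^ 2 + ‖d2 1 u‖ ^ 2 + ‖d2 2 u‖ ^ 2 := by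
  rw [Submodule.coe_norm, PiLp.norm_sq_eq_of_L2, Fin.sum_univ_three]
  rfl

theorem H1.inner_eq (u v : H1) :
    inner ℝ u v = inner ℝ (d1 0 u) (d1 0 v) + inner ℝ (d1 1 u) (d1 1 v) := by
  rw [Submodule.coe_inner, PiLp.inner_apply, Fin.sum_univ_two]
  rfl

theorem H2.norm_d2_le (j : Fin 3) (u : H2) : ‖d2 j u‖ ≤ ‖u‖ :=
  PiLp.norm_apply_le (u : PiLp 2 (fun _ : Fin 3 => RealL2)) j

theorem HasWeakDeriv.unique {f g g' : RealL2} (h : HasWeakDeriv f g) (h' : HasWeakDeriv f g') :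
    g = g' := by
  refine Lp.ext ?_
  refine ae_eq_of_integral_contDiff_smul_eq (locallyIntegrable_L2 g) (locallyIntegrable_L2 g')
    fun φ hφ hs => ?_
  have e := (h φ hφ hs).symm.trans (h' φ hφ hs)
  simp only [smul_eq_mul, mul_comm (φ _)]
  linarith

/-- An element of `H²` is determined by its function. -/
theorem d2_zero_injective : Function.Injective (d2 0) := by
  intro u v h
  have h₁ : d2 1 u = d2 1 v := by
    have := (H2.hasWeakDeriv₁ u)
    rw [h] at this
    exact this.unique (H2.hasWeakDeriv₁ v)
  have h₂ : d2 2 u = d2 2 v := by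
    have := (H2.hasWeakDeriv₂ u)
    rw [h₁] at this
    exact this.unique (H2.hasWeakDeriv₂ v)
  refine Subtype.ext (PiLp.ext fun j => ?_)
  fin_cases j
  exacts [h, h₁, h₂]

/-- The inclusion of `H²` in `H¹`. -/
def H2.toH1 (u : H2) : H1 := H1.mk' (d2 0 u) (d2 1 u) (H2.hasWeakDeriv₁ u)

/-- A test function as an element of `H¹`. -/
def testH1 (φ : ℝ → ℝ) (hφ : ContDiff ℝ ∞ φ) (hs : HasCompactSupport φ) : H1 :=
  H1.mk' (testL2 φ hφ.continuous hs)
    (testL2 (deriv φ) (hφ.continuous_deriv (by simp)) hs.deriv)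
    (hasWeakDeriv_of_hasDerivAt (fun x => (hφ.differentiable (by simp) x).hasDerivAt) _ _)

theorem eq_zero_of_abs_le_exp {a M : ℝ} (h : ∀ x : ℝ, |a| ≤ M * Real.exp x) : a = 0 := by
  have ht : Tendsto (fun x : ℝ => M * Real.exp x) atBot (𝓝 (M * 0)) :=
    Real.tendsto_exp_atBot.const_mul M
  have := ge_of_tendsto' ht h
  rw [mul_zero] at this
  exact abs_nonpos_iff.1 this

/-- An element of `H¹` with `u'' = u` vanishes: it is a combination of `eˣ` and `e⁻ˣ`, and
it is bounded. -/
theorem H1.eq_zero_of_weakDeriv {u : H1} (h : HasWeakDeriv (d1 1 u) (d1 0 u)) : u = 0 := by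
  obtain ⟨F, hFc, hF, hFd, hFb⟩ := (H1.hasWeakDeriv u).exists_continuous
  obtain ⟨G, hGc, hG, hGd, hGb⟩ := h.exists_continuous
  have dF := HasWeakDeriv.hasDerivAt_of_continuous hFd hGc hG
  have dG := HasWeakDeriv.hasDerivAt_of_continuous hGd hFc hF
  have const : ∀ H : ℝ → ℝ, (∀ x, HasDerivAt H 0 x) → ∀ x, H x = H 0 := fun H hH x =>
    is_const_of_deriv_eq_zero (fun y => (hH y).differentiableAt) (fun y => (hH y).deriv) x 0
  have c₁ := const (fun x => (F x - G x) * Real.exp x) fun x => by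
    refine (((dF x).sub (dG x)).mul (Real.hasDerivAt_exp x)).congr_deriv ?_
    simp only [Pi.sub_apply]
    ring
  have c₂ := const (fun x => (F x + G x) * Real.exp (-x)) fun x => by
    refine (((dF x).add (dG x)).mul ((hasDerivAt_neg x).exp)).congr_deriv ?_
    simp only [Pi.add_apply]
    ring
  simp only [neg_zero, Real.exp_zero, mul_one] at c₁ c₂
  set M := (‖d1 0 u‖ + ‖d1 1 u‖) + (‖d1 1 u‖ + ‖d1 0 u‖)
  have z₁ : F 0 - G 0 = 0 := eq_zero_of_abs_le_exp (M := M) fun x => by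
    rw [← c₁ x, abs_mul, Real.abs_exp]
    gcongr
    exact (abs_sub _ _).trans (add_le_add (hFb x) (hGb x))
  have z₂ : F 0 + G 0 = 0 := eq_zero_of_abs_le_exp (M := M) fun x => by
    rw [← c₂ (-x), abs_mul, Real.abs_exp, neg_neg]
    gcongr
    exact (abs_add_le _ _).trans (add_le_add (hFb _) (hGb _))
  have hF0 : ∀ x, F x = 0 ∧ G x = 0 := fun x => by
    have h₁ : F x - G x = 0 := by
      have := c₁ x
      rw [z₁] at this
      exact (mul_eq_zero.1 this).resolve_right (Real.exp_pos _).ne'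
    have h₂ : F x + G x = 0 := by
      have := c₂ x
      rw [z₂] at this
      exact (mul_eq_zero.1 this).resolve_right (Real.exp_pos _).ne'
    constructor <;> linarith
  refine Subtype.ext (PiLp.ext fun j => ?_)
  fin_cases j
  · refine Lp.ext ?_
    filter_upwards [hF, Lp.coeFn_zero ℝ 2 (volume : Measure ℝ)] with x hx h0
    exact hx.trans ((hF0 x).1.trans h0.symm)
  · refine Lp.ext ?_
    filter_upwards [hG, Lp.coeFn_zero ℝ 2 (volume : Measure ℝ)] with x hx h0
    exact hx.trans ((hF0 x).2.trans h0.symm)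

/-- A bounded operator on `H¹` that vanishes at all test functions is zero. -/
theorem H1.eq_zero_of_testH1 {ℓ : H1 →L[ℝ] ℝ}
    (h : ∀ φ hφ hs, ℓ (testH1 φ hφ hs) = 0) : ℓ = 0 := by
  obtain ⟨u, rfl⟩ := (InnerProductSpace.toDual ℝ H1).surjective ℓ
  simp only [InnerProductSpace.toDual_apply_apply] at h
  have hu : u = 0 := by
    refine H1.eq_zero_of_weakDeriv (hasWeakDeriv_iff_inner.2 fun φ hφ hs => ?_)
    have := h φ hφ hs
    rw [H1.inner_eq] at this
    rw [add_comm]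
    exact this
  rw [hu]
  exact (InnerProductSpace.toDual ℝ H1).toLinearEquiv.map_zero

theorem H1.inner_deriv_left (u v : H1) :
    inner ℝ (d1 1 u) (d1 0 v) = -inner ℝ (d1 0 u) (d1 1 v) := by
  have := H1.eq_zero_of_testH1
    (ℓ := (innerSL ℝ (d1 1 u)).comp (d1 0) + (innerSL ℝ (d1 0 u)).comp (d1 1)) (by
      intro φ hφ hs
      have := hasWeakDeriv_iff_inner.1 (H1.hasWeakDeriv u) φ hφ hs
      rw [add_comm] at this
      exact this)
  have := congrArg (fun ℓ : H1 →L[ℝ] ℝ => ℓ v) this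
  simp only [add_apply, ContinuousLinearMap.comp_apply, innerSL_apply_apply, zero_apply] at this
  linarith

theorem H2.inner_d2_two (u v : H2) :
    inner ℝ (d2 2 u) (d2 0 v) = -inner ℝ (d2 1 u) (d2 1 v) :=
  H1.inner_deriv_left (H1.mk' (d2 1 u) (d2 2 u) (H2.hasWeakDeriv₂ u)) (H2.toH1 v)

theorem H2.inner_d2_two_symm (u v : H2) :
    inner ℝ (d2 2 u) (d2 0 v) = inner ℝ (d2 0 u) (d2 2 v) := by
  rw [H2.inner_d2_two, real_inner_comm (d2 2 v), H2.inner_d2_two, real_inner_comm]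

/-- `-∂² + 1` is surjective from `H²` to `L²`: the solution of `-u'' + u = f` is the orthogonal
projection of `(f, 0)` to `H¹`. -/
theorem exists_neg_d2_two_add (f : RealL2) : ∃ u : H2, -d2 2 u + d2 0 u = f := by
  set x : PiLp 2 (fun _ : Fin 2 => RealL2) := WithLp.toLp 2 ![f, 0] with hx
  set u : H1 := H1.orthogonalProjectionOnto x with hu
  have hw : HasWeakDeriv (d1 1 u) (d1 0 u - f : RealL2) := by
    refine hasWeakDeriv_iff_inner.2 fun φ hφ hs => ?_
    have h := H1.inner_orthogonalProjectionOnto_eq_of_mem_right (testH1 φ hφ hs) x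
    rw [← hu, H1.inner_eq, PiLp.inner_apply, Fin.sum_univ_two] at h
    have e : inner ℝ (d1 0 u) (testL2 φ hφ.continuous hs)
        + inner ℝ (d1 1 u) (testL2 (deriv φ) (hφ.continuous_deriv (by simp)) hs.deriv)
        = inner ℝ f (testL2 φ hφ.continuous hs)
        + inner ℝ (0 : RealL2) (testL2 (deriv φ) (hφ.continuous_deriv (by simp)) hs.deriv) := h
    rw [inner_zero_left] at e
    rw [inner_sub_left]
    linarith
  exact ⟨H2.mk' (d1 0 u) (d1 1 u) (d1 0 u - f) (H1.hasWeakDeriv u) hw, by simp⟩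

/-! ### Multiplication operators -/

/-- Multiplication of an essentially bounded and a square-integrable function. -/
def mulOp : Lp ℝ ⊤ (volume : Measure ℝ) →L[ℝ] RealL2 →L[ℝ] RealL2 :=
  (ContinuousLinearMap.mul ℝ ℝ).holderL volume ⊤ 2 2

theorem coeFn_mulOp (a : Lp ℝ ⊤ (volume : Measure ℝ)) (f : RealL2) :
    mulOp a f =ᵐ[volume] fun x => a x * f x := by
  simpa [mulOp] using (ContinuousLinearMap.mul ℝ ℝ).coeFn_holder (r := 2) a f

theorem inner_mulOp (a : Lp ℝ ⊤ (volume : Measure ℝ)) (f g : RealL2) :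
    inner ℝ (mulOp a f) g = inner ℝ f (mulOp a g) := by
  rw [inner_L2_eq, inner_L2_eq]
  refine integral_congr_ae ?_
  filter_upwards [coeFn_mulOp a f, coeFn_mulOp a g] with x h₁ h₂
  rw [h₁, h₂]
  ring

/-- A bounded continuous function as an essentially bounded function. -/
def bddLinf (b : ℝ → ℝ) (hb : Continuous b) (M : ℝ) (hM : ∀ x, |b x| ≤ M) :
    Lp ℝ ⊤ (volume : Measure ℝ) :=
  (memLp_top_of_bound hb.aestronglyMeasurable M (Eventually.of_forall hM)).toLp b

theorem coeFn_mulOp_bddLinf (b : ℝ → ℝ) (hb : Continuous b) (M : ℝ) (hM : ∀ x, |b x| ≤ M)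
    (f : RealL2) : mulOp (bddLinf b hb M hM) f =ᵐ[volume] fun x => b x * f x := by
  filter_upwards [coeFn_mulOp (bddLinf b hb M hM) f, (memLp_top_of_bound
    hb.aestronglyMeasurable M (Eventually.of_forall hM) : MemLp b ⊤ volume).coeFn_toLp] with x h₁ h₂
  rw [h₁, bddLinf, h₂]

theorem HasWeakDeriv.memLp_top {f g : RealL2} (h : HasWeakDeriv f g) :
    MemLp (f : ℝ → ℝ) ⊤ volume := by
  obtain ⟨F, -, hF, -, hFb⟩ := h.exists_continuous
  refine memLp_top_of_bound (Lp.aestronglyMeasurable f) (‖f‖ + ‖g‖) ?_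
  filter_upwards [hF] with x hx
  rw [hx]
  exact hFb x

/-- The Sobolev embedding of `H²(ℝ)` in the bounded functions. -/
def linf : H2 →L[ℝ] Lp ℝ ⊤ (volume : Measure ℝ) :=
  LinearMap.mkContinuous
    { toFun := fun u => (H2.hasWeakDeriv₁ u).memLp_top.toLp (d2 0 u)
      map_add' := fun u v => by
        rw [← MemLp.toLp_add]
        refine MemLp.toLp_congr _ _ ?_
        rw [map_add]
        exact Lp.coeFn_add _ _
      map_smul' := fun a u => by
        rw [RingHom.id_apply, ← MemLp.toLp_const_smul]
        refine MemLp.toLp_congr _ _ ?_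
        rw [map_smul]
        exact Lp.coeFn_smul _ _ }
    2 (fun u => by
      have hb : ∀ᵐ x : ℝ, ‖d2 0 u x‖ ≤ 2 * ‖u‖ := by
        obtain ⟨F, -, hF, -, hFb⟩ := (H2.hasWeakDeriv₁ u).exists_continuous
        filter_upwards [hF] with x hx
        rw [hx, Real.norm_eq_abs]
        linarith [hFb x, H2.norm_d2_le 0 u, H2.norm_d2_le 1 u]
      simp only [LinearMap.coe_mk, AddHom.coe_mk, Lp.norm_toLp]
      refine ENNReal.toReal_le_of_le_ofReal (by positivity) ?_
      rw [eLpNorm_exponent_top]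
      exact eLpNormEssSup_le_of_ae_bound hb)

theorem coeFn_linf (u : H2) : linf u =ᵐ[volume] d2 0 u :=
  (H2.hasWeakDeriv₁ u).memLp_top.coeFn_toLp

/-- The multiplication `H² × L² → L²`. -/
def mulL : H2 →L[ℝ] RealL2 →L[ℝ] RealL2 := mulOp.comp linf

theorem coeFn_mulL (u : H2) (f : RealL2) : mulL u f =ᵐ[volume] fun x => d2 0 u x * f x := by
  filter_upwards [coeFn_mulOp (linf u) f, coeFn_linf u] with x h₁ h₂
  rw [← h₂, ← h₁]
  rfl

theorem coe_mulL (u : H2) (f : RealL2) :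
    ((mulL u f : RealL2) : RealL0) = D 0 u * (f : RealL0) := by
  refine AEEqFun.ext ?_
  filter_upwards [coeFn_mulL u f, AEEqFun.coeFn_mul (D 0 u) (f : RealL0)] with x h₁ h₂
  rw [h₁, h₂]
  rfl

theorem inner_mulL (u : H2) (f g : RealL2) :
    inner ℝ (mulL u f) g = inner ℝ f (mulL u g) := inner_mulOp _ _ _

theorem mulL_comm (u v : H2) : mulL u (d2 0 v) = mulL v (d2 0 u) := by
  refine Lp.ext ?_
  filter_upwards [coeFn_mulL u (d2 0 v), coeFn_mulL v (d2 0 u)] with x h₁ h₂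
  rw [h₁, h₂, mul_comm]

/-! ### Classical representatives and products -/

theorem H2.exists_classical (u : H2) : ∃ F F' : ℝ → ℝ, (∀ x, HasDerivAt F (F' x) x) ∧
    Continuous F' ∧ d2 0 u =ᵐ[volume] F ∧ d2 1 u =ᵐ[volume] F' := by
  obtain ⟨F, -, hF, hFd, -⟩ := (H2.hasWeakDeriv₁ u).exists_continuous
  obtain ⟨G, hGc, hG, -, -⟩ := (H2.hasWeakDeriv₂ u).exists_continuous
  exact ⟨F, G, HasWeakDeriv.hasDerivAt_of_continuous hFd hGc hG, hGc, hF, hG⟩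

theorem hasWeakDeriv_of_ae_eq {f g : RealL2} {F G : ℝ → ℝ} (h : ∀ x, HasDerivAt F (G x) x)
    (hf : f =ᵐ[volume] F) (hg : g =ᵐ[volume] G) : HasWeakDeriv f g := by
  have hF : MemLp F 2 volume := (memLp_congr_ae hf).1 (Lp.memLp f)
  have hG : MemLp G 2 volume := (memLp_congr_ae hg).1 (Lp.memLp g)
  have e₁ : f = hF.toLp F := Lp.ext (hf.trans hF.coeFn_toLp.symm)
  have e₂ : g = hG.toLp G := Lp.ext (hg.trans hG.coeFn_toLp.symm)
  rw [e₁, e₂]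
  exact hasWeakDeriv_of_hasDerivAt h hF hG

theorem hasWeakDeriv_mulL (u v : H2) :
    HasWeakDeriv (mulL u (d2 0 v)) (mulL u (d2 1 v) + mulL v (d2 1 u) : RealL2) := by
  obtain ⟨F, F', hF, -, eF, eF'⟩ := H2.exists_classical u
  obtain ⟨G, G', hG, -, eG, eG'⟩ := H2.exists_classical v
  refine hasWeakDeriv_of_ae_eq (fun x => (hF x).mul (hG x)) ?_ ?_
  · filter_upwards [coeFn_mulL u (d2 0 v), eF, eG] with x h₁ h₂ h₃
    rw [h₁, h₂, h₃, Pi.mul_apply]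
  · filter_upwards [Lp.coeFn_add (mulL u (d2 1 v)) (mulL v (d2 1 u)), coeFn_mulL u (d2 1 v),
      coeFn_mulL v (d2 1 u), eF, eG, eF', eG'] with x h₁ h₂ h₃ h₄ h₅ h₆ h₇
    rw [h₁, Pi.add_apply, h₂, h₃, h₄, h₅, h₆, h₇]
    ring

theorem HasWeakDeriv.smooth_mul {b b' : ℝ → ℝ} (hb : ContDiff ℝ ∞ b) (hb' : Continuous b')
    (hd : ∀ x, HasDerivAt b (b' x) x)
    {M M' : ℝ} (hM : ∀ x, |b x| ≤ M) (hM' : ∀ x, |b' x| ≤ M') {f g : RealL2}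
    (h : HasWeakDeriv f g) :
    HasWeakDeriv (mulOp (bddLinf b hb.continuous M hM) f)
      (mulOp (bddLinf b' hb' M' hM') f + mulOp (bddLinf b hb.continuous M hM) g : RealL2) := by
  intro φ hφ hs
  have hφd : ∀ x, HasDerivAt φ (deriv φ x) x := fun x =>
    (hφ.differentiable (by simp) x).hasDerivAt
  have hcd : Continuous (deriv φ) := hφ.continuous_deriv (by simp)
  have e := h (fun x => b x * φ x) (hb.mul hφ) hs.mul_left
  have ed : deriv (fun x => b x * φ x) = fun x => b' x * φ x + b x * deriv φ x :=
    funext fun x => ((hd x).mul (hφd x)).deriv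
  rw [ed] at e
  have i₁ : Integrable fun x => f x * (b' x * φ x) :=
    integrable_mul_test f (hb'.mul hφ.continuous) hs.mul_left
  have i₂ : Integrable fun x => f x * (b x * deriv φ x) :=
    integrable_mul_test f (hb.continuous.mul hcd) hs.deriv.mul_left
  have i₃ : Integrable fun x => g x * (b x * φ x) :=
    integrable_mul_test g (hb.continuous.mul hφ.continuous) hs.mul_left
  have e₁ : ∫ x, mulOp (bddLinf b hb.continuous M hM) f x * deriv φ x
      = ∫ x, f x * (b x * deriv φ x) := by
    refine integral_congr_ae ?_
    filter_upwards [coeFn_mulOp_bddLinf b hb.continuous M hM f] with x h₁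
    rw [h₁]
    ring
  have e₂ : ∫ x, (mulOp (bddLinf b' hb' M' hM') f + mulOp (bddLinf b hb.continuous M hM) g :
      RealL2) x * φ x = ∫ x, (f x * (b' x * φ x) + g x * (b x * φ x)) := by
    refine integral_congr_ae ?_
    filter_upwards [Lp.coeFn_add (mulOp (bddLinf b' hb' M' hM') f)
      (mulOp (bddLinf b hb.continuous M hM) g), coeFn_mulOp_bddLinf b hb.continuous M hM g,
      coeFn_mulOp_bddLinf b' hb' M' hM' f] with x h₁ h₂ h₃
    rw [h₁, Pi.add_apply, h₂, h₃]
    ring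
  rw [e₁, e₂, integral_add i₁ i₃]
  have e₃ : ∫ x, f x * (b' x * φ x + b x * deriv φ x)
      = (∫ x, f x * (b' x * φ x)) + ∫ x, f x * (b x * deriv φ x) := by
    rw [← integral_add i₁ i₂]
    congr 1
    ext x
    ring
  linarith

/-! ### Parity -/

/-- The reflection `f ↦ f(-·)` of `L²(ℝ)`. -/
def refl : RealL2 →ₗᵢ[ℝ] RealL2 :=
  Lp.compMeasurePreservingₗᵢ ℝ (fun x : ℝ => -x) (Measure.measurePreserving_neg volume)

theorem coeFn_refl (f : RealL2) : refl f =ᵐ[volume] fun x => f (-x) :=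
  Lp.coeFn_compMeasurePreserving f (Measure.measurePreserving_neg volume)

theorem refl_refl (f : RealL2) : refl (refl f) = f := by
  refine Lp.ext ?_
  have h := (Measure.measurePreserving_neg (volume : Measure ℝ)).quasiMeasurePreserving.ae
    (coeFn_refl f)
  filter_upwards [coeFn_refl (refl f), h] with x h₁ h₂
  rw [h₁, h₂, neg_neg]

theorem inner_refl (f g : RealL2) : inner ℝ (refl f) (refl g) = inner ℝ f g :=
  refl.inner_map_map f g

theorem HasWeakDeriv.refl {f g : RealL2} (h : HasWeakDeriv f g) :
    HasWeakDeriv (refl f) (-refl g : RealL2) := by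
  intro φ hφ hs
  have hs' : HasCompactSupport fun x : ℝ => φ (-x) :=
    hs.comp_homeomorph (Homeomorph.neg ℝ)
  have e := h (fun x => φ (-x)) (hφ.comp contDiff_neg) hs'
  have ed : deriv (fun x => φ (-x)) = fun x => -deriv φ (-x) := funext fun x => deriv_comp_neg φ x
  rw [ed] at e
  have e₁ : ∫ x, KdVLS.refl f x * deriv φ x = ∫ x, f x * deriv φ (-x) := by
    rw [← integral_neg_eq_self]
    refine integral_congr_ae ?_
    have h := (Measure.measurePreserving_neg (volume : Measure ℝ)).quasiMeasurePreserving.ae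
      (coeFn_refl f)
    filter_upwards [h] with x hx
    rw [hx, neg_neg]
  have e₂ : ∫ x, (-KdVLS.refl g : RealL2) x * φ x = -∫ x, g x * φ (-x) := by
    rw [← integral_neg, ← integral_neg_eq_self]
    refine integral_congr_ae ?_
    have h := (Measure.measurePreserving_neg (volume : Measure ℝ)).quasiMeasurePreserving.ae
      (coeFn_refl g)
    have h' := (Measure.measurePreserving_neg (volume : Measure ℝ)).quasiMeasurePreserving.ae
      (Lp.coeFn_neg (KdVLS.refl g))
    filter_upwards [h, h'] with x hx hx'
    rw [hx', Pi.neg_apply, hx, neg_neg]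
    ring
  rw [e₁, e₂]
  simp only [mul_neg, integral_neg] at e
  linarith

/-- The reflection of `H²(ℝ)`. -/
def reflH (u : H2) : H2 :=
  H2.mk' (refl (d2 0 u)) (-refl (d2 1 u)) (refl (d2 2 u)) (H2.hasWeakDeriv₁ u).refl (by
    have := (H2.hasWeakDeriv₂ u).refl.smul (-1)
    simpa using this)

@[simp] theorem d2_zero_reflH (u : H2) : d2 0 (reflH u) = refl (d2 0 u) := rfl
@[simp] theorem d2_two_reflH (u : H2) : d2 2 (reflH u) = refl (d2 2 u) := rfl

theorem isEven_iff {u : H2} : IsEven u ↔ refl (d2 0 u) = (1 : ℝ) • d2 0 u := by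
  rw [one_smul, Lp.ext_iff]
  constructor
  · intro h
    filter_upwards [h, coeFn_refl (d2 0 u)] with x h₁ h₂
    exact h₂.trans h₁
  · intro h
    filter_upwards [h, coeFn_refl (d2 0 u)] with x h₁ h₂
    exact h₂.symm.trans h₁

theorem isOdd_iff {u : H2} : IsOdd u ↔ refl (d2 0 u) = (-1 : ℝ) • d2 0 u := by
  rw [neg_one_smul, Lp.ext_iff]
  constructor
  · intro h
    filter_upwards [h, coeFn_refl (d2 0 u), Lp.coeFn_neg (d2 0 u)] with x h₁ h₂ h₃
    rw [h₂, h₃]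
    exact h₁
  · intro h
    filter_upwards [h, coeFn_refl (d2 0 u), Lp.coeFn_neg (d2 0 u)] with x h₁ h₂ h₃
    rw [h₂, h₃] at h₁
    exact h₁

theorem refl_d2_one {s : ℝ} {u : H2} (h : refl (d2 0 u) = s • d2 0 u) :
    refl (d2 1 u) = (-s) • d2 1 u := by
  have : reflH u = s • u := d2_zero_injective (by rw [d2_zero_reflH, h, map_smul])
  have e : -refl (d2 1 u) = s • d2 1 u := by
    rw [← map_smul, ← this]
    rfl
  rw [neg_smul, ← e, neg_neg]

theorem refl_mulL {s t : ℝ} {u : H2} {f : RealL2} (h : refl (d2 0 u) = s • d2 0 u)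
    (hf : refl f = t • f) : refl (mulL u f) = (s * t) • mulL u f := by
  refine Lp.ext ?_
  have h₀ := (Measure.measurePreserving_neg (volume : Measure ℝ)).quasiMeasurePreserving.ae
    (coeFn_mulL u f)
  have h₁ := Lp.ext_iff.1 h
  have h₂ := Lp.ext_iff.1 hf
  filter_upwards [coeFn_refl (mulL u f), h₀, h₁, h₂, coeFn_refl f, coeFn_refl (d2 0 u),
    Lp.coeFn_smul t f, Lp.coeFn_smul s (d2 0 u), Lp.coeFn_smul (s * t) (mulL u f),
    coeFn_mulL u f] with x a₁ a₂ a₃ a₄ a₅ a₆ a₇ a₈ a₉ a₁₀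
  rw [a₆, a₈] at a₃
  rw [a₅, a₇] at a₄
  rw [a₁, a₂, a₃, a₄, a₉]
  simp only [Pi.smul_apply, smul_eq_mul, a₁₀]
  ring

theorem inner_eq_zero_of_parity {s : ℝ} (hs : s * s = 1) {f g : RealL2} (hf : refl f = s • f)
    (hg : refl g = (-s) • g) : inner ℝ f g = 0 := by
  have h := inner_refl f g
  rw [hf, hg, inner_smul_left, inner_smul_right] at h
  simp only [conj_trivial] at h
  linear_combination (-1 / 2) * h - (1 / 2) * inner ℝ f g * hs

/-! ### The profiles `sech^m` and `sech^p tanh` -/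

theorem sech_pos (y : ℝ) : 0 < sech y := one_div_pos.2 (Real.cosh_pos y)

theorem sech_le_one (y : ℝ) : sech y ≤ 1 := by
  rw [sech, div_le_one (Real.cosh_pos y)]
  exact Real.one_le_cosh y

theorem tanh_sq_eq (y : ℝ) : Real.tanh y ^ 2 = 1 - sech y ^ 2 := by
  have hsq := Real.cosh_sq y
  have hne := (Real.cosh_pos y).ne'
  rw [Real.tanh_eq_sinh_div_cosh, sech]
  field_simp
  linear_combination -hsq

/-- The function `sech(κ x) ^ m`. -/
def sechPow (κ m x : ℝ) : ℝ := sech (κ * x) ^ m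

theorem sechPow_pos (κ m x : ℝ) : 0 < sechPow κ m x := Real.rpow_pos_of_pos (sech_pos _) _

theorem hasDerivAt_linear (κ x : ℝ) : HasDerivAt (fun y : ℝ => κ * y) κ x := by
  simpa using (hasDerivAt_id x).const_mul κ

theorem hasDerivAt_sech (κ x : ℝ) : HasDerivAt (fun y : ℝ => sech (κ * y))
    (-(κ * Real.tanh (κ * x) * sech (κ * x))) x := by
  have hne : Real.cosh (κ * x) ≠ 0 := (Real.cosh_pos _).ne'
  refine ((hasDerivAt_const x (1 : ℝ)).div (hasDerivAt_linear κ x).cosh hne).congr_deriv ?_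
  rw [sech, Real.tanh_eq_sinh_div_cosh]
  field_simp
  ring

theorem hasDerivAt_tanh (κ x : ℝ) : HasDerivAt (fun y : ℝ => Real.tanh (κ * y))
    (κ * sech (κ * x) ^ 2) x := by
  have hne : Real.cosh (κ * x) ≠ 0 := (Real.cosh_pos _).ne'
  have e : (fun y : ℝ => Real.tanh (κ * y)) =
      (fun y => Real.sinh (κ * y)) / fun y => Real.cosh (κ * y) := by
    funext y
    simp [Real.tanh_eq_sinh_div_cosh]
  rw [e]
  refine ((hasDerivAt_linear κ x).sinh.div (hasDerivAt_linear κ x).cosh hne).congr_deriv ?_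
  have hsq := Real.cosh_sq (κ * x)
  rw [sech]
  field_simp
  linear_combination κ * hsq

theorem hasDerivAt_sechPow (κ m x : ℝ) :
    HasDerivAt (sechPow κ m) (-(m * κ * Real.tanh (κ * x)) * sechPow κ m x) x := by
  refine ((hasDerivAt_sech κ x).rpow_const (Or.inl (sech_pos _).ne')).congr_deriv ?_
  rw [sechPow, Real.rpow_sub_one (sech_pos _).ne']
  field_simp [(sech_pos (κ * x)).ne']

theorem continuous_sechPow (κ m : ℝ) : Continuous (sechPow κ m) :=
  continuous_iff_continuousAt.2 fun x => (hasDerivAt_sechPow κ m x).continuousAt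

theorem continuous_tanh_mul (κ : ℝ) : Continuous fun x : ℝ => Real.tanh (κ * x) :=
  continuous_iff_continuousAt.2 fun x => (hasDerivAt_tanh κ x).continuousAt

theorem continuous_sech_sq (κ : ℝ) : Continuous fun x : ℝ => sech (κ * x) ^ 2 :=
  (continuous_iff_continuousAt.2 fun x => (hasDerivAt_sech κ x).continuousAt).pow 2

theorem hasDerivAt_sechPow' (κ m x : ℝ) :
    HasDerivAt (fun x => -(m * κ * Real.tanh (κ * x)) * sechPow κ m x)
      (κ ^ 2 * (m ^ 2 - m * (m + 1) * sech (κ * x) ^ 2) * sechPow κ m x) x := by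
  refine ((((hasDerivAt_tanh κ x).const_mul (m * κ)).neg).mul
    (hasDerivAt_sechPow κ m x)).congr_deriv ?_
  have := tanh_sq_eq (κ * x)
  simp only [Pi.neg_apply]
  linear_combination (m ^ 2 * κ ^ 2 * sechPow κ m x) * this

/-- The function `sech(κ x) ^ p * tanh(κ x)`. -/
def sechTanh (κ p x : ℝ) : ℝ := sech (κ * x) ^ p * Real.tanh (κ * x)

theorem sechTanh_eq (κ p x : ℝ) : sechTanh κ p x = sechPow κ p x * Real.tanh (κ * x) := rfl

theorem hasDerivAt_sechTanh (κ p x : ℝ) : HasDerivAt (sechTanh κ p)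
    (κ * ((p + 1) * sech (κ * x) ^ 2 - p) * sechPow κ p x) x := by
  refine ((hasDerivAt_sechPow κ p x).mul (hasDerivAt_tanh κ x)).congr_deriv ?_
  have := tanh_sq_eq (κ * x)
  linear_combination (-p * κ * sechPow κ p x) * this

theorem hasDerivAt_sechTanh' (κ p x : ℝ) :
    HasDerivAt (fun x => κ * ((p + 1) * sech (κ * x) ^ 2 - p) * sechPow κ p x)
      (κ ^ 2 * (p ^ 2 - (p + 1) * (p + 2) * sech (κ * x) ^ 2) * sechTanh κ p x) x := by
  refine ((((((hasDerivAt_sech κ x).fun_pow 2).const_mul (p + 1)).sub_const p).const_mul κ).mul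
    (hasDerivAt_sechPow κ p x)).congr_deriv ?_
  rw [sechTanh_eq]
  push_cast
  ring

theorem memLp_sechPow {κ m : ℝ} (hκ : 0 < κ) (hm : 0 < m) : MemLp (sechPow κ m) 2 := by
  rw [memLp_two_iff_integrable_sq (continuous_sechPow κ m).aestronglyMeasurable]
  have hi : Integrable fun x : ℝ => ((2 : ℝ) ^ m) ^ 2 * (1 + (m * κ * x) ^ 2)⁻¹ :=
    (integrable_inv_one_add_sq.comp_mul_left' (by positivity)).const_mul _
  refine hi.mono' ((continuous_sechPow κ m).pow 2).aestronglyMeasurable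
    (Eventually.of_forall fun x => ?_)
  -- `sech(y) ^ m ≤ 2 ^ m sech(m y)`, by comparison of both sides with `exp(-m |y|)`
  have h1 : sech (κ * x) ≤ 2 * Real.exp (-|κ * x|) := by
    rw [sech, ← Real.cosh_abs, Real.exp_neg, ← div_eq_mul_inv, div_le_div_iff₀ (Real.cosh_pos _)
      (Real.exp_pos _), Real.cosh_eq]
    linarith [Real.exp_pos (-|κ * x|)]
  have h2 : Real.exp (-(m * |κ * x|)) ≤ sech (m * κ * x) := by
    rw [sech, ← Real.cosh_abs, Real.exp_neg, ← one_div, mul_assoc, abs_mul m, abs_of_pos hm]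
    gcongr
    rw [Real.cosh_eq]
    have : Real.exp (-(m * |κ * x|)) ≤ Real.exp (m * |κ * x|) :=
      Real.exp_le_exp.2 (by linarith [mul_nonneg hm.le (abs_nonneg (κ * x))])
    linarith
  have h3 : sechPow κ m x ≤ 2 ^ m * sech (m * κ * x) := by
    calc sechPow κ m x ≤ (2 * Real.exp (-|κ * x|)) ^ m :=
          Real.rpow_le_rpow (sech_pos _).le h1 hm.le
      _ = 2 ^ m * Real.exp (-(m * |κ * x|)) := by
          rw [Real.mul_rpow (by norm_num) (Real.exp_pos _).le, ← Real.exp_mul]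
          congr 2
          ring
      _ ≤ _ := by gcongr
  have h4 := sech_sq_le (m * κ * x)
  rw [Real.norm_of_nonneg (by positivity)]
  calc sechPow κ m x ^ 2 ≤ (2 ^ m * sech (m * κ * x)) ^ 2 := by
        have := (sechPow_pos κ m x).le
        gcongr
    _ = (2 ^ m) ^ 2 * sech (m * κ * x) ^ 2 := by ring
    _ ≤ _ := by gcongr

theorem memLp_of_abs_le_sechPow {κ m K : ℝ} (hκ : 0 < κ) (hm : 0 < m) {f : ℝ → ℝ}
    (hf : Continuous f) (h : ∀ x, |f x| ≤ K * sechPow κ m x) : MemLp f 2 :=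
  ((memLp_sechPow hκ hm).const_mul K).mono hf.aestronglyMeasurable
    (Eventually.of_forall fun x => by
      rw [Real.norm_eq_abs]
      exact (h x).trans (le_abs_self _))

theorem abs_tanh_le_one (y : ℝ) : |Real.tanh y| ≤ 1 := (Real.abs_tanh_lt_one _).le

theorem abs_sech_sq_le_one (y : ℝ) : |sech y ^ 2| ≤ 1 := by
  rw [abs_of_nonneg (by positivity)]
  exact pow_le_one₀ (sech_pos y).le (sech_le_one y)

theorem memLp_sechPow_deriv {κ m : ℝ} (hκ : 0 < κ) (hm : 0 < m) :
    MemLp (fun x => -(m * κ * Real.tanh (κ * x)) * sechPow κ m x) 2 := by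
  refine memLp_of_abs_le_sechPow (K := m * κ) hκ hm
    (((continuous_tanh_mul κ).const_mul (m * κ)).neg.mul (continuous_sechPow κ m)) fun x => ?_
  rw [abs_mul, abs_neg, abs_mul, abs_of_pos (sechPow_pos κ m x), abs_of_pos (by positivity)]
  have := (sechPow_pos κ m x).le
  refine mul_le_mul_of_nonneg_right ?_ this
  exact mul_le_of_le_one_right (by positivity) (abs_tanh_le_one _)

theorem abs_sub_mul_sech_sq_le (a b y : ℝ) : |a - b * sech y ^ 2| ≤ |a| + |b| := by
  refine (abs_sub _ _).trans (add_le_add_right ?_ _)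
  rw [abs_mul]
  exact mul_le_of_le_one_right (abs_nonneg _) (abs_sech_sq_le_one y)

theorem memLp_sechPow_deriv2 {κ m : ℝ} (hκ : 0 < κ) (hm : 0 < m) :
    MemLp (fun x => κ ^ 2 * (m ^ 2 - m * (m + 1) * sech (κ * x) ^ 2) * sechPow κ m x) 2 := by
  refine memLp_of_abs_le_sechPow (K := κ ^ 2 * (|m ^ 2| + |m * (m + 1)|)) hκ hm
    ((continuous_const.mul (continuous_const.sub ((continuous_sech_sq κ).const_mul _))).mul
      (continuous_sechPow κ m)) fun x => ?_
  rw [abs_mul, abs_mul, abs_of_pos (sechPow_pos κ m x), abs_of_nonneg (sq_nonneg κ)]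
  have := (sechPow_pos κ m x).le
  gcongr
  exact abs_sub_mul_sech_sq_le _ _ _

theorem abs_sechTanh_le (κ p x : ℝ) : |sechTanh κ p x| ≤ sechPow κ p x := by
  rw [sechTanh_eq, abs_mul, abs_of_pos (sechPow_pos κ p x)]
  exact mul_le_of_le_one_right (sechPow_pos κ p x).le (abs_tanh_le_one _)

theorem continuous_sechTanh (κ p : ℝ) : Continuous (sechTanh κ p) :=
  continuous_iff_continuousAt.2 fun x => (hasDerivAt_sechTanh κ p x).continuousAt

theorem memLp_sechTanh {κ p : ℝ} (hκ : 0 < κ) (hp : 0 < p) : MemLp (sechTanh κ p) 2 :=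
  memLp_of_abs_le_sechPow (K := 1) hκ hp (continuous_sechTanh κ p) fun x => by
    rw [one_mul]
    exact abs_sechTanh_le κ p x

theorem memLp_sechTanh_deriv {κ p : ℝ} (hκ : 0 < κ) (hp : 0 < p) :
    MemLp (fun x => κ * ((p + 1) * sech (κ * x) ^ 2 - p) * sechPow κ p x) 2 := by
  refine memLp_of_abs_le_sechPow (K := κ * (|p| + |p + 1|)) hκ hp
    ((continuous_const.mul (((continuous_sech_sq κ).const_mul _).sub continuous_const)).mul
      (continuous_sechPow κ p)) fun x => ?_
  rw [abs_mul, abs_mul, abs_of_pos (sechPow_pos κ p x), abs_of_pos hκ, abs_sub_comm]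
  have := (sechPow_pos κ p x).le
  gcongr
  exact abs_sub_mul_sech_sq_le _ _ _

theorem memLp_sechTanh_deriv2 {κ p : ℝ} (hκ : 0 < κ) (hp : 0 < p) :
    MemLp (fun x => κ ^ 2 * (p ^ 2 - (p + 1) * (p + 2) * sech (κ * x) ^ 2) * sechTanh κ p x) 2 := by
  refine memLp_of_abs_le_sechPow (K := κ ^ 2 * (|p ^ 2| + |(p + 1) * (p + 2)|)) hκ hp
    ((continuous_const.mul (continuous_const.sub ((continuous_sech_sq κ).const_mul _))).mul
      (continuous_sechTanh κ p)) fun x => ?_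
  rw [abs_mul, abs_mul, abs_of_nonneg (sq_nonneg κ)]
  gcongr
  · exact abs_sub_mul_sech_sq_le _ _ _
  · exact abs_sechTanh_le κ p x

/-- The function `sech(κ x) ^ m` as an element of `H²(ℝ)`. -/
def ground {κ m : ℝ} (hκ : 0 < κ) (hm : 0 < m) : H2 :=
  H2.ofHasDerivAt _ _ _ (hasDerivAt_sechPow κ m) (hasDerivAt_sechPow' κ m)
    (memLp_sechPow hκ hm) (memLp_sechPow_deriv hκ hm) (memLp_sechPow_deriv2 hκ hm)

/-- The function `sech(κ x) ^ p * tanh(κ x)` as an element of `H²(ℝ)`. -/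
def excited {κ p : ℝ} (hκ : 0 < κ) (hp : 0 < p) : H2 :=
  H2.ofHasDerivAt _ _ _ (hasDerivAt_sechTanh κ p) (hasDerivAt_sechTanh' κ p)
    (memLp_sechTanh hκ hp) (memLp_sechTanh_deriv hκ hp) (memLp_sechTanh_deriv2 hκ hp)

theorem coeFn_d2_ofHasDerivAt {f f' f'' : ℝ → ℝ} (h : ∀ x, HasDerivAt f (f' x) x)
    (h' : ∀ x, HasDerivAt f' (f'' x) x) (hf : MemLp f 2) (hf' : MemLp f' 2)
    (hf'' : MemLp f'' 2) :
    (d2 0 (H2.ofHasDerivAt f f' f'' h h' hf hf' hf'') =ᵐ[volume] f) ∧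
    (d2 1 (H2.ofHasDerivAt f f' f'' h h' hf hf' hf'') =ᵐ[volume] f') ∧
    (d2 2 (H2.ofHasDerivAt f f' f'' h h' hf hf' hf'') =ᵐ[volume] f'') :=
  ⟨hf.coeFn_toLp, hf'.coeFn_toLp, hf''.coeFn_toLp⟩

theorem coeFn_ground {κ m : ℝ} (hκ : 0 < κ) (hm : 0 < m) :
    (d2 0 (ground hκ hm) =ᵐ[volume] sechPow κ m) ∧
    (d2 1 (ground hκ hm) =ᵐ[volume] fun x => -(m * κ * Real.tanh (κ * x)) * sechPow κ m x) ∧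
    (d2 2 (ground hκ hm) =ᵐ[volume]
      fun x => κ ^ 2 * (m ^ 2 - m * (m + 1) * sech (κ * x) ^ 2) * sechPow κ m x) :=
  coeFn_d2_ofHasDerivAt _ _ _ _ _

theorem coeFn_excited {κ p : ℝ} (hκ : 0 < κ) (hp : 0 < p) :
    (d2 0 (excited hκ hp) =ᵐ[volume] sechTanh κ p) ∧
    (d2 1 (excited hκ hp) =ᵐ[volume]
      fun x => κ * ((p + 1) * sech (κ * x) ^ 2 - p) * sechPow κ p x) ∧
    (d2 2 (excited hκ hp) =ᵐ[volume]
      fun x => κ ^ 2 * (p ^ 2 - (p + 1) * (p + 2) * sech (κ * x) ^ 2) * sechTanh κ p x) :=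
  coeFn_d2_ofHasDerivAt _ _ _ _ _

theorem sech_neg (y : ℝ) : sech (-y) = sech y := by rw [sech, sech, Real.cosh_neg]

theorem refl_ground {κ m : ℝ} (hκ : 0 < κ) (hm : 0 < m) :
    refl (d2 0 (ground hκ hm)) = (1 : ℝ) • d2 0 (ground hκ hm) := by
  rw [one_smul]
  refine Lp.ext ?_
  have h := (Measure.measurePreserving_neg (volume : Measure ℝ)).quasiMeasurePreserving.ae
    (coeFn_ground hκ hm).1
  filter_upwards [coeFn_refl (d2 0 (ground hκ hm)), h, (coeFn_ground hκ hm).1] with x h₁ h₂ h₃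
  rw [h₁, h₂, h₃, sechPow, sechPow, mul_neg, sech_neg]

theorem refl_excited {κ p : ℝ} (hκ : 0 < κ) (hp : 0 < p) :
    refl (d2 0 (excited hκ hp)) = (-1 : ℝ) • d2 0 (excited hκ hp) := by
  rw [neg_one_smul]
  refine Lp.ext ?_
  have h := (Measure.measurePreserving_neg (volume : Measure ℝ)).quasiMeasurePreserving.ae
    (coeFn_excited hκ hp).1
  filter_upwards [coeFn_refl (d2 0 (excited hκ hp)), h, (coeFn_excited hκ hp).1,
    Lp.coeFn_neg (d2 0 (excited hκ hp))] with x h₁ h₂ h₃ h₄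
  rw [h₁, h₂, h₄, Pi.neg_apply, h₃, sechTanh, sechTanh, mul_neg, sech_neg, Real.tanh_neg, mul_neg]

theorem ne_zero_of_ae_eq {f : RealL2} {F : ℝ → ℝ} (hf : f =ᵐ[volume] F) (hF : Continuous F)
    {x : ℝ} (hx : F x ≠ 0) : f ≠ 0 := by
  rintro rfl
  have h : F =ᵐ[volume] fun _ => (0 : ℝ) := hf.symm.trans (Lp.coeFn_zero ℝ 2 volume)
  exact hx (congrFun ((hF.ae_eq_iff_eq volume continuous_const).1 h) x)

theorem ground_ne_zero {κ m : ℝ} (hκ : 0 < κ) (hm : 0 < m) : d2 0 (ground hκ hm) ≠ 0 :=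
  ne_zero_of_ae_eq (coeFn_ground hκ hm).1 (continuous_sechPow κ m) (sechPow_pos κ m 0).ne'

theorem excited_ne_zero {κ p : ℝ} (hκ : 0 < κ) (hp : 0 < p) : d2 0 (excited hκ hp) ≠ 0 := by
  refine ne_zero_of_ae_eq (x := 1) (coeFn_excited hκ hp).1 (continuous_sechTanh κ p) ?_
  rw [sechTanh_eq]
  refine mul_ne_zero (sechPow_pos κ p 1).ne' ?_
  rw [Real.tanh_eq_sinh_div_cosh, mul_one]
  exact (div_pos (Real.sinh_pos_iff.2 hκ) (Real.cosh_pos _)).ne'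

/-! ### The ladder operators `±∂ + m κ tanh(κ x)` -/

/-- The bounded function `tanh(κ x)`. -/
def tanhL (κ : ℝ) : Lp ℝ ⊤ (volume : Measure ℝ) :=
  bddLinf _ (continuous_tanh_mul κ) 1 fun _ => abs_tanh_le_one _

/-- The bounded function `sech(κ x) ^ 2`. -/
def sechSqL (κ : ℝ) : Lp ℝ ⊤ (volume : Measure ℝ) :=
  bddLinf _ (continuous_sech_sq κ) 1 fun _ => abs_sech_sq_le_one _

theorem coeFn_tanhL (κ : ℝ) (f : RealL2) :
    mulOp (tanhL κ) f =ᵐ[volume] fun x => Real.tanh (κ * x) * f x :=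
  coeFn_mulOp_bddLinf _ _ _ _ f

theorem coeFn_sechSqL (κ : ℝ) (f : RealL2) :
    mulOp (sechSqL κ) f =ᵐ[volume] fun x => sech (κ * x) ^ 2 * f x :=
  coeFn_mulOp_bddLinf _ _ _ _ f

theorem inner_sechSqL_nonneg (κ : ℝ) (f : RealL2) : 0 ≤ inner ℝ (mulOp (sechSqL κ) f) f := by
  rw [inner_L2_eq]
  refine integral_nonneg_of_ae ?_
  filter_upwards [coeFn_sechSqL κ f] with x hx
  rw [hx, Pi.zero_apply]
  nlinarith [mul_nonneg (sq_nonneg (sech (κ * x))) (mul_self_nonneg (f x))]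

theorem tanhL_tanhL (κ : ℝ) (f : RealL2) :
    mulOp (tanhL κ) (mulOp (tanhL κ) f) = f - mulOp (sechSqL κ) f := by
  refine Lp.ext ?_
  filter_upwards [coeFn_tanhL κ (mulOp (tanhL κ) f), coeFn_tanhL κ f, coeFn_sechSqL κ f,
    Lp.coeFn_sub f (mulOp (sechSqL κ) f)] with x h₁ h₂ h₃ h₄
  rw [h₁, h₂, h₄, Pi.sub_apply, h₃]
  linear_combination f x * tanh_sq_eq (κ * x)

theorem norm_tanhL_sq (κ : ℝ) (f : RealL2) :
    ‖mulOp (tanhL κ) f‖ ^ 2 = ‖f‖ ^ 2 - inner ℝ (mulOp (sechSqL κ) f) f := by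
  rw [← real_inner_self_eq_norm_sq, inner_mulOp, tanhL_tanhL, inner_sub_right,
    real_inner_self_eq_norm_sq, real_inner_comm]

theorem norm_tanhL_le (κ : ℝ) (f : RealL2) : ‖mulOp (tanhL κ) f‖ ≤ ‖f‖ := by
  have h := norm_tanhL_sq κ f
  have := inner_sechSqL_nonneg κ f
  exact le_of_sq_le_sq (by linarith) (norm_nonneg _)

theorem contDiff_tanh_mul (κ : ℝ) : ContDiff ℝ ∞ fun x : ℝ => Real.tanh (κ * x) := by
  have e : (fun x : ℝ => Real.tanh (κ * x)) = fun x => Real.sinh (κ * x) / Real.cosh (κ * x) := by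
    funext x
    rw [Real.tanh_eq_sinh_div_cosh]
  rw [e]
  exact (Real.contDiff_sinh.comp (contDiff_const.mul contDiff_id)).div
    (Real.contDiff_cosh.comp (contDiff_const.mul contDiff_id)) fun x => (Real.cosh_pos _).ne'

theorem HasWeakDeriv.tanh_mul (κ : ℝ) {f g : RealL2} (h : HasWeakDeriv f g) :
    HasWeakDeriv (mulOp (tanhL κ) f)
      (κ • mulOp (sechSqL κ) f + mulOp (tanhL κ) g : RealL2) := by
  have hM' : ∀ x : ℝ, |κ * sech (κ * x) ^ 2| ≤ |κ| := fun x => by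
    rw [abs_mul]
    exact mul_le_of_le_one_right (abs_nonneg _) (abs_sech_sq_le_one _)
  have := h.smooth_mul (contDiff_tanh_mul κ) ((continuous_sech_sq κ).const_mul κ)
    (hasDerivAt_tanh κ) (fun x => abs_tanh_le_one _) hM'
  have key : mulOp (bddLinf _ ((continuous_sech_sq κ).const_mul κ) _ hM') f
      = κ • mulOp (sechSqL κ) f := by
    refine Lp.ext ?_
    filter_upwards [Lp.coeFn_smul κ (mulOp (sechSqL κ) f), coeFn_sechSqL κ f,
      coeFn_mulOp_bddLinf _ ((continuous_sech_sq κ).const_mul κ) _ hM' f] with x h₁ h₂ h₃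
    rw [h₁, h₃, Pi.smul_apply, h₂, smul_eq_mul, mul_assoc]
  rw [key] at this
  exact this

theorem two_inner_tanhL (κ : ℝ) (u : H1) :
    2 * inner ℝ (d1 1 u) (mulOp (tanhL κ) (d1 0 u)) =
      -(κ * inner ℝ (mulOp (sechSqL κ) (d1 0 u)) (d1 0 u)) := by
  have h := H1.inner_deriv_left u (H1.mk' _ _ ((H1.hasWeakDeriv u).tanh_mul κ))
  rw [d1_zero_mk', d1_one_mk', inner_add_right, inner_smul_right,
    ← inner_mulOp (tanhL κ) (d1 0 u) (d1 1 u), real_inner_comm (d1 1 u) (mulOp (tanhL κ) (d1 0 u)),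
    real_inner_comm (mulOp (sechSqL κ) (d1 0 u)) (d1 0 u)] at h
  linarith

/-- The operator `∂ + m κ tanh(κ x)`. -/
def lower (κ m : ℝ) : H1 →L[ℝ] RealL2 := d1 1 + (m * κ) • (mulOp (tanhL κ)).comp (d1 0)

/-- The operator `-∂ + m κ tanh(κ x)`. -/
def raise (κ m : ℝ) : H1 →L[ℝ] RealL2 := -d1 1 + (m * κ) • (mulOp (tanhL κ)).comp (d1 0)

theorem lower_apply (κ m : ℝ) (u : H1) :
    lower κ m u = d1 1 u + (m * κ) • mulOp (tanhL κ) (d1 0 u) := rfl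

theorem raise_apply (κ m : ℝ) (u : H1) :
    raise κ m u = -d1 1 u + (m * κ) • mulOp (tanhL κ) (d1 0 u) := rfl

theorem norm_lower_sq (κ m : ℝ) (u : H1) : ‖lower κ m u‖ ^ 2 = ‖d1 1 u‖ ^ 2
    + m ^ 2 * κ ^ 2 * ‖d1 0 u‖ ^ 2
    - m * (m + 1) * κ ^ 2 * inner ℝ (mulOp (sechSqL κ) (d1 0 u)) (d1 0 u) := by
  rw [lower_apply, norm_add_sq_real, inner_smul_right, norm_smul, mul_pow, norm_tanhL_sq,
    Real.norm_eq_abs, sq_abs]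
  linear_combination (m * κ) * two_inner_tanhL κ u

theorem norm_raise_sq (κ m : ℝ) (u : H1) : ‖raise κ m u‖ ^ 2 = ‖d1 1 u‖ ^ 2
    + m ^ 2 * κ ^ 2 * ‖d1 0 u‖ ^ 2
    - m * (m - 1) * κ ^ 2 * inner ℝ (mulOp (sechSqL κ) (d1 0 u)) (d1 0 u) := by
  rw [raise_apply, norm_add_sq_real, inner_smul_right, norm_smul, mul_pow, norm_tanhL_sq,
    Real.norm_eq_abs, sq_abs, inner_neg_left, norm_neg]
  linear_combination -(m * κ) * two_inner_tanhL κ u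

/-- The commutation relation of the ladder operators, in terms of quadratic forms. -/
theorem norm_raise_sq_eq (κ m : ℝ) (u : H1) : ‖raise κ m u‖ ^ 2 =
    ‖lower κ (m - 1) u‖ ^ 2 + (2 * m - 1) * κ ^ 2 * ‖d1 0 u‖ ^ 2 := by
  rw [norm_raise_sq, norm_lower_sq]
  ring

theorem inner_raise (κ m : ℝ) (w u : H1) :
    inner ℝ (raise κ m w) (d1 0 u) = inner ℝ (d1 0 w) (lower κ m u) := by
  rw [raise_apply, lower_apply, inner_add_left, inner_add_right, inner_neg_left, inner_smul_left,
    inner_smul_right, inner_mulOp, H1.inner_deriv_left, neg_neg]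
  rfl

/-- The constant in the lower bound of `-∂ + m κ tanh(κ x)`. -/
def ladderGap (κ m : ℝ) : ℝ := min (m ^ 2) 1 * κ ^ 2

theorem ladderGap_pos {κ m : ℝ} (hκ : 0 < κ) (hm : 0 < m) : 0 < ladderGap κ m := by
  unfold ladderGap
  have : 0 < min (m ^ 2) 1 := lt_min (by positivity) one_pos
  positivity

theorem ladderGap_le_norm_raise {κ m : ℝ} (hm : 0 < m) (u : H1) :
    ladderGap κ m * ‖d1 0 u‖ ^ 2 ≤ ‖raise κ m u‖ ^ 2 := by
  unfold ladderGap
  have hs := inner_sechSqL_nonneg κ (d1 0 u)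
  rcases le_total m 1 with h | h
  · refine (mul_le_mul_of_nonneg_right (mul_le_mul_of_nonneg_right (min_le_left _ _)
      (sq_nonneg κ)) (sq_nonneg _)).trans ?_
    rw [norm_raise_sq]
    have : 0 ≤ m * (1 - m) * κ ^ 2 * inner ℝ (mulOp (sechSqL κ) (d1 0 u)) (d1 0 u) := by
      have : 0 ≤ 1 - m := by linarith
      positivity
    nlinarith [sq_nonneg ‖d1 1 u‖]
  · refine (mul_le_mul_of_nonneg_right (mul_le_mul_of_nonneg_right (min_le_right _ _)
      (sq_nonneg κ)) (sq_nonneg _)).trans ?_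
    rw [norm_raise_sq_eq]
    have : 0 ≤ (2 * m - 2) * (κ ^ 2 * ‖d1 0 u‖ ^ 2) := by
      have : 0 ≤ 2 * m - 2 := by linarith
      positivity
    nlinarith [sq_nonneg ‖lower κ (m - 1) u‖]

theorem isClosed_range_raise {κ m : ℝ} (hκ : 0 < κ) (hm : 0 < m) :
    IsClosed (Set.range (raise κ m)) := by
  have hg := ladderGap_pos hκ hm
  have hb : ∀ u : H1, ‖u‖ ≤ Real.toNNReal (1 + (m * κ + 1) / √(ladderGap κ m)) * ‖raise κ m u‖ := by
    intro u
    rw [Real.coe_toNNReal _ (by positivity)]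
    have h0 : ‖d1 0 u‖ ≤ ‖raise κ m u‖ / √(ladderGap κ m) := by
      rw [le_div_iff₀ (Real.sqrt_pos.2 hg)]
      refine le_of_sq_le_sq ?_ (norm_nonneg _)
      rw [mul_pow, Real.sq_sqrt hg.le]
      linarith [ladderGap_le_norm_raise (κ := κ) hm u]
    have h1 : ‖d1 1 u‖ ≤ ‖raise κ m u‖ + m * κ * ‖d1 0 u‖ := by
      have e : d1 1 u = -(raise κ m u) + (m * κ) • mulOp (tanhL κ) (d1 0 u) := by
        rw [raise_apply]
        abel
      calc ‖d1 1 u‖ = ‖-(raise κ m u) + (m * κ) • mulOp (tanhL κ) (d1 0 u)‖ := by rw [← e]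
        _ ≤ _ := (norm_add_le _ _).trans (by
          rw [norm_neg, norm_smul, Real.norm_of_nonneg (by positivity)]
          gcongr
          exact norm_tanhL_le κ _)
    have h2 : ‖u‖ ≤ ‖d1 0 u‖ + ‖d1 1 u‖ := by
      refine le_of_sq_le_sq ?_ (by positivity)
      rw [H1.norm_sq]
      nlinarith [mul_nonneg (norm_nonneg (d1 0 u)) (norm_nonneg (d1 1 u))]
    calc ‖u‖ ≤ ‖raise κ m u‖ + (m * κ + 1) * ‖d1 0 u‖ := by linarith
      _ ≤ ‖raise κ m u‖ + (m * κ + 1) * (‖raise κ m u‖ / √(ladderGap κ m)) := by gcongr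
      _ = _ := by ring
  exact ((raise κ m).antilipschitz_of_bound hb).isClosed_range (raise κ m).uniformContinuous

/-- The kernel of `∂ + m κ tanh(κ x)`, in the weak sense, is spanned by `sech(κ x) ^ m`. -/
theorem exists_eq_smul_ground {κ m : ℝ} (hκ : 0 < κ) (hm : 0 < m) {f : RealL2}
    (h : ∀ w : H1, inner ℝ (raise κ m w) f = 0) : ∃ C : ℝ, f = C • d2 0 (ground hκ hm) := by
  have hw : HasWeakDeriv f (-((m * κ) • mulOp (tanhL κ) f) : RealL2) := by
    refine hasWeakDeriv_iff_inner.2 fun φ hφ hs => ?_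
    have := h (testH1 φ hφ hs)
    rw [raise_apply, inner_add_left, inner_neg_left, inner_smul_left, inner_mulOp,
      real_inner_comm, real_inner_comm (mulOp (tanhL κ) f)] at this
    rw [inner_neg_left, inner_smul_left]
    change -inner ℝ f (testL2 (deriv φ) (hφ.continuous_deriv (by simp)) hs.deriv) + m * κ *
      inner ℝ (mulOp (tanhL κ) f) (testL2 φ hφ.continuous hs) = 0 at this
    simp only [conj_trivial]
    linarith
  obtain ⟨F, hFc, hF, hFd, -⟩ := hw.exists_continuous
  have hG : Continuous fun x => -(m * κ * Real.tanh (κ * x)) * F x :=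
    ((continuous_tanh_mul κ).const_mul (m * κ)).neg.mul hFc
  have hd := HasWeakDeriv.hasDerivAt_of_continuous hFd hG (by
    filter_upwards [hF, Lp.coeFn_neg ((m * κ) • mulOp (tanhL κ) f),
      Lp.coeFn_smul (m * κ) (mulOp (tanhL κ) f), coeFn_tanhL κ f] with x h₁ h₂ h₃ h₄
    rw [h₂, Pi.neg_apply, h₃, Pi.smul_apply, h₄, h₁, smul_eq_mul]
    ring)
  have hq : ∀ x, HasDerivAt (fun y => F y / sechPow κ m y) 0 x := fun x => by
    have hp := (sechPow_pos κ m x).ne'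
    refine ((hd x).div (hasDerivAt_sechPow κ m x) hp).congr_deriv ?_
    field_simp
    ring
  have hc : ∀ x, F x / sechPow κ m x = F 0 / sechPow κ m 0 := fun x =>
    is_const_of_deriv_eq_zero (fun y => (hq y).differentiableAt) (fun y => (hq y).deriv) x 0
  refine ⟨F 0 / sechPow κ m 0, Lp.ext ?_⟩
  filter_upwards [hF, (coeFn_ground hκ hm).1, Lp.coeFn_smul (F 0 / sechPow κ m 0)
    (d2 0 (ground hκ hm))] with x h₁ h₂ h₃
  rw [h₁, h₃, Pi.smul_apply, h₂, smul_eq_mul, ← hc x, div_mul_cancel₀ _ (sechPow_pos κ m x).ne']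

/-- The range of `-∂ + m κ tanh(κ x)` is the orthogonal complement of `sech(κ x) ^ m`. -/
theorem exists_raise_eq {κ m : ℝ} (hκ : 0 < κ) (hm : 0 < m) {f : RealL2}
    (h : inner ℝ f (d2 0 (ground hκ hm)) = 0) : ∃ w : H1, raise κ m w = f := by
  set K : Submodule ℝ RealL2 := (raise κ m).range with hK
  have hcl : IsClosed (K : Set RealL2) := isClosed_range_raise hκ hm
  have : CompleteSpace K := hcl.completeSpace_coe
  have : f ∈ Kᗮᗮ := by
    rw [Submodule.mem_orthogonal]
    intro g hg
    obtain ⟨C, rfl⟩ := exists_eq_smul_ground hκ hm (f := g)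
      fun w => (Submodule.mem_orthogonal K g).1 hg _ ⟨w, rfl⟩
    rw [inner_smul_left, real_inner_comm, h, mul_zero]
  rw [Submodule.orthogonal_orthogonal] at this
  exact this

theorem le_norm_lower_of_raise {κ m e : ℝ} (he : 0 < e) {u w : H1} (hw : raise κ m w = d1 0 u)
    (h : e * ‖d1 0 w‖ ^ 2 ≤ ‖raise κ m w‖ ^ 2) : e * ‖d1 0 u‖ ^ 2 ≤ ‖lower κ m u‖ ^ 2 := by
  -- `‖u‖² = ⟪w, (∂ + m κ tanh) u⟫ ≤ ‖w‖ ‖(∂ + m κ tanh) u‖`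
  have h1 : ‖d1 0 u‖ ^ 2 ≤ ‖d1 0 w‖ * ‖lower κ m u‖ := by
    rw [← real_inner_self_eq_norm_sq]
    nth_rw 1 [← hw]
    rw [inner_raise]
    exact real_inner_le_norm _ _
  rw [hw] at h
  rcases (norm_nonneg (d1 0 u)).eq_or_lt with h0 | h0
  · rw [← h0]
    nlinarith [sq_nonneg ‖lower κ m u‖]
  · have h2 : (‖d1 0 u‖ ^ 2) ^ 2 ≤ ‖d1 0 w‖ ^ 2 * ‖lower κ m u‖ ^ 2 := by
      rw [← mul_pow]
      gcongr
    have h3 : e * (‖d1 0 u‖ ^ 2) ^ 2 ≤ ‖d1 0 u‖ ^ 2 * ‖lower κ m u‖ ^ 2 := by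
      nlinarith [sq_nonneg ‖lower κ m u‖]
    have h4 : 0 < ‖d1 0 u‖ ^ 2 := by positivity
    nlinarith

/-- The spectral gap of `(-∂ + m κ tanh(κ x)) (∂ + m κ tanh(κ x))` above its ground state. -/
theorem ladderGap_le_norm_lower {κ m : ℝ} (hκ : 0 < κ) (hm : 0 < m) {u : H1}
    (h : inner ℝ (d1 0 u) (d2 0 (ground hκ hm)) = 0) :
    ladderGap κ m * ‖d1 0 u‖ ^ 2 ≤ ‖lower κ m u‖ ^ 2 := by
  obtain ⟨w, hw⟩ := exists_raise_eq hκ hm h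
  exact le_norm_lower_of_raise (ladderGap_pos hκ hm) hw (ladderGap_le_norm_raise hm w)

theorem lower_excited {κ ν : ℝ} (hκ : 0 < κ) (hν : 0 < ν - 1) :
    lower κ ν (H2.toH1 (excited hκ hν)) = κ • d2 0 (ground hκ hν) := by
  refine Lp.ext ?_
  rw [lower_apply]
  have h := coeFn_excited hκ hν
  filter_upwards [Lp.coeFn_add (d1 1 (H2.toH1 (excited hκ hν)))
    ((ν * κ) • mulOp (tanhL κ) (d1 0 (H2.toH1 (excited hκ hν)))),
    Lp.coeFn_smul (ν * κ) (mulOp (tanhL κ) (d1 0 (H2.toH1 (excited hκ hν)))),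
    coeFn_tanhL κ (d1 0 (H2.toH1 (excited hκ hν))), h.1, h.2.1, (coeFn_ground hκ hν).1,
    Lp.coeFn_smul κ (d2 0 (ground hκ hν))] with x h₁ h₂ h₃ h₄ h₅ h₆ h₇
  rw [h₁, Pi.add_apply, h₂, Pi.smul_apply, h₃, h₇, Pi.smul_apply, h₆, smul_eq_mul, smul_eq_mul]
  change d2 1 (excited hκ hν) x + ν * κ * (Real.tanh (κ * x) * d2 0 (excited hκ hν) x) = _
  rw [h₄, h₅, sechTanh_eq]
  linear_combination (ν * κ * sechPow κ (ν - 1) x) * tanh_sq_eq (κ * x)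

theorem le_norm_lower_of_orthogonal {κ ν : ℝ} (hκ : 0 < κ) (hν : 0 < ν - 1) (hν' : 0 < ν) {u : H1}
    (h : inner ℝ (d1 0 u) (d2 0 (ground hκ hν')) = 0)
    (h' : inner ℝ (d1 0 u) (d2 0 (excited hκ hν)) = 0) :
    (ladderGap κ (ν - 1) + (2 * ν - 1) * κ ^ 2) * ‖d1 0 u‖ ^ 2 ≤ ‖lower κ ν u‖ ^ 2 := by
  obtain ⟨w, hw⟩ := exists_raise_eq hκ hν' h
  have hg := ladderGap_pos hκ hν
  have hpos : 0 < (2 * ν - 1) * κ ^ 2 := by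
    have : 0 < 2 * ν - 1 := by linarith
    positivity
  refine le_norm_lower_of_raise (by linarith) hw ?_
  have hw0 : inner ℝ (d1 0 w) (d2 0 (ground hκ hν)) = 0 := by
    rw [← hw] at h'
    have e := inner_raise κ ν w (H2.toH1 (excited hκ hν))
    rw [lower_excited, inner_smul_right] at e
    exact (mul_eq_zero.1 (e.symm.trans h')).resolve_left hκ.ne'
  rw [norm_raise_sq_eq]
  linarith [ladderGap_le_norm_lower hκ hν hw0]

/-! ### Solvability for coercive Schrödinger operators -/

theorem inner_neg_d2_two_symm (u v : H2) :
    inner ℝ (-d2 2 u + d2 0 u) (d2 0 v) = inner ℝ (d2 0 u) (-d2 2 v + d2 0 v) := by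
  rw [inner_add_left, inner_add_right, inner_neg_left, inner_neg_right, H2.inner_d2_two_symm]

/-- The elliptic estimate for `-∂² + 1`. -/
theorem norm_le_norm_neg_d2_two (u : H2) : ‖u‖ ≤ ‖-d2 2 u + d2 0 u‖ := by
  refine le_of_sq_le_sq ?_ (norm_nonneg _)
  rw [H2.norm_sq, norm_add_sq_real, inner_neg_left, H2.inner_d2_two, norm_neg, neg_neg,
    real_inner_self_eq_norm_sq]
  nlinarith [sq_nonneg ‖d2 1 u‖]

theorem norm_le_of_potential (V : RealL2 →L[ℝ] RealL2) (u : H2) :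
    ‖u‖ ≤ ‖-d2 2 u + d2 0 u - V (d2 0 u)‖ + ‖V‖ * ‖d2 0 u‖ := by
  calc ‖u‖ ≤ ‖-d2 2 u + d2 0 u‖ := norm_le_norm_neg_d2_two u
    _ = ‖(-d2 2 u + d2 0 u - V (d2 0 u)) + V (d2 0 u)‖ := by rw [sub_add_cancel]
    _ ≤ _ := (norm_add_le _ _).trans (by gcongr; exact V.le_opNorm _)

/-- A coercive operator `-∂² + 1 - V` with a bounded symmetric `V` is surjective: its range is
closed, and a function orthogonal to it belongs to the domain by self-adjointness of `-∂² + 1`. -/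
theorem exists_eq_of_coercive {V : RealL2 →L[ℝ] RealL2}
    (hV : ∀ f g, inner ℝ (V f) g = inner ℝ f (V g)) {η : ℝ} (hη : 0 < η)
    (hc : ∀ u : H2, η * ‖d2 0 u‖ ^ 2 ≤ inner ℝ (-d2 2 u + d2 0 u - V (d2 0 u)) (d2 0 u))
    (f : RealL2) : ∃ u : H2, -d2 2 u + d2 0 u - V (d2 0 u) = f := by
  set S : H2 →L[ℝ] RealL2 := -d2 2 + d2 0 - V.comp (d2 0) with hS
  have hSa : ∀ u, S u = -d2 2 u + d2 0 u - V (d2 0 u) := fun u => rfl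
  have hlow : ∀ u, ‖d2 0 u‖ ≤ ‖S u‖ / η := fun u => by
    rw [le_div_iff₀ hη]
    have h1 := (hc u).trans (real_inner_le_norm _ _)
    rw [← hSa] at h1
    rcases (norm_nonneg (d2 0 u)).eq_or_lt with h0 | h0
    · rw [← h0, zero_mul]
      positivity
    · nlinarith
  have hcl : IsClosed (Set.range S) := by
    refine (S.antilipschitz_of_bound (K := Real.toNNReal (1 + ‖V‖ / η)) fun u => ?_).isClosed_range
      S.uniformContinuous
    rw [Real.coe_toNNReal _ (by positivity)]
    calc ‖u‖ ≤ ‖S u‖ + ‖V‖ * ‖d2 0 u‖ := norm_le_of_potential V u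
      _ ≤ ‖S u‖ + ‖V‖ * (‖S u‖ / η) := by gcongr; exact hlow u
      _ = _ := by ring
  set K : Submodule ℝ RealL2 := S.range with hK
  have hcl' : IsClosed (K : Set RealL2) := hcl
  have : CompleteSpace K := hcl'.completeSpace_coe
  have hbot : Kᗮ = ⊥ := by
    rw [Submodule.eq_bot_iff]
    intro g hg
    have hg' : ∀ u, inner ℝ (S u) g = 0 := fun u =>
      (Submodule.mem_orthogonal K g).1 hg _ ⟨u, rfl⟩
    obtain ⟨v, hv⟩ := exists_neg_d2_two_add (V g)
    have h1 : ∀ u : H2, inner ℝ (-d2 2 u + d2 0 u) (g - d2 0 v) = 0 := fun u => by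
      have e := hg' u
      rw [hSa, inner_sub_left, hV, ← hv, ← inner_neg_d2_two_symm] at e
      rw [inner_sub_right]
      exact e
    obtain ⟨w, hw⟩ := exists_neg_d2_two_add (g - d2 0 v)
    have h2 := h1 w
    rw [hw, inner_self_eq_zero, sub_eq_zero] at h2
    have h3 := hc v
    rw [← hSa, ← h2, hg'] at h3
    have : ‖g‖ ^ 2 ≤ 0 := by
      by_contra hcon
      push Not at hcon
      nlinarith
    exact norm_eq_zero.1 (pow_eq_zero_iff (by norm_num) |>.1 (le_antisymm this (sq_nonneg _)))
  have htop : K = ⊤ := (Submodule.orthogonal_eq_bot_iff).1 hbot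
  have : f ∈ K := htop ▸ Submodule.mem_top
  exact this

/-! ### The Pöschl–Teller operator -/

/-- The Pöschl–Teller operator `-∂² + (ν - 1)² κ² - ν (ν + 1) κ² sech(κ x)²`. It is normalized so
that its second eigenvalue is zero. -/
def poschl (κ ν : ℝ) : H2 →L[ℝ] RealL2 :=
  -d2 2 + ((ν - 1) ^ 2 * κ ^ 2) • d2 0 - (ν * (ν + 1) * κ ^ 2) • (mulOp (sechSqL κ)).comp (d2 0)

/-- The ground state energy of the Pöschl–Teller operator. -/
def energy (κ ν : ℝ) : ℝ := -((2 * ν - 1) * κ ^ 2)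

theorem poschl_apply (κ ν : ℝ) (u : H2) : poschl κ ν u = -d2 2 u + ((ν - 1) ^ 2 * κ ^ 2) • d2 0 u
    - (ν * (ν + 1) * κ ^ 2) • mulOp (sechSqL κ) (d2 0 u) := rfl

theorem inner_poschl (κ ν : ℝ) (u v : H2) :
    inner ℝ (poschl κ ν u) (d2 0 v) = inner ℝ (d2 0 u) (poschl κ ν v) := by
  rw [poschl_apply, poschl_apply, inner_sub_left, inner_sub_right, inner_add_left, inner_add_right,
    inner_neg_left, inner_neg_right, H2.inner_d2_two_symm, inner_smul_left, inner_smul_left,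
    inner_smul_right, inner_smul_right, inner_mulOp]
  rfl

theorem inner_poschl_self (κ ν : ℝ) (u : H2) : inner ℝ (poschl κ ν u) (d2 0 u) =
    ‖lower κ ν (H2.toH1 u)‖ ^ 2 - (2 * ν - 1) * κ ^ 2 * ‖d2 0 u‖ ^ 2 := by
  rw [norm_lower_sq, poschl_apply, inner_sub_left, inner_add_left, inner_neg_left, H2.inner_d2_two,
    inner_smul_left, inner_smul_left, real_inner_self_eq_norm_sq, real_inner_self_eq_norm_sq]
  simp only [conj_trivial, neg_neg]
  change ‖d2 1 u‖ ^ 2 + (ν - 1) ^ 2 * κ ^ 2 * ‖d2 0 u‖ ^ 2 - ν * (ν + 1) * κ ^ 2 *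
    inner ℝ (mulOp (sechSqL κ) (d2 0 u)) (d2 0 u) = ‖d2 1 u‖ ^ 2 + ν ^ 2 * κ ^ 2 * ‖d2 0 u‖ ^ 2
    - ν * (ν + 1) * κ ^ 2 * inner ℝ (mulOp (sechSqL κ) (d2 0 u)) (d2 0 u) -
    (2 * ν - 1) * κ ^ 2 * ‖d2 0 u‖ ^ 2
  ring

theorem coeFn_poschl (κ ν : ℝ) (u : H2) : poschl κ ν u =ᵐ[volume] fun x => -d2 2 u x +
    (ν - 1) ^ 2 * κ ^ 2 * d2 0 u x - ν * (ν + 1) * κ ^ 2 * (sech (κ * x) ^ 2 * d2 0 u x) := by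
  rw [poschl_apply]
  filter_upwards [Lp.coeFn_sub (-d2 2 u + ((ν - 1) ^ 2 * κ ^ 2) • d2 0 u)
    ((ν * (ν + 1) * κ ^ 2) • mulOp (sechSqL κ) (d2 0 u)),
    Lp.coeFn_add (-d2 2 u) (((ν - 1) ^ 2 * κ ^ 2) • d2 0 u), Lp.coeFn_neg (d2 2 u),
    Lp.coeFn_smul ((ν - 1) ^ 2 * κ ^ 2) (d2 0 u),
    Lp.coeFn_smul (ν * (ν + 1) * κ ^ 2) (mulOp (sechSqL κ) (d2 0 u)),
    coeFn_sechSqL κ (d2 0 u)] with x h₁ h₂ h₃ h₄ h₅ h₆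
  simp only [h₁, h₂, h₃, h₄, h₅, h₆, Pi.sub_apply, Pi.add_apply, Pi.neg_apply, Pi.smul_apply,
    smul_eq_mul]

theorem poschl_ground {κ ν : ℝ} (hκ : 0 < κ) (hν : 0 < ν) :
    poschl κ ν (ground hκ hν) = energy κ ν • d2 0 (ground hκ hν) := by
  refine Lp.ext ?_
  filter_upwards [coeFn_poschl κ ν (ground hκ hν), (coeFn_ground hκ hν).1, (coeFn_ground hκ hν).2.2,
    Lp.coeFn_smul (energy κ ν) (d2 0 (ground hκ hν))] with x h₁ h₂ h₃ h₄
  rw [h₁, h₄, Pi.smul_apply, h₃, h₂, energy, smul_eq_mul]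
  ring

theorem poschl_excited {κ ν : ℝ} (hκ : 0 < κ) (hν : 0 < ν - 1) :
    poschl κ ν (excited hκ hν) = 0 := by
  refine Lp.ext ?_
  filter_upwards [coeFn_poschl κ ν (excited hκ hν), (coeFn_excited hκ hν).1,
    (coeFn_excited hκ hν).2.2, Lp.coeFn_zero ℝ 2 (volume : Measure ℝ)] with x h₁ h₂ h₃ h₄
  rw [h₁, h₄, h₃, h₂, Pi.zero_apply]
  ring

theorem inner_ground_excited {κ m p : ℝ} (hκ : 0 < κ) (hm : 0 < m) (hp : 0 < p) :
    inner ℝ (d2 0 (ground hκ hm)) (d2 0 (excited hκ hp)) = 0 :=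
  inner_eq_zero_of_parity (s := 1) (by norm_num) (refl_ground hκ hm) (refl_excited hκ hp)

theorem poschl_form_ge_of_orthogonal {κ ν : ℝ} (hκ : 0 < κ) (hν : 0 < ν - 1) (hν' : 0 < ν) {u : H2}
    (h : inner ℝ (d2 0 u) (d2 0 (ground hκ hν')) = 0)
    (h' : inner ℝ (d2 0 u) (d2 0 (excited hκ hν)) = 0) :
    ladderGap κ (ν - 1) * ‖d2 0 u‖ ^ 2 ≤ inner ℝ (poschl κ ν u) (d2 0 u) := by
  have := le_norm_lower_of_orthogonal hκ hν hν' (u := H2.toH1 u) h h'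
  rw [inner_poschl_self]
  change (ladderGap κ (ν - 1) + (2 * ν - 1) * κ ^ 2) * ‖d2 0 u‖ ^ 2 ≤ _ at this
  linarith

/-- The decomposition along the two lowest eigenfunctions. -/
theorem exists_decomposition {κ ν : ℝ} (hκ : 0 < κ) (hν : 0 < ν - 1) (hν' : 0 < ν) (f : RealL2) :
    ∃ (a b : ℝ) (g : RealL2), f = a • d2 0 (ground hκ hν') + b • d2 0 (excited hκ hν) + g ∧
      a = inner ℝ f (d2 0 (ground hκ hν')) / ‖d2 0 (ground hκ hν')‖ ^ 2 ∧
      b = inner ℝ f (d2 0 (excited hκ hν)) / ‖d2 0 (excited hκ hν)‖ ^ 2 ∧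
      inner ℝ g (d2 0 (ground hκ hν')) = 0 ∧ inner ℝ g (d2 0 (excited hκ hν)) = 0 := by
  have n₁ := norm_ne_zero_iff.2 (ground_ne_zero hκ hν')
  have n₂ := norm_ne_zero_iff.2 (excited_ne_zero hκ hν)
  have o := inner_ground_excited hκ hν' hν
  have o' := (real_inner_comm _ _).trans o
  set a : ℝ := inner ℝ f (d2 0 (ground hκ hν')) / ‖d2 0 (ground hκ hν')‖ ^ 2 with ha
  set b : ℝ := inner ℝ f (d2 0 (excited hκ hν)) / ‖d2 0 (excited hκ hν)‖ ^ 2 with hb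
  refine ⟨a, b, f - a • d2 0 (ground hκ hν') - b • d2 0 (excited hκ hν), ?_, rfl, rfl, ?_, ?_⟩
  · abel
  · rw [inner_sub_left, inner_sub_left, inner_smul_left, inner_smul_left, o',
      real_inner_self_eq_norm_sq, ha]
    simp only [conj_trivial]
    field_simp
    ring
  · rw [inner_sub_left, inner_sub_left, inner_smul_left, inner_smul_left, o,
      real_inner_self_eq_norm_sq, hb]
    simp only [conj_trivial]
    field_simp
    ring

theorem exists_poschl_form_ge {κ ν : ℝ} (hκ : 0 < κ) (hν : 0 < ν - 1) (hν' : 0 < ν) :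
    ∃ K : ℝ, 0 < K ∧ ∀ u : H2, ladderGap κ (ν - 1) * ‖d2 0 u‖ ^ 2 ≤ inner ℝ (poschl κ ν u) (d2 0 u)
      + K * (inner ℝ (d2 0 u) (d2 0 (ground hκ hν')) ^ 2 +
        inner ℝ (d2 0 u) (d2 0 (excited hκ hν)) ^ 2) := by
  set φ := ground hκ hν' with hφ
  set ψ := excited hκ hν with hψ
  set N₁ := ‖d2 0 φ‖ ^ 2 with hN₁
  set N₂ := ‖d2 0 ψ‖ ^ 2 with hN₂
  set η := ladderGap κ (ν - 1) with hη
  have n₁ : 0 < N₁ := pow_pos (norm_pos_iff.2 (ground_ne_zero hκ hν')) 2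
  have n₂ : 0 < N₂ := pow_pos (norm_pos_iff.2 (excited_ne_zero hκ hν)) 2
  have hηp : 0 < η := ladderGap_pos hκ hν
  have o := inner_ground_excited hκ hν' hν
  have o' := (real_inner_comm _ _).trans o
  refine ⟨(η + |energy κ ν|) / N₁ + η / N₂, by positivity, fun u => ?_⟩
  obtain ⟨a, b, g, hg, ha, hb, g₁, g₂⟩ := exists_decomposition hκ hν hν' (d2 0 u)
  rw [← hφ, ← hψ, ← hN₁, ← hN₂] at *
  set v : H2 := u - a • φ - b • ψ with hv
  have hv0 : d2 0 v = g := by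
    rw [hv, map_sub, map_sub, map_smul, map_smul, hg]
    abel
  have hu : u = a • φ + b • ψ + v := by rw [hv]; abel
  have hTu : poschl κ ν u = (a * energy κ ν) • d2 0 φ + poschl κ ν v := by
    rw [hu, map_add, map_add, map_smul, map_smul, poschl_ground, poschl_excited, smul_zero,
      add_zero, smul_smul]
  have g₁' := (real_inner_comm _ _).trans g₁
  have g₂' := (real_inner_comm _ _).trans g₂
  have t₁ : inner ℝ (poschl κ ν v) (d2 0 φ) = 0 := by
    rw [inner_poschl, poschl_ground, inner_smul_right, hv0, g₁, mul_zero]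
  have t₂ : inner ℝ (poschl κ ν v) (d2 0 ψ) = 0 := by
    rw [inner_poschl, poschl_excited, inner_zero_right]
  have hform : inner ℝ (poschl κ ν u) (d2 0 u)
      = energy κ ν * a ^ 2 * N₁ + inner ℝ (poschl κ ν v) (d2 0 v) := by
    rw [hTu, hg, hv0]
    simp only [inner_add_left, inner_add_right, inner_smul_left, inner_smul_right, t₁, t₂, o, g₁',
      real_inner_self_eq_norm_sq, conj_trivial]
    ring
  have hnorm : ‖d2 0 u‖ ^ 2 = a ^ 2 * N₁ + b ^ 2 * N₂ + ‖d2 0 v‖ ^ 2 := by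
    rw [← real_inner_self_eq_norm_sq, hg, hv0]
    simp only [inner_add_left, inner_add_right, inner_smul_left, inner_smul_right, g₁, g₂, o, o',
      g₁', g₂', real_inner_self_eq_norm_sq, conj_trivial]
    ring
  have i₁ : inner ℝ (d2 0 u) (d2 0 φ) = a * N₁ := by rw [ha]; field_simp
  have i₂ : inner ℝ (d2 0 u) (d2 0 ψ) = b * N₂ := by rw [hb]; field_simp
  have hco := poschl_form_ge_of_orthogonal hκ hν hν' (u := v) (by rw [hv0]; exact g₁)
    (by rw [hv0]; exact g₂)
  rw [hform, hnorm, i₁, i₂]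
  have k₁ : ((η + |energy κ ν|) / N₁ + η / N₂) * ((a * N₁) ^ 2 + (b * N₂) ^ 2)
      = (η + |energy κ ν|) * (a ^ 2 * N₁) + η * (b ^ 2 * N₂)
        + ((η + |energy κ ν|) / N₁ * (b * N₂) ^ 2 + η / N₂ * (a * N₁) ^ 2) := by
    field_simp
    ring
  rw [k₁]
  have k₂ : 0 ≤ (η + |energy κ ν|) / N₁ * (b * N₂) ^ 2 + η / N₂ * (a * N₁) ^ 2 := by positivity
  have k₃ : 0 ≤ (|energy κ ν| + energy κ ν) * (a ^ 2 * N₁) :=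
    mul_nonneg (by linarith [neg_abs_le (energy κ ν)]) (by positivity)
  nlinarith

/-- The Fredholm alternative for `poschl κ ν - μ` at real numbers `μ ≤ 0`. -/
theorem exists_poschl_sub_eq {κ ν : ℝ} (hκ : 0 < κ) (hν : 0 < ν - 1) (hν' : 0 < ν) {μ : ℝ}
    (hμ : μ ≤ 0) {f : RealL2} (h₁ : μ = energy κ ν → inner ℝ f (d2 0 (ground hκ hν')) = 0)
    (h₂ : μ = 0 → inner ℝ f (d2 0 (excited hκ hν)) = 0) :
    ∃ u : H2, poschl κ ν u - μ • d2 0 u = f := by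
  obtain ⟨K, hK, hform⟩ := exists_poschl_form_ge hκ hν hν'
  set φ := ground hκ hν' with hφ
  set ψ := excited hκ hν with hψ
  set η := ladderGap κ (ν - 1) with hη
  have hηp : 0 < η := ladderGap_pos hκ hν
  have n₁ : 0 < ‖d2 0 φ‖ ^ 2 := pow_pos (norm_pos_iff.2 (ground_ne_zero hκ hν')) 2
  have n₂ : 0 < ‖d2 0 ψ‖ ^ 2 := pow_pos (norm_pos_iff.2 (excited_ne_zero hκ hν)) 2
  have o : inner ℝ (d2 0 φ) (d2 0 ψ) = 0 := inner_ground_excited hκ hν' hν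
  have o' := (real_inner_comm _ _).trans o
  have Tφ : poschl κ ν φ = energy κ ν • d2 0 φ := poschl_ground hκ hν'
  have Tψ : poschl κ ν ψ = 0 := poschl_excited hκ hν
  -- adding `K` times the projections to `φ` and `ψ` makes the operator coercive
  let R : RealL2 →L[ℝ] RealL2 := (innerSL ℝ (d2 0 φ)).smulRight (d2 0 φ)
    + (innerSL ℝ (d2 0 ψ)).smulRight (d2 0 ψ)
  have hR : ∀ f, R f = inner ℝ (d2 0 φ) f • d2 0 φ + inner ℝ (d2 0 ψ) f • d2 0 ψ := fun f => rfl
  let V : RealL2 →L[ℝ] RealL2 := (1 - (ν - 1) ^ 2 * κ ^ 2 + μ) • ContinuousLinearMap.id ℝ RealL2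
    + (ν * (ν + 1) * κ ^ 2) • mulOp (sechSqL κ) - K • R
  have hVa : ∀ f, V f = (1 - (ν - 1) ^ 2 * κ ^ 2 + μ) • f
      + (ν * (ν + 1) * κ ^ 2) • mulOp (sechSqL κ) f
      - K • (inner ℝ (d2 0 φ) f • d2 0 φ + inner ℝ (d2 0 ψ) f • d2 0 ψ) := fun f => rfl
  have hVs : ∀ f g, inner ℝ (V f) g = inner ℝ f (V g) := fun f g => by
    rw [hVa, hVa]
    simp only [inner_sub_left, inner_sub_right, inner_add_left, inner_add_right, inner_smul_left,
      inner_smul_right, inner_mulOp, conj_trivial, real_inner_comm (d2 0 φ) f,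
      real_inner_comm (d2 0 ψ) f]
    ring
  have hS : ∀ u : H2, -d2 2 u + d2 0 u - V (d2 0 u) = poschl κ ν u - μ • d2 0 u
      + K • (inner ℝ (d2 0 φ) (d2 0 u) • d2 0 φ + inner ℝ (d2 0 ψ) (d2 0 u) • d2 0 ψ) := fun u => by
    rw [hVa, poschl_apply]
    module
  have hc : ∀ u : H2, η * ‖d2 0 u‖ ^ 2 ≤ inner ℝ (-d2 2 u + d2 0 u - V (d2 0 u)) (d2 0 u) :=
    fun u => by
    rw [hS]
    simp only [inner_sub_left, inner_add_left, inner_smul_left, real_inner_self_eq_norm_sq,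
      conj_trivial]
    have := hform u
    rw [real_inner_comm (d2 0 φ), real_inner_comm (d2 0 ψ)] at this
    nlinarith [mul_nonneg (neg_nonneg.2 hμ) (sq_nonneg ‖d2 0 u‖)]
  obtain ⟨a, b, g, hg, ha, hb, g₁, g₂⟩ := exists_decomposition hκ hν hν' f
  rw [← hφ, ← hψ] at hg
  rw [← hφ] at ha g₁
  rw [← hψ] at hb g₂
  obtain ⟨u, hu⟩ := exists_eq_of_coercive hVs hηp hc g
  rw [hS] at hu
  have u₁ : inner ℝ (d2 0 φ) (d2 0 u) = 0 := by
    have e := congrArg (fun x => inner ℝ x (d2 0 φ)) hu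
    simp only [inner_sub_left, inner_add_left, inner_smul_left, inner_poschl, o', conj_trivial,
      real_inner_self_eq_norm_sq] at e
    rw [g₁, Tφ, inner_smul_right, real_inner_comm] at e
    have c := hc φ
    rw [hS, Tφ] at c
    simp only [inner_sub_left, inner_add_left, inner_smul_left, o', conj_trivial,
      real_inner_self_eq_norm_sq] at c
    have c' : 0 < energy κ ν - μ + K * ‖d2 0 φ‖ ^ 2 := by
      have : 0 < (energy κ ν - μ + K * ‖d2 0 φ‖ ^ 2) * ‖d2 0 φ‖ ^ 2 := by nlinarith
      exact (pos_iff_pos_of_mul_pos this).2 n₁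
    have e' : (energy κ ν - μ + K * ‖d2 0 φ‖ ^ 2) * inner ℝ (d2 0 φ) (d2 0 u) = 0 := by
      linarith
    exact (mul_eq_zero.1 e').resolve_left c'.ne'
  have u₂ : inner ℝ (d2 0 ψ) (d2 0 u) = 0 := by
    have e := congrArg (fun x => inner ℝ x (d2 0 ψ)) hu
    simp only [inner_sub_left, inner_add_left, inner_smul_left, inner_poschl, o, conj_trivial,
      real_inner_self_eq_norm_sq] at e
    rw [g₂, Tψ, inner_zero_right, real_inner_comm] at e
    have c' : 0 < - μ + K * ‖d2 0 ψ‖ ^ 2 := by nlinarith [mul_pos hK n₂]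
    have e' : (- μ + K * ‖d2 0 ψ‖ ^ 2) * inner ℝ (d2 0 ψ) (d2 0 u) = 0 := by linarith
    exact (mul_eq_zero.1 e').resolve_left c'.ne'
  rw [u₁, u₂, zero_smul, zero_smul, add_zero, smul_zero, add_zero] at hu
  have b₁ : a / (energy κ ν - μ) * (energy κ ν - μ) = a := by
    by_cases h : μ = energy κ ν
    · rw [ha, h₁ h]
      simp
    · exact div_mul_cancel₀ _ (sub_ne_zero.2 (Ne.symm h))
  have b₂ : b / (-μ) * (-μ) = b := by
    by_cases h : μ = 0
    · rw [hb, h₂ h]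
      simp
    · exact div_mul_cancel₀ _ (neg_ne_zero.2 h)
  refine ⟨(a / (energy κ ν - μ)) • φ + (b / (-μ)) • ψ + u, ?_⟩
  rw [map_add, map_add, map_smul, map_smul, Tφ, Tψ, map_add, map_add,
    map_smul, map_smul, hg, ← hu]
  nth_rw 3 [← b₁]
  nth_rw 3 [← b₂]
  module

/-- The operator `poschl κ ν` is bounded below on the orthogonal complement of its kernel. -/
theorem exists_norm_le_norm_poschl {κ ν : ℝ} (hκ : 0 < κ) (hν : 0 < ν - 1) (hν' : 0 < ν) :
    ∃ K : ℝ, 0 < K ∧ ∀ u : H2, inner ℝ (d2 0 u) (d2 0 (excited hκ hν)) = 0 →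
      ‖u‖ ≤ K * ‖poschl κ ν u‖ := by
  set φ := ground hκ hν' with hφ
  set η := ladderGap κ (ν - 1) with hη
  have hηp : 0 < η := ladderGap_pos hκ hν
  have n₁ : 0 < ‖d2 0 φ‖ := norm_pos_iff.2 (ground_ne_zero hκ hν')
  have hE : energy κ ν < 0 := by
    have : 0 < (2 * ν - 1) * κ ^ 2 := mul_pos (by linarith) (by positivity)
    unfold energy
    linarith
  set θ := min η (-energy κ ν) with hθ
  have hθp : 0 < θ := lt_min hηp (by linarith)
  let V : RealL2 →L[ℝ] RealL2 := (1 - (ν - 1) ^ 2 * κ ^ 2) • ContinuousLinearMap.id ℝ RealL2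
    + (ν * (ν + 1) * κ ^ 2) • mulOp (sechSqL κ)
  have hVa : ∀ f, V f = (1 - (ν - 1) ^ 2 * κ ^ 2) • f
      + (ν * (ν + 1) * κ ^ 2) • mulOp (sechSqL κ) f := fun f => rfl
  have hS : ∀ u : H2, -d2 2 u + d2 0 u - V (d2 0 u) = poschl κ ν u := fun u => by
    rw [hVa, poschl_apply]
    module
  refine ⟨1 + ‖V‖ / θ, by positivity, fun u hu => ?_⟩
  have key : θ * ‖d2 0 u‖ ≤ ‖poschl κ ν u‖ := by
    obtain ⟨a, b, g, hg, ha, hb, g₁, g₂⟩ := exists_decomposition hκ hν hν' (d2 0 u)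
    rw [hu, zero_div] at hb
    rw [hb, zero_smul, add_zero] at hg
    rw [← hφ] at *
    set v : H2 := u - a • φ with hv
    have hv0 : d2 0 v = g := by
      rw [hv, map_sub, map_smul, hg]
      abel
    have hu' : u = a • φ + v := by rw [hv]; abel
    have hTu : poschl κ ν u = (a * energy κ ν) • d2 0 φ + poschl κ ν v := by
      rw [hu', map_add, map_smul, poschl_ground, smul_smul]
    have g₁' := (real_inner_comm _ _).trans g₁
    have t₁ : inner ℝ (poschl κ ν v) (d2 0 φ) = 0 := by
      rw [inner_poschl, poschl_ground, inner_smul_right, hv0, g₁, mul_zero]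
    -- the test function that changes the sign of the component along the ground state
    have hnw : ‖g - a • d2 0 φ‖ = ‖d2 0 u‖ := by
      rw [← sq_eq_sq₀ (norm_nonneg _) (norm_nonneg _), hg, norm_sub_sq_real, norm_add_sq_real,
        inner_smul_right, inner_smul_left, g₁, g₁']
      simp
      ring
    have hnu : ‖d2 0 u‖ ^ 2 = a ^ 2 * ‖d2 0 φ‖ ^ 2 + ‖g‖ ^ 2 := by
      rw [hg, norm_add_sq_real, inner_smul_left, g₁', norm_smul, mul_pow, Real.norm_eq_abs, sq_abs]
      simp
    have hco := poschl_form_ge_of_orthogonal hκ hν hν' (u := v) (by rw [hv0]; exact g₁)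
      (by rw [hv0]; exact g₂)
    have h1 : θ * ‖d2 0 u‖ ^ 2 ≤ inner ℝ (poschl κ ν u) (g - a • d2 0 φ) := by
      rw [hTu, hnu, ← hv0]
      rw [hv0] at *
      simp only [inner_add_left, inner_sub_right, inner_smul_left, inner_smul_right, t₁, g₁',
        real_inner_self_eq_norm_sq, conj_trivial]
      have m₁ : θ ≤ η := min_le_left _ _
      have m₂ : θ ≤ -energy κ ν := min_le_right _ _
      have p₁ : θ * ‖g‖ ^ 2 ≤ η * ‖g‖ ^ 2 := by gcongr
      have p₂ : θ * (a ^ 2 * ‖d2 0 φ‖ ^ 2) ≤ -energy κ ν * (a ^ 2 * ‖d2 0 φ‖ ^ 2) := by gcongr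
      nlinarith
    have h2 := h1.trans (real_inner_le_norm _ _)
    rw [hnw] at h2
    rcases (norm_nonneg (d2 0 u)).eq_or_lt with h0 | h0
    · rw [← h0, mul_zero]
      positivity
    · nlinarith
  calc ‖u‖ ≤ ‖poschl κ ν u‖ + ‖V‖ * ‖d2 0 u‖ := by
        rw [← hS]
        exact norm_le_of_potential V u
    _ ≤ ‖poschl κ ν u‖ + ‖V‖ * (‖poschl κ ν u‖ / θ) := by
        gcongr
        rw [le_div_iff₀ hθp]
        linarith
    _ = _ := by ring

theorem refl_sechSqL (κ : ℝ) (f : RealL2) :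
    refl (mulOp (sechSqL κ) f) = mulOp (sechSqL κ) (refl f) := by
  refine Lp.ext ?_
  have h := (Measure.measurePreserving_neg (volume : Measure ℝ)).quasiMeasurePreserving.ae
    (coeFn_sechSqL κ f)
  filter_upwards [coeFn_refl (mulOp (sechSqL κ) f), h, coeFn_refl f, coeFn_sechSqL κ (refl f)]
    with x h₁ h₂ h₃ h₄
  rw [h₁, h₂, h₄, h₃, mul_neg, sech_neg]

theorem refl_poschl (κ ν : ℝ) (u : H2) : refl (poschl κ ν u) = poschl κ ν (reflH u) := by
  simp only [poschl_apply, map_sub, map_add, map_neg, map_smul, refl_sechSqL]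
  rfl

/-- The Fredholm alternative within the functions of a given parity. -/
theorem exists_poschl_sub_eq_of_parity {κ ν : ℝ} (hκ : 0 < κ) (hν : 0 < ν - 1) (hν' : 0 < ν)
    {μ : ℝ} (hμ : μ ≤ 0) {s : ℝ} (hs : s * s = 1) {f : RealL2} (hf : refl f = s • f)
    (h₁ : μ = energy κ ν → inner ℝ f (d2 0 (ground hκ hν')) = 0)
    (h₂ : μ = 0 → inner ℝ f (d2 0 (excited hκ hν)) = 0) :
    ∃ u : H2, refl (d2 0 u) = s • d2 0 u ∧ poschl κ ν u - μ • d2 0 u = f := by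
  obtain ⟨u, hu⟩ := exists_poschl_sub_eq hκ hν hν' hμ h₁ h₂
  refine ⟨(1 / 2 : ℝ) • (u + s • reflH u), ?_, ?_⟩
  · rw [map_smul, map_add, map_smul, map_smul, map_add, map_smul, d2_zero_reflH, refl_refl,
      smul_comm s, smul_add s, smul_smul, hs, one_smul, add_comm]
  · have h : poschl κ ν (reflH u) - μ • d2 0 (reflH u) = s • f := by
      rw [← refl_poschl, d2_zero_reflH, ← map_smul, ← map_sub, hu, hf]
    have e : poschl κ ν ((1 / 2 : ℝ) • (u + s • reflH u))
        - μ • d2 0 ((1 / 2 : ℝ) • (u + s • reflH u))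
        = (1 / 2 : ℝ) • ((poschl κ ν u - μ • d2 0 u)
          + s • (poschl κ ν (reflH u) - μ • d2 0 (reflH u))) := by
      simp only [map_smul, map_add]
      module
    rw [e, h, hu, smul_smul, hs]
    module

/-! ### Local solvability and persistence of eigenvalues -/

section Abstract

variable {E P G : Type*} [NormedAddCommGroup E] [NormedSpace ℝ E] [CompleteSpace E]
  [NormedAddCommGroup P] [NormedSpace ℝ P] [CompleteSpace P]
  [NormedAddCommGroup G] [NormedSpace ℝ G] [CompleteSpace G]

/-- If the partial derivative of `F` in the first variable is surjective, then the equation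
`F(x, p) = F(x₀, p₀)` has solutions `x` near `x₀` for all parameters `p` near `p₀`. -/
theorem eventually_exists_eq_of_surjective {F : E × P → G} {x₀ : E} {p₀ : P}
    (hF : ContDiffAt ℝ 1 F (x₀, p₀)) {L : E →L[ℝ] G}
    (hL : HasFDerivAt (fun x => F (x, p₀)) L x₀) (hs : Function.Surjective L)
    {N : Set E} (hN : N ∈ 𝓝 x₀) :
    ∀ᶠ p in 𝓝 p₀, ∃ x ∈ N, F (x, p) = F (x₀, p₀) := by
  have hd : HasStrictFDerivAt F (fderiv ℝ F (x₀, p₀)) (x₀, p₀) :=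
    hF.hasStrictFDerivAt (by norm_num)
  have hL' : (fderiv ℝ F (x₀, p₀)).comp (ContinuousLinearMap.inl ℝ E P) = L := by
    refine HasFDerivAt.unique ?_ hL
    exact hd.hasFDerivAt.comp x₀ (hasFDerivAt_prodMk_left x₀ p₀)
  have hΦ : HasStrictFDerivAt (fun y : E × P => (F y, y.2))
      ((fderiv ℝ F (x₀, p₀)).prod (ContinuousLinearMap.snd ℝ E P)) (x₀, p₀) :=
    hd.prodMk hasStrictFDerivAt_snd
  have hsurj : ((fderiv ℝ F (x₀, p₀)).prod (ContinuousLinearMap.snd ℝ E P)).range = ⊤ := by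
    rw [LinearMap.range_eq_top]
    rintro ⟨g, q⟩
    obtain ⟨x, hx⟩ := hs (g - fderiv ℝ F (x₀, p₀) (0, q))
    refine ⟨(x, q), ?_⟩
    have e : fderiv ℝ F (x₀, p₀) (x, q) = L x + fderiv ℝ F (x₀, p₀) (0, q) := by
      rw [← hL', ContinuousLinearMap.comp_apply, ContinuousLinearMap.inl_apply, ← map_add]
      simp
    change (fderiv ℝ F (x₀, p₀) (x, q), q) = (g, q)
    rw [e, hx, sub_add_cancel]
  have hmap := hΦ.map_nhds_eq_of_surj hsurj
  have hmem : (fun y : E × P => (F y, y.2)) '' (N ×ˢ univ) ∈ 𝓝 (F (x₀, p₀), p₀) := by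
    rw [← hmap]
    exact image_mem_map (prod_mem_nhds hN univ_mem)
  have hcont : Tendsto (fun p : P => (F (x₀, p₀), p)) (𝓝 p₀) (𝓝 (F (x₀, p₀), p₀)) :=
    (Continuous.prodMk_right (F (x₀, p₀))).tendsto p₀
  filter_upwards [hcont hmem] with p hp
  obtain ⟨⟨x, q⟩, hx, he⟩ := hp
  simp only [Prod.mk.injEq] at he
  obtain ⟨h₁, rfl⟩ := he
  exact ⟨x, hx.1, h₁⟩

/-- Persistence of a simple eigenvalue: let `φ` be an eigenvector of `T` at `μ₀` and let `ℓ` be a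
functional with `ℓ φ ≠ 0` whose kernel is contained in the range of `T - μ₀`. Then every small
perturbation of `T` has an eigenvector near `φ` with eigenvalue near `μ₀`. -/
theorem eventually_exists_eigenvector {T j : E →L[ℝ] G} {φ : E} {μ₀ : ℝ} {ℓ : G →L[ℝ] ℝ}
    (hφ : T φ = μ₀ • j φ) (hℓ : ℓ (j φ) ≠ 0)
    (hrange : ∀ f, ℓ f = 0 → ∃ u, T u - μ₀ • j u = f)
    {N : Set (E × ℝ)} (hN : N ∈ 𝓝 (φ, μ₀)) :
    ∀ᶠ B : E →L[ℝ] G in 𝓝 0, ∃ x ∈ N, T x.1 + B x.1 = x.2 • j x.1 := by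
  let F : (E × ℝ) × (E →L[ℝ] G) → G := fun y => T y.1.1 + y.2 y.1.1 - y.1.2 • j y.1.1
  have hF : ContDiff ℝ 1 F := by fun_prop
  have hL : HasFDerivAt (fun x : E × ℝ => F (x, 0))
      ((T - μ₀ • j).comp (ContinuousLinearMap.fst ℝ E ℝ)
        - (ContinuousLinearMap.snd ℝ E ℝ).smulRight (j φ)) (φ, μ₀) := by
    have e : (fun x : E × ℝ => F (x, 0)) = fun x => T x.1 - x.2 • j x.1 := by
      funext x
      simp [F]
    rw [e]
    have h₁ : HasFDerivAt (fun x : E × ℝ => T x.1) (T.comp (ContinuousLinearMap.fst ℝ E ℝ))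
        (φ, μ₀) := (T.comp (ContinuousLinearMap.fst ℝ E ℝ)).hasFDerivAt
    have h₂ : HasFDerivAt (fun x : E × ℝ => j x.1) (j.comp (ContinuousLinearMap.fst ℝ E ℝ))
        (φ, μ₀) := (j.comp (ContinuousLinearMap.fst ℝ E ℝ)).hasFDerivAt
    have h₃ : HasFDerivAt (fun x : E × ℝ => x.2) (ContinuousLinearMap.snd ℝ E ℝ) (φ, μ₀) :=
      hasFDerivAt_snd
    refine (h₁.sub (h₃.smul h₂)).congr_fderiv ?_
    ext <;> simp
  have hs : Function.Surjective ((T - μ₀ • j).comp (ContinuousLinearMap.fst ℝ E ℝ)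
        - (ContinuousLinearMap.snd ℝ E ℝ).smulRight (j φ)) := by
    intro f
    obtain ⟨u, hu⟩ := hrange (f - (ℓ f / ℓ (j φ)) • j φ) (by
      rw [map_sub, map_smul, smul_eq_mul, div_mul_cancel₀ _ hℓ, sub_self])
    refine ⟨(u, -(ℓ f / ℓ (j φ))), ?_⟩
    simp only [_root_.sub_apply, ContinuousLinearMap.comp_apply, ContinuousLinearMap.coe_fst',
      ContinuousLinearMap.smulRight_apply, ContinuousLinearMap.coe_snd', _root_.smul_apply, hu]
    module
  have h := eventually_exists_eq_of_surjective (p₀ := (0 : E →L[ℝ] G)) hF.contDiffAt hL hs hN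
  have h0 : F ((φ, μ₀), 0) = 0 := by simp [F, hφ]
  filter_upwards [h] with B hB
  obtain ⟨x, hx, e⟩ := hB
  exact ⟨x, hx, sub_eq_zero.1 (e.trans h0)⟩

theorem exists_eigenvector_of_norm_lt {T j : E →L[ℝ] G} {φ : E} {μ₀ : ℝ} {ℓ : G →L[ℝ] ℝ}
    (hφ : T φ = μ₀ • j φ) (hℓ : ℓ (j φ) ≠ 0)
    (hrange : ∀ f, ℓ f = 0 → ∃ u, T u - μ₀ • j u = f)
    {N : Set (E × ℝ)} (hN : N ∈ 𝓝 (φ, μ₀)) :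
    ∃ ε > 0, ∀ B : E →L[ℝ] G, ‖B‖ < ε → ∃ x ∈ N, T x.1 + B x.1 = x.2 • j x.1 := by
  obtain ⟨ε, hε, h⟩ := Metric.eventually_nhds_iff.1 (eventually_exists_eigenvector hφ hℓ hrange hN)
  exact ⟨ε, hε, fun B hB => h (by rwa [dist_zero_right])⟩

end Abstract

section Invariant

variable {E G : Type*} [NormedAddCommGroup E] [NormedSpace ℝ E] [NormedAddCommGroup G]
  [NormedSpace ℝ G]

/-- Persistence of a simple eigenvalue within closed subspaces that are preserved by the operator
and by its perturbation. -/
theorem exists_eigenvector_of_invariant {K : Submodule ℝ E} {M : Submodule ℝ G}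
    [CompleteSpace K] [CompleteSpace M] {T j : E →L[ℝ] G} (hT : ∀ x ∈ K, T x ∈ M)
    (hj : ∀ x ∈ K, j x ∈ M) {φ : E} (hφK : φ ∈ K) {μ₀ : ℝ} {ℓ : G →L[ℝ] ℝ}
    (hφ : T φ = μ₀ • j φ) (hℓ : ℓ (j φ) ≠ 0)
    (hrange : ∀ f ∈ M, ℓ f = 0 → ∃ u ∈ K, T u - μ₀ • j u = f) {N : Set (E × ℝ)}
    (hN : N ∈ 𝓝 (φ, μ₀)) :
    ∃ ε > 0, ∀ B : E →L[ℝ] G, (∀ x ∈ K, B x ∈ M) → ‖B‖ < ε →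
      ∃ x μ, (x, μ) ∈ N ∧ x ∈ K ∧ T x + B x = μ • j x := by
  let res : ∀ S : E →L[ℝ] G, (∀ x ∈ K, S x ∈ M) → (K →L[ℝ] M) := fun S hS =>
    (S.comp K.subtypeL).codRestrict M fun x => hS x x.2
  have hN' : (fun y : K × ℝ => ((y.1 : E), y.2)) ⁻¹' N ∈ 𝓝 ((⟨φ, hφK⟩ : K), μ₀) :=
    (by fun_prop : Continuous fun y : K × ℝ => ((y.1 : E), y.2)).continuousAt.preimage_mem_nhds hN
  have hr : ∀ f : M, (ℓ.comp M.subtypeL) f = 0 → ∃ u, res T hT u - μ₀ • res j hj u = f := by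
    rintro ⟨f, hf⟩ hf0
    obtain ⟨u, hu, e⟩ := hrange f hf hf0
    exact ⟨⟨u, hu⟩, Subtype.ext e⟩
  have hφ' : res T hT ⟨φ, hφK⟩ = μ₀ • res j hj ⟨φ, hφK⟩ := Subtype.ext hφ
  have hℓ' : (ℓ.comp M.subtypeL) (res j hj ⟨φ, hφK⟩) ≠ 0 := hℓ
  obtain ⟨ε, hε, h⟩ := exists_eigenvector_of_norm_lt hφ' hℓ' hr hN'
  refine ⟨ε, hε, fun B hB hBε => ?_⟩
  have hle : ‖res B hB‖ ≤ ‖B‖ :=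
    ContinuousLinearMap.opNorm_le_bound _ (norm_nonneg B) fun x => B.le_opNorm x
  obtain ⟨x, hx, e⟩ := h (res B hB) (hle.trans_lt hBε)
  exact ⟨x.1, x.2, hx, x.1.2, congrArg Subtype.val e⟩

end Invariant

/-! ### Counting eigenvalues below a spectral gap -/

section Count

variable {X H ι : Type*} [AddCommGroup X] [Module ℝ X] [NormedAddCommGroup H]
  [InnerProductSpace ℝ H]

/-- Let `T` be symmetric, let `v` be an orthogonal family of eigenvectors, and let the form of `T`
be positive on the orthogonal complement of the family. Then the eigenvectors of `T` with
nonpositive eigenvalues are those that the family provides. -/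
theorem mem_span_of_eigenvector [Fintype ι] {T j : X →ₗ[ℝ] H} (hj : Function.Injective j)
    (hT : ∀ x y, inner ℝ (T x) (j y) = inner ℝ (j x) (T y))
    {v : ι → X} {μ : ι → ℝ} (hv : ∀ i, T (v i) = μ i • j (v i)) (hv0 : ∀ i, v i ≠ 0)
    (ho : Pairwise fun i k => inner ℝ (j (v i)) (j (v k)) = 0)
    (hpos : ∀ x, x ≠ 0 → (∀ i, inner ℝ (j x) (j (v i)) = 0) → 0 < inner ℝ (T x) (j x))
    {r : ℝ} (hr : r ≤ 0) {x : X} (hx : T x = r • j x) :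
    x ∈ Submodule.span ℝ (v '' {i | μ i = r}) := by
  classical
  have hn : ∀ i, inner ℝ (j (v i)) (j (v i)) ≠ 0 := fun i => by
    rw [inner_self_ne_zero]
    exact fun h => hv0 i (hj (h.trans (map_zero j).symm))
  set c : ι → ℝ := fun i => inner ℝ (j x) (j (v i)) / inner ℝ (j (v i)) (j (v i)) with hc
  have hc0 : ∀ i, μ i ≠ r → c i = 0 := fun i hi => by
    have h := hT x (v i)
    rw [hx, hv, inner_smul_left, inner_smul_right, conj_trivial] at h
    have : (r - μ i) * inner ℝ (j x) (j (v i)) = 0 := by linarith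
    simp only [hc]
    rw [(mul_eq_zero.1 this).resolve_left (sub_ne_zero.2 (Ne.symm hi)), zero_div]
  set y : X := x - ∑ i, c i • v i with hy
  have hyo : ∀ k, inner ℝ (j y) (j (v k)) = 0 := fun k => by
    rw [hy, map_sub, map_sum, inner_sub_left, sum_inner, Finset.sum_eq_single k]
    · rw [map_smul, inner_smul_left, conj_trivial]
      simp only [hc]
      rw [div_mul_cancel₀ _ (hn k), sub_self]
    · intro i _ hi
      rw [map_smul, inner_smul_left, ho hi, mul_zero]
    · simp
  have hTy : T y = r • j y := by
    rw [hy, map_sub, map_sub, map_sum, map_sum, hx, smul_sub, Finset.smul_sum]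
    congr 1
    refine Finset.sum_congr rfl fun i _ => ?_
    rw [map_smul, map_smul, hv]
    by_cases hi : μ i = r
    · rw [hi, smul_comm]
    · rw [hc0 i hi, zero_smul, zero_smul, smul_zero]
  have hy0 : y = 0 := by
    by_contra h
    have := hpos y h hyo
    rw [hTy, inner_smul_left, conj_trivial, real_inner_self_eq_norm_sq] at this
    nlinarith [sq_nonneg ‖j y‖]
  rw [hy, sub_eq_zero] at hy0
  rw [hy0]
  refine Submodule.sum_mem _ fun i _ => ?_
  by_cases hi : μ i = r
  · exact Submodule.smul_mem _ _ (Submodule.subset_span ⟨i, hi, rfl⟩)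
  · rw [hc0 i hi, zero_smul]
    exact Submodule.zero_mem _

theorem linearIndependent_of_orthogonal {j : X →ₗ[ℝ] H} (hj : Function.Injective j)
    {v : ι → X} (hv0 : ∀ i, v i ≠ 0)
    (ho : Pairwise fun i k => inner ℝ (j (v i)) (j (v k)) = 0) : LinearIndependent ℝ v := by
  have : LinearIndependent ℝ (j ∘ v) :=
    linearIndependent_of_ne_zero_of_inner_eq_zero
      (fun i h => hv0 i (hj (h.trans (map_zero j).symm))) ho
  exact this.of_comp j

theorem finrank_span_image {v : ι → X} (hv : LinearIndependent ℝ v) (S : Finset ι) :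
    Module.finrank ℝ (Submodule.span ℝ (v '' (S : Set ι))) = S.card := by
  have h : LinearIndependent ℝ (fun i : S => v i) := hv.comp _ Subtype.val_injective
  have e : v '' (S : Set ι) = Set.range fun i : S => v i := by
    ext x
    simp
  rw [e, finrank_span_eq_card h, Fintype.card_coe]

end Count

/-! ### Parity sectors -/

/-- The operator whose kernel consists of the functions with `f(-·) = s f`. -/
def parityDefect (s : ℝ) : RealL2 →L[ℝ] RealL2 :=
  refl.toContinuousLinearMap - s • ContinuousLinearMap.id ℝ RealL2

theorem parityDefect_eq_zero {s : ℝ} {f : RealL2} : parityDefect s f = 0 ↔ refl f = s • f := by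
  rw [← sub_eq_zero (a := refl f)]
  rfl

/-- The inclusion of `H² × H²` in `L² × L²`. -/
def incl2 : (H2 × H2) →L[ℝ] (RealL2 × RealL2) := (d2 0).prodMap (d2 0)

theorem incl2_apply (x : H2 × H2) : incl2 x = (d2 0 x.1, d2 0 x.2) := rfl

/-- The pairs `(f, g)` of square-integrable functions with `f(-·) = s f` and `g(-·) = -s g`. -/
def sectorL2 (s : ℝ) : Submodule ℝ (RealL2 × RealL2) :=
  ((parityDefect s).prodMap (parityDefect (-s))).ker

/-- The pairs of functions of `H²` in the sector of parity `s`. -/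
def sectorH2 (s : ℝ) : Submodule ℝ (H2 × H2) :=
  (((parityDefect s).prodMap (parityDefect (-s))).comp incl2).ker

instance (s : ℝ) : CompleteSpace (sectorL2 s) :=
  inferInstanceAs (CompleteSpace ((parityDefect s).prodMap (parityDefect (-s))).ker)

instance (s : ℝ) : CompleteSpace (sectorH2 s) :=
  inferInstanceAs (CompleteSpace (((parityDefect s).prodMap (parityDefect (-s))).comp incl2).ker)

theorem mem_sectorL2 {s : ℝ} {f : RealL2 × RealL2} :
    f ∈ sectorL2 s ↔ refl f.1 = s • f.1 ∧ refl f.2 = (-s) • f.2 := by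
  rw [← parityDefect_eq_zero, ← parityDefect_eq_zero]
  exact Prod.mk_eq_zero

theorem mem_sectorH2 {s : ℝ} {u : H2 × H2} :
    u ∈ sectorH2 s ↔ refl (d2 0 u.1) = s • d2 0 u.1 ∧ refl (d2 0 u.2) = (-s) • d2 0 u.2 := by
  rw [← parityDefect_eq_zero, ← parityDefect_eq_zero]
  exact Prod.mk_eq_zero

/-- The coupled block of the Hessian at the uncoupled soliton. -/
def block₀ (κ ν a : ℝ) : (H2 × H2) →L[ℝ] (RealL2 × RealL2) :=
  (poschl κ 3).prodMap (a • poschl κ ν)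

theorem block₀_apply (κ ν a : ℝ) (x : H2 × H2) :
    block₀ κ ν a x = (poschl κ 3 x.1, a • poschl κ ν x.2) := rfl

/-- The perturbation of the scalar operator `L₂` by `h = U - U₀` and by the shift `β` of the
frequency. -/
def pertScalar (a k : ℝ) (p : H2 × H2 × ℝ) : H2 →L[ℝ] RealL2 :=
  -(a • (p.2.2 • d2 0 + k • (mulL p.1).comp (d2 0)))

theorem pertScalar_apply (a k : ℝ) (p : H2 × H2 × ℝ) (u : H2) :
    pertScalar a k p u = -(a • (p.2.2 • d2 0 u + k • mulL p.1 (d2 0 u))) := rfl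

/-- The perturbation of the coupled block by `(h, A, β)`. -/
def pertBlock (a k : ℝ) (p : H2 × H2 × ℝ) : (H2 × H2) →L[ℝ] (RealL2 × RealL2) :=
  (ContinuousLinearMap.inl ℝ RealL2 RealL2).comp
    (-((mulL p.1).comp (d2 0)).comp (ContinuousLinearMap.fst ℝ H2 H2)
      - (2 : ℝ) • ((mulL p.2.1).comp (d2 0)).comp (ContinuousLinearMap.snd ℝ H2 H2)) +
  (ContinuousLinearMap.inr ℝ RealL2 RealL2).comp
    (-((2 : ℝ) • ((mulL p.2.1).comp (d2 0)).comp (ContinuousLinearMap.fst ℝ H2 H2))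
      + (pertScalar a k p).comp (ContinuousLinearMap.snd ℝ H2 H2))

theorem pertBlock_apply (a k : ℝ) (p : H2 × H2 × ℝ) (x : H2 × H2) :
    pertBlock a k p x = (-mulL p.1 (d2 0 x.1) - (2 : ℝ) • mulL p.2.1 (d2 0 x.2),
      -((2 : ℝ) • mulL p.2.1 (d2 0 x.1)) + pertScalar a k p x.2) := by
  simp [pertBlock]

/-- The constant in the bounds of the perturbations. -/
def pertConst (a k : ℝ) : ℝ := 5 * ‖mulL‖ + |a| * (1 + |k| * ‖mulL‖)

theorem pertConst_nonneg (a k : ℝ) : 0 ≤ pertConst a k := by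
  unfold pertConst
  positivity

theorem norm_mulL_d2_le (u v : H2) : ‖mulL u (d2 0 v)‖ ≤ ‖mulL‖ * ‖u‖ * ‖v‖ :=
  (mulL.le_opNorm₂ u (d2 0 v)).trans (by gcongr; exact H2.norm_d2_le 0 v)

theorem norm_pertScalar_apply_le (a k : ℝ) (p : H2 × H2 × ℝ) (u : H2) :
    ‖pertScalar a k p u‖ ≤ |a| * (1 + |k| * ‖mulL‖) * ‖p‖ * ‖u‖ := by
  have h₁ : ‖p.1‖ ≤ ‖p‖ := norm_fst_le p
  have h₂ : |p.2.2| ≤ ‖p‖ := (norm_snd_le p.2).trans (norm_snd_le p)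
  have h₃ := norm_mulL_d2_le p.1 u
  have h₄ : ‖d2 0 u‖ ≤ ‖u‖ := H2.norm_d2_le 0 u
  rw [pertScalar_apply, norm_neg, norm_smul, Real.norm_eq_abs]
  calc |a| * ‖p.2.2 • d2 0 u + k • mulL p.1 (d2 0 u)‖
      ≤ |a| * (|p.2.2| * ‖d2 0 u‖ + |k| * ‖mulL p.1 (d2 0 u)‖) := by
        gcongr
        refine (norm_add_le _ _).trans (le_of_eq ?_)
        rw [norm_smul, norm_smul, Real.norm_eq_abs, Real.norm_eq_abs]
    _ ≤ |a| * (‖p‖ * ‖u‖ + |k| * (‖mulL‖ * ‖p‖ * ‖u‖)) := by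
        gcongr
        exact h₃.trans (by gcongr)
    _ = _ := by ring

theorem norm_pertBlock_le (a k : ℝ) (p : H2 × H2 × ℝ) :
    ‖pertBlock a k p‖ ≤ pertConst a k * ‖p‖ := by
  refine ContinuousLinearMap.opNorm_le_bound _
    (mul_nonneg (pertConst_nonneg a k) (norm_nonneg p)) fun x => ?_
  have h₁ : ‖p.1‖ ≤ ‖p‖ := norm_fst_le p
  have h₂ : ‖p.2.1‖ ≤ ‖p‖ := (norm_fst_le p.2).trans (norm_snd_le p)
  have x₁ : ‖x.1‖ ≤ ‖x‖ := norm_fst_le x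
  have x₂ : ‖x.2‖ ≤ ‖x‖ := norm_snd_le x
  have m : ∀ u v : H2, ‖u‖ ≤ ‖p‖ → ‖v‖ ≤ ‖x‖ → ‖mulL u (d2 0 v)‖ ≤ ‖mulL‖ * ‖p‖ * ‖x‖ :=
    fun u v hu hv => (norm_mulL_d2_le u v).trans (by gcongr)
  have m₁ := m _ _ h₁ x₁
  have m₂ := m _ _ h₂ x₂
  have m₃ := m _ _ h₂ x₁
  have m₄ : ‖pertScalar a k p x.2‖ ≤ |a| * (1 + |k| * ‖mulL‖) * ‖p‖ * ‖x‖ :=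
    (norm_pertScalar_apply_le a k p x.2).trans (by gcongr)
  have q : 0 ≤ ‖mulL‖ * ‖p‖ * ‖x‖ := by positivity
  have q' : 0 ≤ |a| * (1 + |k| * ‖mulL‖) * ‖p‖ * ‖x‖ := by positivity
  rw [pertBlock_apply, Prod.norm_mk, pertConst]
  refine max_le ?_ ?_
  · refine (norm_sub_le _ _).trans ?_
    rw [norm_neg, norm_smul, Real.norm_of_nonneg (by norm_num : (0 : ℝ) ≤ 2)]
    linarith
  · refine (norm_add_le _ _).trans ?_
    rw [norm_neg, norm_smul, Real.norm_of_nonneg (by norm_num : (0 : ℝ) ≤ 2)]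
    linarith

theorem norm_pertScalar_le (a k : ℝ) (p : H2 × H2 × ℝ) :
    ‖pertScalar a k p‖ ≤ pertConst a k * ‖p‖ := by
  refine ContinuousLinearMap.opNorm_le_bound _
    (mul_nonneg (pertConst_nonneg a k) (norm_nonneg p)) fun u => ?_
  refine (norm_pertScalar_apply_le a k p u).trans ?_
  rw [pertConst]
  gcongr
  linarith [norm_nonneg mulL]

theorem eventually_mul_norm_lt {V : Type*} [NormedAddCommGroup V] (C : ℝ) {ε : ℝ} (hε : 0 < ε) :
    ∀ᶠ p in 𝓝 (0 : V), C * ‖p‖ < ε := by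
  have h : Tendsto (fun p : V => C * ‖p‖) (𝓝 0) (𝓝 (C * ‖(0 : V)‖)) :=
    (continuous_const.mul continuous_norm).tendsto 0
  rw [norm_zero, mul_zero] at h
  exact h.eventually_lt_const hε

theorem refl_smul_self {s : ℝ} (a : ℝ) {f : RealL2} (h : refl f = s • f) :
    refl (a • f) = s • (a • f) := by
  rw [map_smul, h, smul_comm]

theorem refl_poschl_of_parity {κ ν s : ℝ} {u : H2} (h : refl (d2 0 u) = s • d2 0 u) :
    refl (poschl κ ν u) = s • poschl κ ν u := by
  have : reflH u = s • u := d2_zero_injective (by rw [d2_zero_reflH, h, map_smul])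
  rw [refl_poschl, this, map_smul]

theorem block₀_mem {κ ν a s : ℝ} {x : H2 × H2} (hx : x ∈ sectorH2 s) :
    block₀ κ ν a x ∈ sectorL2 s := by
  rw [mem_sectorH2] at hx
  rw [mem_sectorL2, block₀_apply]
  exact ⟨refl_poschl_of_parity hx.1, refl_smul_self a (refl_poschl_of_parity hx.2)⟩

theorem incl2_mem {s : ℝ} {x : H2 × H2} (hx : x ∈ sectorH2 s) : incl2 x ∈ sectorL2 s :=
  mem_sectorL2.2 (mem_sectorH2.1 hx)

theorem pertBlock_mem {a k s : ℝ} {p : H2 × H2 × ℝ}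
    (h : refl (d2 0 p.1) = (1 : ℝ) • d2 0 p.1) (hA : refl (d2 0 p.2.1) = (-1 : ℝ) • d2 0 p.2.1)
    {x : H2 × H2} (hx : x ∈ sectorH2 s) : pertBlock a k p x ∈ sectorL2 s := by
  rw [mem_sectorH2] at hx
  rw [mem_sectorL2, pertBlock_apply, pertScalar_apply]
  have e₁ := refl_mulL h hx.1
  have e₂ := refl_mulL hA hx.2
  have e₃ := refl_mulL hA hx.1
  have e₄ := refl_mulL h hx.2
  constructor
  · simp only [map_sub, map_neg, map_smul, e₁, e₂]
    module
  · simp only [map_add, map_neg, map_smul, e₃, e₄, hx.2]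
    module

/-- The Fredholm alternative for the coupled block at the uncoupled soliton, within a sector. -/
theorem exists_block₀_sub_eq {κ ν a : ℝ} (hκ : 0 < κ) (hν : 0 < ν - 1) (hν' : 0 < ν) (ha : 0 < a)
    {s : ℝ} (hs : s * s = 1) {μ : ℝ} (hμ : μ ≤ 0) {f : RealL2 × RealL2} (hf : f ∈ sectorL2 s)
    (h₁ : μ = energy κ 3 → inner ℝ f.1 (d2 0 (ground hκ (by norm_num : (0 : ℝ) < 3))) = 0)
    (h₂ : μ = 0 → inner ℝ f.1 (d2 0 (excited hκ (by norm_num : (0 : ℝ) < 3 - 1))) = 0)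
    (h₃ : μ = a * energy κ ν → inner ℝ f.2 (d2 0 (ground hκ hν')) = 0)
    (h₄ : μ = 0 → inner ℝ f.2 (d2 0 (excited hκ hν)) = 0) :
    ∃ u ∈ sectorH2 s, block₀ κ ν a u - μ • incl2 u = f := by
  rw [mem_sectorL2] at hf
  obtain ⟨u, hu, eu⟩ := exists_poschl_sub_eq_of_parity hκ (by norm_num : (0 : ℝ) < 3 - 1)
    (by norm_num) hμ hs hf.1 h₁ h₂
  obtain ⟨v, hv, ev⟩ := exists_poschl_sub_eq_of_parity (μ := μ / a) (s := -s) (f := a⁻¹ • f.2) hκ hν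
    hν' (div_nonpos_of_nonpos_of_nonneg hμ ha.le) (by rw [neg_mul_neg, hs])
    (refl_smul_self _ hf.2)
    (fun h => by
      rw [inner_smul_left, h₃ (by rw [← h]; field_simp), mul_zero])
    (fun h => by
      rw [inner_smul_left, h₄ (by simpa [ha.ne'] using h), mul_zero])
  refine ⟨(u, v), mem_sectorH2.2 ⟨hu, hv⟩, Prod.ext eu ?_⟩
  have e : f.2 = a • (a⁻¹ • f.2) := by rw [smul_smul, mul_inv_cancel₀ ha.ne', one_smul]
  rw [e, ← ev]
  change a • poschl κ ν v - μ • d2 0 v = _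
  rw [smul_sub, smul_smul, mul_div_cancel₀ _ ha.ne']

theorem energy_neg {κ ν : ℝ} (hκ : 0 < κ) (hν : 0 < ν - 1) : energy κ ν < 0 := by
  have : 0 < (2 * ν - 1) * κ ^ 2 := mul_pos (by linarith) (by positivity)
  unfold energy
  linarith

/-- Persistence of a simple eigenvalue of the coupled block within a sector. -/
theorem eventually_exists_sector_eigenvector {κ ν a k s : ℝ} {φ : H2 × H2} {μ₀ : ℝ}
    (hφs : φ ∈ sectorH2 s) (hφ : block₀ κ ν a φ = μ₀ • incl2 φ) {ℓ : RealL2 × RealL2 →L[ℝ] ℝ}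
    (hℓ : ℓ (incl2 φ) ≠ 0)
    (hrange : ∀ f ∈ sectorL2 s, ℓ f = 0 → ∃ u ∈ sectorH2 s, block₀ κ ν a u - μ₀ • incl2 u = f)
    {N : Set ((H2 × H2) × ℝ)} (hN : N ∈ 𝓝 (φ, μ₀)) :
    ∀ᶠ p in 𝓝 (0 : H2 × H2 × ℝ), refl (d2 0 p.1) = (1 : ℝ) • d2 0 p.1 →
      refl (d2 0 p.2.1) = (-1 : ℝ) • d2 0 p.2.1 → ∃ x μ, (x, μ) ∈ N ∧ x ∈ sectorH2 s ∧
        block₀ κ ν a x + pertBlock a k p x = μ • incl2 x := by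
  obtain ⟨ε, hε, h⟩ := exists_eigenvector_of_invariant (fun x hx => block₀_mem hx)
    (fun x hx => incl2_mem hx) hφs hφ hℓ hrange hN
  filter_upwards [eventually_mul_norm_lt (pertConst a k) hε] with p hp h₁ h₂
  exact h _ (fun x hx => pertBlock_mem h₁ h₂ hx) ((norm_pertBlock_le a k p).trans_lt hp)

/-- The ground state of `L₁` persists. -/
theorem eventually_exists_ground_fst {κ ν a : ℝ} (hκ : 0 < κ) (hν : 0 < ν - 1) (ha : 0 < a)
    (k : ℝ) {N : Set ((H2 × H2) × ℝ)}
    (hN : N ∈ 𝓝 ((ground hκ (by norm_num : (0 : ℝ) < 3), (0 : H2)), energy κ 3)) :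
    ∀ᶠ p in 𝓝 (0 : H2 × H2 × ℝ), refl (d2 0 p.1) = (1 : ℝ) • d2 0 p.1 →
      refl (d2 0 p.2.1) = (-1 : ℝ) • d2 0 p.2.1 → ∃ x μ, (x, μ) ∈ N ∧ x ∈ sectorH2 1 ∧
        block₀ κ ν a x + pertBlock a k p x = μ • incl2 x := by
  have hν' : 0 < ν := by linarith
  have hE := energy_neg hκ (by norm_num : (0 : ℝ) < 3 - 1)
  have h3 : (0 : ℝ) < 3 := by norm_num
  have m : ((ground hκ h3, 0) : H2 × H2) ∈ sectorH2 1 :=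
    mem_sectorH2.2 ⟨refl_ground hκ h3, by simp⟩
  have e : block₀ κ ν a (ground hκ h3, 0) = energy κ 3 • incl2 (ground hκ h3, 0) :=
    Prod.ext (poschl_ground hκ h3) (by simp [block₀_apply, incl2_apply])
  refine eventually_exists_sector_eigenvector m e
    (ℓ := (innerSL ℝ (d2 0 (ground hκ h3))).comp (ContinuousLinearMap.fst ℝ RealL2 RealL2))
    (inner_self_ne_zero.2 (ground_ne_zero hκ h3)) (fun f hf hf0 => ?_) hN
  refine exists_block₀_sub_eq hκ hν hν' ha (by norm_num) hE.le hf
    (fun _ => (real_inner_comm _ _).trans hf0) (fun h => absurd h hE.ne)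
    (fun _ => ?_) (fun h => absurd h hE.ne)
  rw [real_inner_comm]
  exact inner_eq_zero_of_parity (s := 1) (by norm_num) (refl_ground hκ hν') (mem_sectorL2.1 hf).2

/-- The kernel of `L₂` persists as an eigenvector. -/
theorem eventually_exists_excited_snd {κ ν a : ℝ} (hκ : 0 < κ) (hν : 0 < ν - 1) (ha : 0 < a)
    (k : ℝ) {N : Set ((H2 × H2) × ℝ)} (hN : N ∈ 𝓝 (((0 : H2), excited hκ hν), (0 : ℝ))) :
    ∀ᶠ p in 𝓝 (0 : H2 × H2 × ℝ), refl (d2 0 p.1) = (1 : ℝ) • d2 0 p.1 →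
      refl (d2 0 p.2.1) = (-1 : ℝ) • d2 0 p.2.1 → ∃ x μ, (x, μ) ∈ N ∧ x ∈ sectorH2 1 ∧
        block₀ κ ν a x + pertBlock a k p x = μ • incl2 x := by
  have hν' : 0 < ν := by linarith
  have hE := energy_neg hκ (by norm_num : (0 : ℝ) < 3 - 1)
  have hE' := energy_neg hκ hν
  have m : ((0, excited hκ hν) : H2 × H2) ∈ sectorH2 1 :=
    mem_sectorH2.2 ⟨by simp, refl_excited hκ hν⟩
  have e : block₀ κ ν a (0, excited hκ hν) = (0 : ℝ) • incl2 (0, excited hκ hν) := by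
    rw [zero_smul, block₀_apply, map_zero, poschl_excited, smul_zero]
    rfl
  refine eventually_exists_sector_eigenvector m e
    (ℓ := (innerSL ℝ (d2 0 (excited hκ hν))).comp (ContinuousLinearMap.snd ℝ RealL2 RealL2))
    (inner_self_ne_zero.2 (excited_ne_zero hκ hν)) (fun f hf hf0 => ?_) hN
  refine exists_block₀_sub_eq hκ hν hν' ha (by norm_num) le_rfl hf
    (fun h => absurd h hE.ne') (fun _ => ?_)
    (fun h => absurd h (mul_neg_of_pos_of_neg ha hE').ne') (fun _ => (real_inner_comm _ _).trans hf0)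
  exact inner_eq_zero_of_parity (s := 1) (by norm_num) (mem_sectorL2.1 hf).1
    (refl_excited hκ (by norm_num))

/-- The ground state of `L₂` persists in the coupled block. -/
theorem eventually_exists_ground_snd {κ ν a : ℝ} (hκ : 0 < κ) (hν : 0 < ν - 1) (hν' : 0 < ν)
    (ha : 0 < a) (k : ℝ) {N : Set ((H2 × H2) × ℝ)}
    (hN : N ∈ 𝓝 (((0 : H2), ground hκ hν'), a * energy κ ν)) :
    ∀ᶠ p in 𝓝 (0 : H2 × H2 × ℝ), refl (d2 0 p.1) = (1 : ℝ) • d2 0 p.1 →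
      refl (d2 0 p.2.1) = (-1 : ℝ) • d2 0 p.2.1 → ∃ x μ, (x, μ) ∈ N ∧ x ∈ sectorH2 (-1) ∧
        block₀ κ ν a x + pertBlock a k p x = μ • incl2 x := by
  have hE := mul_neg_of_pos_of_neg ha (energy_neg hκ hν)
  have m : ((0, ground hκ hν') : H2 × H2) ∈ sectorH2 (-1) :=
    mem_sectorH2.2 ⟨by simp, by rw [neg_neg]; exact refl_ground hκ hν'⟩
  have e : block₀ κ ν a (0, ground hκ hν') = (a * energy κ ν) • incl2 (0, ground hκ hν') := by
    rw [block₀_apply, map_zero, poschl_ground, smul_smul, incl2_apply, map_zero, Prod.smul_mk,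
      smul_zero]
  refine eventually_exists_sector_eigenvector m e
    (ℓ := (innerSL ℝ (d2 0 (ground hκ hν'))).comp (ContinuousLinearMap.snd ℝ RealL2 RealL2))
    (inner_self_ne_zero.2 (ground_ne_zero hκ hν')) (fun f hf hf0 => ?_) hN
  refine exists_block₀_sub_eq hκ hν hν' ha (by norm_num) hE.le hf
    (fun _ => ?_) (fun h => absurd h hE.ne)
    (fun _ => (real_inner_comm _ _).trans hf0) (fun h => absurd h hE.ne)
  rw [real_inner_comm]
  exact inner_eq_zero_of_parity (s := 1) (by norm_num) (refl_ground hκ (by norm_num))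
    (mem_sectorL2.1 hf).1

/-- The ground state of the scalar operator `L₂` persists. -/
theorem eventually_exists_ground_scalar {κ ν a : ℝ} (hκ : 0 < κ) (hν : 0 < ν - 1) (hν' : 0 < ν)
    (ha : 0 < a) (k : ℝ) {N : Set (H2 × ℝ)} (hN : N ∈ 𝓝 (ground hκ hν', a * energy κ ν)) :
    ∀ᶠ p in 𝓝 (0 : H2 × H2 × ℝ), ∃ x ∈ N,
      a • poschl κ ν x.1 + pertScalar a k p x.1 = x.2 • d2 0 x.1 := by
  have hE := energy_neg hκ hν
  obtain ⟨ε, hε, h⟩ := exists_eigenvector_of_norm_lt (T := a • poschl κ ν) (j := d2 0)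
    (ℓ := innerSL ℝ (d2 0 (ground hκ hν'))) (φ := ground hκ hν') (μ₀ := a * energy κ ν)
    (by rw [_root_.smul_apply, poschl_ground, smul_smul])
    (inner_self_ne_zero.2 (ground_ne_zero hκ hν')) (fun f hf => by
      obtain ⟨u, hu⟩ := exists_poschl_sub_eq (f := a⁻¹ • f) hκ hν hν' hE.le
        (fun _ => by
          rw [inner_smul_left, real_inner_comm]
          exact mul_eq_zero_of_right _ hf) (fun h => absurd h hE.ne)
      refine ⟨u, ?_⟩
      have e : f = a • (a⁻¹ • f) := by rw [smul_smul, mul_inv_cancel₀ ha.ne', one_smul]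
      rw [e, ← hu, _root_.smul_apply, smul_sub, smul_smul]) hN
  filter_upwards [eventually_mul_norm_lt (pertConst a k) hε] with p hp
  exact h _ ((norm_pertScalar_le a k p).trans_lt hp)

/-! ### The system in terms of the Pöschl–Teller operators -/

/-- The inverse length scale `√c / 2` of the soliton. -/
def kap (c : ℝ) : ℝ := √c / 2

/-- The Pöschl–Teller parameter `ν` of `L₂`, with `ν (ν + 1) = 12 k`. -/
def nu (k : ℝ) : ℝ := (√(1 + 48 * k) - 3) / 2 + 1

theorem kap_pos {c : ℝ} (hc : 0 < c) : 0 < kap c := by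
  unfold kap
  positivity

theorem kap_sq {c : ℝ} (hc : 0 < c) : kap c ^ 2 = c / 4 := by
  rw [kap, div_pow, Real.sq_sqrt hc.le]
  norm_num

theorem nu_sub_one (k : ℝ) : nu k - 1 = (√(1 + 48 * k) - 3) / 2 := by
  unfold nu
  ring

theorem nu_sub_one_pos {k : ℝ} (hk : 1 / 6 < k) : 0 < nu k - 1 := by
  rw [nu_sub_one]
  have : (3 : ℝ) < √(1 + 48 * k) := Real.lt_sqrt_of_sq_lt (by linarith)
  linarith

theorem nu_mul {k : ℝ} (hk : 1 / 6 < k) : nu k * (nu k + 1) = 12 * k := by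
  have : √(1 + 48 * k) ^ 2 = 1 + 48 * k := Real.sq_sqrt (by linarith)
  unfold nu
  linear_combination (1 / 4) * this

/-- The function `g̃` as an element of `H²(ℝ)`. -/
def gT {c k : ℝ} (hc : 0 < c) (hk : 1 / 6 < k) : H2 := excited (kap_pos hc) (nu_sub_one_pos hk)

theorem coeFn_gT {c k : ℝ} (hc : 0 < c) (hk : 1 / 6 < k) :
    d2 0 (gT hc hk) =ᵐ[volume] gTilde c k := by
  filter_upwards [(coeFn_excited (kap_pos hc) (nu_sub_one_pos hk)).1] with x hx
  rw [gT, hx, sechTanh, nu_sub_one]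
  rfl

theorem coeFn_U₀ {c : ℝ} (hc : 0 < c) : (d2 0 (U₀ hc) =ᵐ[volume] soliton c) ∧
    (d2 1 (U₀ hc) =ᵐ[volume] soliton' c) ∧ (d2 2 (U₀ hc) =ᵐ[volume] soliton'' c) :=
  coeFn_d2_ofHasDerivAt _ _ _ _ _

theorem mulL_U₀ {c : ℝ} (hc : 0 < c) (f : RealL2) :
    mulL (U₀ hc) f = (3 * c) • mulOp (sechSqL (kap c)) f := by
  refine Lp.ext ?_
  filter_upwards [coeFn_mulL (U₀ hc) f, (coeFn_U₀ hc).1, coeFn_sechSqL (kap c) f,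
    Lp.coeFn_smul (3 * c) (mulOp (sechSqL (kap c)) f)] with x h₁ h₂ h₃ h₄
  rw [h₁, h₂, h₄, Pi.smul_apply, h₃, soliton, smul_eq_mul, mul_assoc]
  rfl

theorem poschl_three {c : ℝ} (hc : 0 < c) (u : H2) :
    poschl (kap c) 3 u = -d2 2 u + c • d2 0 u - mulL (U₀ hc) (d2 0 u) := by
  have h := kap_sq hc
  rw [poschl_apply, mulL_U₀, show ((3 : ℝ) - 1) ^ 2 * kap c ^ 2 = c by rw [h]; ring,
    show (3 : ℝ) * (3 + 1) * kap c ^ 2 = 3 * c by rw [h]; ring]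

theorem poschl_nu {c k : ℝ} (hc : 0 < c) (hk : 1 / 6 < k) (u : H2) :
    poschl (kap c) (nu k) u = -d2 2 u - Ωc2 c k • d2 0 u - k • mulL (U₀ hc) (d2 0 u) := by
  have h := kap_sq hc
  rw [poschl_apply, mulL_U₀, smul_smul, nu_mul hk, h, nu_sub_one, Ωc2,
    show 12 * k * (c / 4) = k * (3 * c) by ring,
    show ((√(1 + 48 * k) - 3) / 2) ^ 2 * (c / 4) = -(-(c / 16) * (√(1 + 48 * k) - 3) ^ 2) by ring]
  module

theorem U₀_equation {c : ℝ} (hc : 0 < c) :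
    d2 2 (U₀ hc) - c • d2 0 (U₀ hc) + (1 / 2 : ℝ) • mulL (U₀ hc) (d2 0 (U₀ hc)) = 0 := by
  refine Lp.ext ?_
  filter_upwards [Lp.coeFn_add (d2 2 (U₀ hc) - c • d2 0 (U₀ hc))
    ((1 / 2 : ℝ) • mulL (U₀ hc) (d2 0 (U₀ hc))), Lp.coeFn_sub (d2 2 (U₀ hc)) (c • d2 0 (U₀ hc)),
    Lp.coeFn_smul c (d2 0 (U₀ hc)), Lp.coeFn_smul (1 / 2 : ℝ) (mulL (U₀ hc) (d2 0 (U₀ hc))),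
    coeFn_mulL (U₀ hc) (d2 0 (U₀ hc)), (coeFn_U₀ hc).1, (coeFn_U₀ hc).2.2,
    Lp.coeFn_zero ℝ 2 (volume : Measure ℝ)] with x h₁ h₂ h₃ h₄ h₅ h₆ h₇ h₈
  rw [h₁, Pi.add_apply, h₂, Pi.sub_apply, h₃, Pi.smul_apply, h₄, Pi.smul_apply, h₅, h₆, h₇, h₈,
    soliton'']
  simp only [smul_eq_mul, Pi.zero_apply]
  ring

theorem refl_U₀ {c : ℝ} (hc : 0 < c) : refl (d2 0 (U₀ hc)) = (1 : ℝ) • d2 0 (U₀ hc) := by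
  rw [one_smul]
  refine Lp.ext ?_
  have h := (Measure.measurePreserving_neg (volume : Measure ℝ)).quasiMeasurePreserving.ae
    (coeFn_U₀ hc).1
  filter_upwards [coeFn_refl (d2 0 (U₀ hc)), h, (coeFn_U₀ hc).1] with x h₁ h₂ h₃
  rw [h₁, h₂, h₃, soliton, soliton, mul_neg, sech_neg]

theorem coe_sq (u : H2) : ((mulL u (d2 0 u) : RealL2) : RealL0) = D 0 u ^ 2 := by
  rw [coe_mulL, sq]
  rfl

theorem coe_L2_injective {f g : RealL2} (h : (f : RealL0) = (g : RealL0)) : f = g :=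
  Subtype.ext h

theorem defect_U_eq {c : ℝ} (hc : 0 < c) (U A : H2) :
    d2 2 U - c • d2 0 U + (1 / 2 : ℝ) • mulL U (d2 0 U) + mulL A (d2 0 A) =
      ((1 / 2 : ℝ) • mulL (U - U₀ hc) (d2 0 (U - U₀ hc)) + mulL A (d2 0 A))
      - poschl (kap c) 3 (U - U₀ hc) := by
  have h := U₀_equation hc
  have h' := mulL_comm (U₀ hc) U
  rw [poschl_three hc]
  simp only [map_sub, _root_.sub_apply]
  rw [← h', ← sub_eq_zero, ← h]
  module

theorem defect_A_eq {c k : ℝ} (hc : 0 < c) (hk : 1 / 6 < k) (Ω : ℝ) (U A : H2) :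
    d2 2 A + Ω • d2 0 A + k • mulL U (d2 0 A) =
      ((Ω - Ωc2 c k) • d2 0 A + k • mulL (U - U₀ hc) (d2 0 A)) - poschl (kap c) (nu k) A := by
  rw [poschl_nu hc hk, map_sub, _root_.sub_apply]
  module

theorem equation_U_iff {c : ℝ} (hc : 0 < c) (U A : H2) :
    D 2 U - c • D 0 U + (1 / 2 : ℝ) • D 0 U ^ 2 + D 0 A ^ 2 = 0 ↔
      poschl (kap c) 3 (U - U₀ hc) = (1 / 2 : ℝ) • mulL (U - U₀ hc) (d2 0 (U - U₀ hc))
        + mulL A (d2 0 A) := by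
  have e : D 2 U - c • D 0 U + (1 / 2 : ℝ) • D 0 U ^ 2 + D 0 A ^ 2 =
      ((d2 2 U - c • d2 0 U + (1 / 2 : ℝ) • mulL U (d2 0 U) + mulL A (d2 0 A) : RealL2)
        : RealL0) := by
    rw [← coe_sq, ← coe_sq]
    rfl
  rw [e, defect_U_eq hc]
  constructor
  · intro h
    exact (sub_eq_zero.1 (coe_L2_injective h)).symm
  · intro h
    rw [h, sub_self]
    rfl

theorem equation_A_iff {c k : ℝ} (hc : 0 < c) (hk : 1 / 6 < k) (Ω : ℝ) (U A : H2) :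
    D 2 A + Ω • D 0 A + k • (D 0 U * D 0 A) = 0 ↔
      poschl (kap c) (nu k) A = (Ω - Ωc2 c k) • d2 0 A + k • mulL (U - U₀ hc) (d2 0 A) := by
  have e : D 2 A + Ω • D 0 A + k • (D 0 U * D 0 A) =
      ((d2 2 A + Ω • d2 0 A + k • mulL U (d2 0 A) : RealL2) : RealL0) := by
    rw [D_eq 0 A, ← coe_mulL]
    rfl
  rw [e, defect_A_eq hc hk]
  constructor
  · intro h
    exact (sub_eq_zero.1 (coe_L2_injective h)).symm
  · intro h
    rw [h, sub_self]
    rfl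

/-! ### The function `L₁⁻¹ g̃²` -/

theorem coe_L₁_U₀ {c : ℝ} (hc : 0 < c) (u : H2) :
    L₁ c (U₀ hc) u = (poschl (kap c) 3 u : RealL0) := by
  rw [poschl_three hc]
  have h := coe_mulL (U₀ hc) (d2 0 u)
  change -D 2 u + c • D 0 u - D 0 (U₀ hc) * D 0 u = _
  rw [D_eq 0 u, ← h]
  rfl

theorem isInvGTildeSq_iff {c k : ℝ} (hc : 0 < c) (hk : 1 / 6 < k) (W : H2) :
    IsInvGTildeSq hc k W ↔ refl (d2 0 W) = (1 : ℝ) • d2 0 W ∧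
      poschl (kap c) 3 W = mulL (gT hc hk) (d2 0 (gT hc hk)) := by
  rw [IsInvGTildeSq, isEven_iff, coe_L₁_U₀]
  refine and_congr_right fun _ => ?_
  have hg : (mulL (gT hc hk) (d2 0 (gT hc hk)) : RealL2) =ᵐ[volume]
      fun x => gTilde c k x ^ 2 := by
    filter_upwards [coeFn_mulL (gT hc hk) (d2 0 (gT hc hk)), coeFn_gT hc hk] with x h₁ h₂
    rw [h₁, h₂, sq]
  constructor
  · intro h
    exact Lp.ext (h.trans hg.symm)
  · intro h
    rw [h]
    exact hg

theorem pairing_eq {c k : ℝ} (hc : 0 < c) (hk : 1 / 6 < k) (W : H2) :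
    pairing c k W = inner ℝ (mulL W (d2 0 (gT hc hk))) (d2 0 (gT hc hk)) := by
  rw [pairing, inner_L2_eq]
  refine integral_congr_ae ?_
  filter_upwards [coeFn_mulL W (d2 0 (gT hc hk)), coeFn_gT hc hk] with x h₁ h₂
  rw [h₁, h₂, D_eq]
  ring

theorem refl_gT {c k : ℝ} (hc : 0 < c) (hk : 1 / 6 < k) :
    refl (d2 0 (gT hc hk)) = (-1 : ℝ) • d2 0 (gT hc hk) := refl_excited _ _

/-- `L₁` is bijective on even functions. -/
theorem existsUnique_poschl_three_eq {κ : ℝ} (hκ : 0 < κ) {f : RealL2}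
    (hf : refl f = (1 : ℝ) • f) :
    ∃! u : H2, refl (d2 0 u) = (1 : ℝ) • d2 0 u ∧ poschl κ 3 u = f := by
  have h2 : (0 : ℝ) < 3 - 1 := by norm_num
  have hE := energy_neg hκ h2
  obtain ⟨u, hu, e⟩ := exists_poschl_sub_eq_of_parity hκ h2 (by norm_num) le_rfl (by norm_num) hf
    (fun h => absurd h hE.ne') (fun _ => inner_eq_zero_of_parity (by norm_num) hf
      (refl_excited hκ h2))
  rw [zero_smul, sub_zero] at e
  refine ⟨u, ⟨hu, e⟩, fun v ⟨hv, ev⟩ => ?_⟩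
  obtain ⟨K, hK, hb⟩ := exists_norm_le_norm_poschl hκ h2 (by norm_num)
  have h := hb (v - u) (inner_eq_zero_of_parity (s := 1) (by norm_num)
    (by rw [map_sub, map_sub, hu, hv, smul_sub]) (refl_excited hκ h2))
  rw [map_sub, e, ev, sub_self, norm_zero, mul_zero] at h
  exact sub_eq_zero.1 (norm_le_zero_iff.1 h)

theorem existsUnique_isInvGTildeSq {c k : ℝ} (hc : 0 < c) (hk : 1 / 6 < k) :
    ∃! W : H2, IsInvGTildeSq hc k W := by
  simp only [isInvGTildeSq_iff hc hk]
  refine existsUnique_poschl_three_eq (kap_pos hc) ?_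
  rw [refl_mulL (refl_gT hc hk) (refl_gT hc hk)]
  norm_num

/-! ### Existence of the branch -/

/-- The projection of `L² × L²` onto the pairs of an even and an odd function. -/
def projEven : RealL2 × RealL2 →L[ℝ] sectorL2 1 :=
  ContinuousLinearMap.codRestrict
    (((1 / 2 : ℝ) • (ContinuousLinearMap.id ℝ RealL2 + refl.toContinuousLinearMap)).prodMap
      ((1 / 2 : ℝ) • (ContinuousLinearMap.id ℝ RealL2 - refl.toContinuousLinearMap)))
    (sectorL2 1) fun f => by
      refine mem_sectorL2.2 ⟨?_, ?_⟩
      · change refl ((1 / 2 : ℝ) • (f.1 + refl f.1)) = (1 : ℝ) • ((1 / 2 : ℝ) • (f.1 + refl f.1))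
        rw [map_smul, map_add, refl_refl]
        module
      · change refl ((1 / 2 : ℝ) • (f.2 - refl f.2)) =
          (-1 : ℝ) • ((1 / 2 : ℝ) • (f.2 - refl f.2))
        rw [map_smul, map_sub, refl_refl]
        module

theorem projEven_of_mem {f : RealL2 × RealL2} (hf : f ∈ sectorL2 1) : (projEven f : _) = f := by
  obtain ⟨h₁, h₂⟩ := mem_sectorL2.1 hf
  refine Prod.ext ?_ ?_
  · change (1 / 2 : ℝ) • (f.1 + refl f.1) = f.1
    rw [h₁]
    module
  · change (1 / 2 : ℝ) • (f.2 - refl f.2) = f.2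
    rw [h₂]
    module

/-- The defect of the rescaled system at `U = U₀ + t w`, `A = √t (g + t χ)`, `Ω = Ω̃ + t θ`. In the
unknowns `(w, χ, θ)` the system is a regular perturbation problem in `t`. -/
def branchDefect (κ ν k : ℝ) (g w χ : H2) (θ t : ℝ) : RealL2 × RealL2 :=
  (poschl κ 3 w - ((t / 2) • mulL w (d2 0 w) + mulL (g + t • χ) (d2 0 (g + t • χ))),
    poschl κ ν χ - (θ • d2 0 (g + t • χ) + k • mulL w (d2 0 (g + t • χ))))

theorem contDiffAt_branchDefect {X : Type*} [NormedAddCommGroup X] [NormedSpace ℝ X]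
    (κ ν k : ℝ) (g : H2) {w χ : X → H2} {θ t : X → ℝ} {x : X} (hw : ContDiffAt ℝ 1 w x)
    (hχ : ContDiffAt ℝ 1 χ x) (hθ : ContDiffAt ℝ 1 θ x) (ht : ContDiffAt ℝ 1 t x) :
    ContDiffAt ℝ 1 (fun y => branchDefect κ ν k g (w y) (χ y) (θ y) (t y)) x := by
  have hL : ∀ {Y Z : Type} [NormedAddCommGroup Y] [NormedSpace ℝ Y] [NormedAddCommGroup Z]
      [NormedSpace ℝ Z] (L : Y →L[ℝ] Z) {u : X → Y}, ContDiffAt ℝ 1 u x →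
      ContDiffAt ℝ 1 (fun y => L (u y)) x := fun L _ hu => L.contDiff.contDiffAt.comp x hu
  have hG : ContDiffAt ℝ 1 (fun y => g + t y • χ y) x := contDiffAt_const.add (ht.smul hχ)
  have m : ∀ {u v : X → H2}, ContDiffAt ℝ 1 u x → ContDiffAt ℝ 1 v x →
      ContDiffAt ℝ 1 (fun y => mulL (u y) (d2 0 (v y))) x :=
    fun hu hv => (hL mulL hu).clm_apply (hL (d2 0) hv)
  exact ((hL _ hw).sub (((ht.div_const 2).smul (m hw hw)).add (m hG hG))).prodMk
    ((hL _ hχ).sub ((hθ.smul (hL _ hG)).add ((m hw hG).const_smul k)))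

theorem branchDefect_mem {κ ν k : ℝ} {g : H2} (hg : refl (d2 0 g) = (-1 : ℝ) • d2 0 g)
    {w χ : H2} (h : (w, χ) ∈ sectorH2 1) (θ t : ℝ) :
    branchDefect κ ν k g w χ θ t ∈ sectorL2 1 := by
  obtain ⟨hw, hχ⟩ := mem_sectorH2.1 h
  have hG : refl (d2 0 (g + t • χ)) = (-1 : ℝ) • d2 0 (g + t • χ) := by
    rw [map_add, map_smul, map_add, map_smul, hg, hχ]
    module
  unfold branchDefect
  generalize g + t • χ = G at hG ⊢
  have e₁ := refl_mulL hw hw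
  have e₂ := refl_mulL hG hG
  have e₃ := refl_mulL hw hG
  have e₄ := refl_poschl_of_parity (κ := κ) (ν := 3) hw
  have e₅ := refl_poschl_of_parity (κ := κ) (ν := ν) hχ
  refine mem_sectorL2.2 ⟨?_, ?_⟩
  · simp only [map_sub, map_add, map_smul _ (t / 2), e₁, e₂, e₄]
    module
  · simp only [map_sub, map_add _ (θ • _), map_smul _ θ, map_smul _ k, hG, e₃, e₅]
    module

/-- The linear part of the rescaled system at `t = 0`, in the unknowns `((w, χ), θ)`. -/
def linearizedMap (κ ν k : ℝ) (g : H2) : (H2 × H2) × ℝ →L[ℝ] RealL2 × RealL2 :=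
  (((poschl κ 3).comp (ContinuousLinearMap.fst ℝ H2 H2)).prod
    ((poschl κ ν).comp (ContinuousLinearMap.snd ℝ H2 H2)
      - k • (mulL.flip (d2 0 g)).comp (ContinuousLinearMap.fst ℝ H2 H2))).comp
    (ContinuousLinearMap.fst ℝ (H2 × H2) ℝ) -
  (ContinuousLinearMap.inr ℝ RealL2 RealL2).comp
    ((ContinuousLinearMap.snd ℝ (H2 × H2) ℝ).smulRight (d2 0 g))

theorem linearizedMap_apply (κ ν k : ℝ) (g : H2) (x : H2 × H2) (θ : ℝ) :
    linearizedMap κ ν k g (x, θ) =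
      (poschl κ 3 x.1, poschl κ ν x.2 - (θ • d2 0 g + k • mulL x.1 (d2 0 g))) := by
  refine Prod.ext ?_ ?_
  · change _ - (0 : RealL2) = _
    rw [sub_zero]
    rfl
  · change poschl κ ν x.2 - k • mulL x.1 (d2 0 g) - θ • d2 0 g = _
    module

theorem linearizedMap_eq {κ ν k : ℝ} {g : H2} {x : H2 × H2} {θ : ℝ} {f : RealL2 × RealL2}
    (h₁ : poschl κ 3 x.1 = f.1)
    (h₂ : poschl κ ν x.2 - (θ • d2 0 g + k • mulL x.1 (d2 0 g)) = f.2) :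
    linearizedMap κ ν k g (x, θ) = f := by
  rw [linearizedMap_apply]
  exact Prod.ext h₁ h₂

theorem branchDefect_zero (κ ν k : ℝ) (g : H2) (x : H2 × H2) (θ : ℝ) :
    branchDefect κ ν k g x.1 x.2 θ (0 / θ) =
      linearizedMap κ ν k g (x, θ) - (mulL g (d2 0 g), 0) := by
  rw [linearizedMap_apply, branchDefect, zero_div, zero_div, zero_smul, zero_smul, zero_add,
    add_zero, Prod.mk_sub_mk, sub_zero]

/-- Solvability of the rescaled system linearized at `t = 0`: the unknown `θ` makes the second
equation solvable. -/
theorem exists_linearized_eq {c k : ℝ} (hc : 0 < c) (hk : 1 / 6 < k) {f : RealL2 × RealL2}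
    (hf : f ∈ sectorL2 1) : ∃ x ∈ sectorH2 1, ∃ θ : ℝ, poschl (kap c) 3 x.1 = f.1 ∧
      poschl (kap c) (nu k) x.2 - (θ • d2 0 (gT hc hk) +
        k • mulL x.1 (d2 0 (gT hc hk))) = f.2 := by
  obtain ⟨h₁, h₂⟩ := mem_sectorL2.1 hf
  obtain ⟨w, ⟨hw, ew⟩, -⟩ := existsUnique_poschl_three_eq (kap_pos hc) h₁
  have hν := nu_sub_one_pos hk
  have hE := energy_neg (kap_pos hc) hν
  have hg := refl_gT hc hk
  have hg0 : ‖d2 0 (gT hc hk)‖ ^ 2 ≠ 0 :=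
    pow_ne_zero _ (norm_ne_zero_iff.2 (excited_ne_zero (kap_pos hc) hν))
  set f' := f.2 + k • mulL w (d2 0 (gT hc hk)) with hf'
  set θ := -(inner ℝ f' (d2 0 (gT hc hk)) / ‖d2 0 (gT hc hk)‖ ^ 2) with hθ
  obtain ⟨χ, hχ, eχ⟩ := exists_poschl_sub_eq_of_parity (κ := kap c) (ν := nu k) (μ := 0) (s := -1)
    (f := f' + θ • d2 0 (gT hc hk)) (kap_pos hc) hν (by linarith) le_rfl (by norm_num) (by
      have := refl_mulL hw hg
      rw [map_add, map_smul, hf', map_add, map_smul, this, h₂, hg]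
      module)
    (fun h => absurd h hE.ne') (fun _ => by
      change inner ℝ _ (d2 0 (gT hc hk)) = 0
      rw [inner_add_left, inner_smul_left, real_inner_self_eq_norm_sq, hθ]
      rw [conj_trivial, neg_mul, div_mul_cancel₀ _ hg0, add_neg_cancel])
  refine ⟨(w, χ), mem_sectorH2.2 ⟨hw, hχ⟩, θ, ew, ?_⟩
  rw [zero_smul, sub_zero] at eχ
  rw [eχ, hf']
  module

/-- Solutions of `F(x, θ, β) = 0` with `x` in an invariant subspace `K`, for `F` affine in `(x, θ)`
at `β = 0`. -/
theorem eventually_exists_zero_of_invariant {X Y : Type*} [NormedAddCommGroup X] [NormedSpace ℝ X]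
    [NormedAddCommGroup Y] [NormedSpace ℝ Y] {K : Submodule ℝ X} [CompleteSpace K]
    {M : Submodule ℝ Y} [CompleteSpace M] (Q : Y →L[ℝ] M) (hQ : ∀ y ∈ M, (Q y : Y) = y)
    {F : X → ℝ → ℝ → Y} {x₀ : X} (hx₀ : x₀ ∈ K) {θ₀ : ℝ}
    (hF : ContDiffAt ℝ 1 (fun q : (X × ℝ) × ℝ => F q.1.1 q.1.2 q.2) ((x₀, θ₀), 0))
    (hmem : ∀ x ∈ K, ∀ θ β, F x θ β ∈ M) (L : X × ℝ →L[ℝ] Y) {b : Y}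
    (hslice : ∀ x θ, F x θ 0 = L (x, θ) - b) (h₀ : L (x₀, θ₀) = b)
    (hsurj : ∀ f ∈ M, ∃ x ∈ K, ∃ θ, L (x, θ) = f) {N : Set (X × ℝ)} (hN : N ∈ 𝓝 (x₀, θ₀)) :
    ∀ᶠ β in 𝓝 (0 : ℝ), ∃ x ∈ K, ∃ θ, (x, θ) ∈ N ∧ F x θ β = 0 := by
  let i : K × ℝ →L[ℝ] X × ℝ := K.subtypeL.prodMap (ContinuousLinearMap.id ℝ ℝ)
  let F' : (K × ℝ) × ℝ → M := fun q => Q (F (q.1.1 : X) q.1.2 q.2)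
  have hF' : ContDiffAt ℝ 1 F' ((⟨x₀, hx₀⟩, θ₀), 0) := by
    have h := hF.comp ((⟨x₀, hx₀⟩, θ₀), 0)
      (i.prodMap (ContinuousLinearMap.id ℝ ℝ)).contDiff.contDiffAt
    exact Q.contDiff.contDiffAt.comp _ h
  have hs : ∀ y : K × ℝ, F' (y, 0) = (Q.comp (L.comp i)) y - Q b := fun y => by
    change Q (F (y.1 : X) y.2 0) = Q (L (y.1, y.2)) - Q b
    rw [hslice, map_sub]
  have hd : HasFDerivAt (fun y => F' (y, 0)) (Q.comp (L.comp i)) (⟨x₀, hx₀⟩, θ₀) := by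
    simp only [hs]
    exact (Q.comp (L.comp i)).hasFDerivAt.sub_const _
  have hsj : Function.Surjective (Q.comp (L.comp i)) := by
    rintro ⟨f, hf⟩
    obtain ⟨x, hx, θ, e⟩ := hsurj f hf
    refine ⟨(⟨x, hx⟩, θ), Subtype.ext ?_⟩
    change ((Q (L (x, θ)) : M) : Y) = f
    rw [e, hQ f hf]
  have h0 : F' ((⟨x₀, hx₀⟩, θ₀), 0) = 0 := by
    rw [hs]
    change Q (L (x₀, θ₀)) - Q b = 0
    rw [h₀, sub_self]
  filter_upwards [eventually_exists_eq_of_surjective hF' hd hsj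
    (i.continuous.continuousAt.preimage_mem_nhds hN)] with β ⟨⟨⟨x, hx⟩, θ⟩, hxN, e⟩
  refine ⟨x, hx, θ, hxN, ?_⟩
  rw [h0] at e
  rw [← hQ _ (hmem x hx θ β)]
  exact congrArg Subtype.val e

theorem setOf_norm_lt_mem_nhds {X Y : Type*} [NormedAddCommGroup X] [NormedAddCommGroup Y]
    {x₀ : X × Y} {r θ₀ : ℝ} (h₁ : ‖x₀.1‖ ≤ r) (h₂ : ‖x₀.2‖ ≤ r) (hθ₀ : θ₀ ≠ 0) :
    {y : (X × Y) × ℝ | ‖y.1.1‖ < r + 1 ∧ ‖y.1.2‖ < r + 1 ∧ |y.2 - θ₀| < |θ₀| / 2} ∈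
      𝓝 (x₀, θ₀) := by
  refine IsOpen.mem_nhds ?_ ⟨lt_add_of_le_of_pos h₁ one_pos, lt_add_of_le_of_pos h₂ one_pos, by
    simpa using hθ₀⟩
  have c₁ : Continuous fun y : (X × Y) × ℝ => ‖y.1.1‖ := by fun_prop
  have c₂ : Continuous fun y : (X × Y) × ℝ => ‖y.1.2‖ := by fun_prop
  have c₃ : Continuous fun y : (X × Y) × ℝ => |y.2 - θ₀| := by fun_prop
  exact (isOpen_lt c₁ continuous_const).inter
    ((isOpen_lt c₂ continuous_const).inter (isOpen_lt c₃ continuous_const))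

/-- A solution of the rescaled system gives a solution of the original one. -/
theorem equations_of_branchDefect_eq_zero {κ ν k : ℝ} {g : H2} (hTg : poschl κ ν g = 0)
    {w χ : H2} {θ t : ℝ} (ht : 0 ≤ t) (e : branchDefect κ ν k g w χ θ t = 0) :
    poschl κ 3 (t • w) = (1 / 2 : ℝ) • mulL (t • w) (d2 0 (t • w)) +
      mulL (√t • (g + t • χ)) (d2 0 (√t • (g + t • χ))) ∧
    poschl κ ν (√t • (g + t • χ)) = (t * θ) • d2 0 (√t • (g + t • χ)) +
      k • mulL (t • w) (d2 0 (√t • (g + t • χ))) := by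
  have hsq : √t * √t = t := Real.mul_self_sqrt ht
  have hTG : poschl κ ν (g + t • χ) = t • poschl κ ν χ := by
    rw [map_add, map_smul, hTg, zero_add]
  have h₁ := sub_eq_zero.1 (congrArg Prod.fst e)
  have h₂ := sub_eq_zero.1 (congrArg Prod.snd e)
  generalize g + t • χ = G at *
  constructor
  · simp only [map_smul, _root_.smul_apply]
    rw [h₁]
    conv_rhs => rw [smul_smul (√t) (√t), hsq]
    module
  · rw [map_smul, hTG, h₂]
    simp only [map_smul, _root_.smul_apply]
    module

/-- The solution of the rescaled system at `t = 0`. The sign of `θ₀` is opposite to that of the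
pairing `P`. -/
theorem exists_branchDefect_zero_eq_zero {c k : ℝ} (hc : 0 < c) (hk : 1 / 6 < k) {W : H2}
    (hW : refl (d2 0 W) = (1 : ℝ) • d2 0 W)
    (eW : poschl (kap c) 3 W = mulL (gT hc hk) (d2 0 (gT hc hk))) {P : ℝ}
    (hP : P = inner ℝ (mulL W (d2 0 (gT hc hk))) (d2 0 (gT hc hk))) (hP0 : P ≠ 0) :
    ∃ x₀ ∈ sectorH2 1, ∃ θ₀ : ℝ, poschl (kap c) 3 x₀.1 = mulL (gT hc hk) (d2 0 (gT hc hk)) ∧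
      poschl (kap c) (nu k) x₀.2 - (θ₀ • d2 0 (gT hc hk) +
        k • mulL x₀.1 (d2 0 (gT hc hk))) = 0 ∧ θ₀ * P < 0 := by
  have hν := nu_sub_one_pos hk
  have hk0 : 0 < k := by linarith
  set g := gT hc hk with hg_def
  have hg : refl (d2 0 g) = (-1 : ℝ) • d2 0 g := refl_gT hc hk
  have hg0 : d2 0 g ≠ 0 := excited_ne_zero (kap_pos hc) hν
  have hTg : poschl (kap c) (nu k) g = 0 := poschl_excited (kap_pos hc) hν
  have hgg : (mulL g (d2 0 g), (0 : RealL2)) ∈ sectorL2 1 := by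
    refine mem_sectorL2.2 ⟨?_, by simp⟩
    rw [refl_mulL hg hg]
    norm_num
  obtain ⟨x₀, hx₀, θ₀, e₁, e₂⟩ := exists_linearized_eq hc hk hgg
  -- Pairing the second equation with `g̃` determines `θ₀ ‖g̃‖² = -k P`.
  have hθ₀ : θ₀ * ‖d2 0 g‖ ^ 2 = -(k * P) := by
    have hWx : x₀.1 = W :=
      (existsUnique_poschl_three_eq (kap_pos hc) (mem_sectorL2.1 hgg).1).unique
        ⟨(mem_sectorH2.1 hx₀).1, e₁⟩ ⟨hW, eW⟩
    have h := congrArg (fun f => inner ℝ f (d2 0 g)) e₂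
    simp only [← hg_def] at h
    rw [inner_sub_left, inner_poschl, hTg, inner_zero_right, inner_zero_left, inner_add_left,
      inner_smul_left, inner_smul_left, real_inner_self_eq_norm_sq, hWx, ← hP] at h
    simp only [conj_trivial] at h
    linarith
  have hgsq : 0 < ‖d2 0 g‖ ^ 2 := by
    have := norm_pos_iff.2 hg0
    positivity
  refine ⟨x₀, hx₀, θ₀, e₁, e₂, ?_⟩
  have : θ₀ * P * ‖d2 0 g‖ ^ 2 = -(k * P ^ 2) := by linear_combination P * hθ₀
  have h2 : 0 < k * P ^ 2 := by positivity
  by_contra! h3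
  nlinarith [mul_nonneg h3 hgsq.le]

theorem eventually_exists_branchDefect_eq_zero {c k : ℝ} (hc : 0 < c) (hk : 1 / 6 < k) {W : H2}
    (hW : refl (d2 0 W) = (1 : ℝ) • d2 0 W)
    (eW : poschl (kap c) 3 W = mulL (gT hc hk) (d2 0 (gT hc hk))) {P : ℝ}
    (hP : P = inner ℝ (mulL W (d2 0 (gT hc hk))) (d2 0 (gT hc hk))) (hP0 : P ≠ 0) :
    ∃ θ₀ R : ℝ, θ₀ * P < 0 ∧ 0 < R ∧ ∀ᶠ β in 𝓝 (0 : ℝ), ∃ x ∈ sectorH2 1, ∃ θ : ℝ,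
      (‖x.1‖ < R ∧ ‖x.2‖ < R ∧ |θ - θ₀| < |θ₀| / 2) ∧
      branchDefect (kap c) (nu k) k (gT hc hk) x.1 x.2 θ (β / θ) = 0 := by
  obtain ⟨x₀, hx₀, θ₀, e₁, e₂, hθP⟩ := exists_branchDefect_zero_eq_zero hc hk hW eW hP hP0
  have hθ0 : θ₀ ≠ 0 := by
    rintro rfl
    simp at hθP
  set g := gT hc hk
  have hg : refl (d2 0 g) = (-1 : ℝ) • d2 0 g := refl_gT hc hk
  have d₁ : ContDiff ℝ 1 fun q : ((H2 × H2) × ℝ) × ℝ => q.1.1.1 := by fun_prop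
  have d₂ : ContDiff ℝ 1 fun q : ((H2 × H2) × ℝ) × ℝ => q.1.1.2 := by fun_prop
  have d₃ : ContDiff ℝ 1 fun q : ((H2 × H2) × ℝ) × ℝ => q.1.2 := by fun_prop
  have d₄ : ContDiff ℝ 1 fun q : ((H2 × H2) × ℝ) × ℝ => q.2 := by fun_prop
  have hθd : ContDiffAt ℝ 1 (fun q : ((H2 × H2) × ℝ) × ℝ => branchDefect (kap c) (nu k) k g
      q.1.1.1 q.1.1.2 q.1.2 (q.2 / q.1.2)) ((x₀, θ₀), 0) :=
    contDiffAt_branchDefect _ _ _ _ d₁.contDiffAt d₂.contDiffAt d₃.contDiffAt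
      (d₄.contDiffAt.div d₃.contDiffAt hθ0)
  set R := ‖x₀‖ + 1 with hR
  have hN : {y : (H2 × H2) × ℝ | ‖y.1.1‖ < R ∧ ‖y.1.2‖ < R ∧
      |y.2 - θ₀| < |θ₀| / 2} ∈ 𝓝 (x₀, θ₀) :=
    setOf_norm_lt_mem_nhds (norm_fst_le x₀) (norm_snd_le x₀) hθ0
  refine ⟨θ₀, R, hθP, by positivity, ?_⟩
  refine eventually_exists_zero_of_invariant (X := H2 × H2) (Y := RealL2 × RealL2)
    (K := sectorH2 1) (M := sectorL2 1) projEven (fun f hf => projEven_of_mem hf) hx₀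
    (F := fun x θ β => branchDefect (kap c) (nu k) k g x.1 x.2 θ (β / θ)) hθd
    (fun x hx θ β => branchDefect_mem hg hx θ _) (linearizedMap (kap c) (nu k) k g)
    (fun x θ => branchDefect_zero (kap c) (nu k) k g x θ)
    (b := (mulL g (d2 0 g), 0)) (linearizedMap_eq e₁ e₂) (fun f hf => ?_) hN
  obtain ⟨x, hx, θ, h₁, h₂⟩ := exists_linearized_eq hc hk hf
  exact ⟨x, hx, θ, linearizedMap_eq h₁ h₂⟩

/-- The branch exists on the side where `(Ω - Ω̃) P < 0`, `P` being the pairing. -/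
theorem exists_branch {c k : ℝ} (hc : 0 < c) (hk : 1 / 6 < k) {W : H2}
    (hW : refl (d2 0 W) = (1 : ℝ) • d2 0 W)
    (eW : poschl (kap c) 3 W = mulL (gT hc hk) (d2 0 (gT hc hk))) {P : ℝ}
    (hP : P = inner ℝ (mulL W (d2 0 (gT hc hk))) (d2 0 (gT hc hk))) (hP0 : P ≠ 0) :
    ∃ C₀ : ℝ, 0 < C₀ ∧ ∀ᶠ β in 𝓝 (0 : ℝ), β * P < 0 → ∃ h A : H2,
      refl (d2 0 h) = (1 : ℝ) • d2 0 h ∧ refl (d2 0 A) = (-1 : ℝ) • d2 0 A ∧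
      poschl (kap c) 3 h = (1 / 2 : ℝ) • mulL h (d2 0 h) + mulL A (d2 0 A) ∧
      poschl (kap c) (nu k) A = β • d2 0 A + k • mulL h (d2 0 A) ∧
      A ≠ 0 ∧ ‖h‖ ≤ C₀ * |β| ∧ ‖A‖ ≤ C₀ * √|β| := by
  have hν := nu_sub_one_pos hk
  obtain ⟨θ₀, R, hθP, hR, hsol⟩ := eventually_exists_branchDefect_eq_zero hc hk hW eW hP hP0
  set g := gT hc hk
  have hg : refl (d2 0 g) = (-1 : ℝ) • d2 0 g := refl_gT hc hk
  have hg0 : d2 0 g ≠ 0 := excited_ne_zero (kap_pos hc) hν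
  have hgn : 0 < ‖g‖ := norm_pos_iff.2 fun h => hg0 (by rw [h, map_zero])
  have hTg : poschl (kap c) (nu k) g = 0 := poschl_excited (kap_pos hc) hν
  have hθ0 : θ₀ ≠ 0 := by
    rintro rfl
    simp at hθP
  have hθ₀' : 0 < |θ₀| := abs_pos.2 hθ0
  have hsmall := eventually_mul_norm_lt (V := ℝ) (2 / |θ₀| * R) (lt_min hgn one_pos)
  refine ⟨2 / |θ₀| * R + √(2 / |θ₀|) * (‖g‖ + 1), by positivity, ?_⟩
  filter_upwards [hsol, hsmall] with β hβ hs hβP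
  obtain ⟨⟨w, χ⟩, hx, θ, ⟨nw, nχ, nθ⟩, e⟩ := hβ
  set t := β / θ with ht
  dsimp only at nw nχ nθ
  have hθlow : |θ₀| / 2 < |θ| := by
    have := abs_sub_abs_le_abs_sub θ₀ θ
    rw [abs_sub_comm] at this
    linarith
  have hθ : θ ≠ 0 := abs_pos.1 (by linarith)
  have hθθ : 0 < θ * θ₀ := by
    have h₁ := abs_lt.1 nθ
    rcases lt_or_gt_of_ne hθ0 with h | h
    · rw [abs_of_neg h] at h₁
      exact mul_pos_of_neg_of_neg (by linarith) h
    · rw [abs_of_pos h] at h₁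
      exact mul_pos (by linarith) h
  have hβ0 : β ≠ 0 := by
    rintro rfl
    simp at hβP
  have htpos : 0 < t := by
    have h₁ : 0 < (β * P) * (θ₀ * P) := mul_pos_of_neg_of_neg hβP hθP
    have h₂ : 0 < β * θ₀ := by
      have : 0 < P ^ 2 := by positivity
      by_contra! h3
      nlinarith [mul_nonneg this.le (neg_nonneg.2 h3)]
    have h₃ : 0 < β * θ := by
      have : 0 < θ₀ ^ 2 := by positivity
      by_contra! h3
      nlinarith [mul_pos hθθ h₂, mul_nonneg this.le (neg_nonneg.2 h3)]
    have : t = β * θ / θ ^ 2 := by rw [ht]; field_simp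
    rw [this]
    positivity
  have htθ : t * θ = β := div_mul_cancel₀ _ hθ
  have htle : t ≤ 2 / |θ₀| * |β| := by
    rw [← abs_of_pos htpos, ht, abs_div, div_mul_eq_mul_div, div_le_div_iff₀ (by linarith) hθ₀']
    nlinarith [abs_nonneg β]
  have htχ : ‖t • χ‖ < min ‖g‖ 1 := by
    rw [norm_smul, Real.norm_of_nonneg htpos.le]
    refine lt_of_le_of_lt ?_ hs
    rw [Real.norm_eq_abs]
    calc t * ‖χ‖ ≤ (2 / |θ₀| * |β|) * R := by gcongr
      _ = _ := by ring
  set G := g + t • χ with hG_def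
  obtain ⟨hw, hχ⟩ := mem_sectorH2.1 hx
  have hG0 : G ≠ 0 := by
    intro h
    have h' : g = -(t • χ) := eq_neg_of_add_eq_zero_left h
    have h2 := htχ.trans_le (min_le_left _ _)
    rw [← norm_neg, ← h'] at h2
    exact lt_irrefl _ h2
  obtain ⟨q₁, q₂⟩ := equations_of_branchDefect_eq_zero hTg htpos.le e
  rw [htθ] at q₂
  refine ⟨t • w, √t • G, ?_, ?_, q₁, q₂, smul_ne_zero (Real.sqrt_pos.2 htpos).ne' hG0, ?_, ?_⟩
  · rw [map_smul, map_smul, hw]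
    module
  · rw [map_smul, map_smul, hG_def, map_add, map_smul, map_add, map_smul, hg, hχ]
    module
  · rw [norm_smul, Real.norm_of_nonneg htpos.le]
    calc t * ‖w‖ ≤ (2 / |θ₀| * |β|) * R := by gcongr
      _ = (2 / |θ₀| * R) * |β| := by ring
      _ ≤ _ := by
        gcongr
        exact le_add_of_nonneg_right (by positivity)
  · rw [norm_smul, Real.norm_of_nonneg (Real.sqrt_nonneg t)]
    have h1 : √t ≤ √(2 / |θ₀|) * √|β| := by
      rw [← Real.sqrt_mul (by positivity)]
      exact Real.sqrt_le_sqrt htle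
    have h2 : ‖G‖ ≤ ‖g‖ + 1 :=
      (norm_add_le _ _).trans (by gcongr; exact (htχ.trans_le (min_le_right _ _)).le)
    calc √t * ‖G‖ ≤ (√(2 / |θ₀|) * √|β|) * (‖g‖ + 1) := by gcongr
      _ = (√(2 / |θ₀|) * (‖g‖ + 1)) * √|β| := by ring
      _ ≤ _ := by
        gcongr
        exact le_add_of_nonneg_left (by positivity)

/-! ### Asymptotics of the solutions on the branch -/

/-- The pair `(h, A) = (U - U₀, A)` solves the system at `Ω = Ω̃ + β` and satisfies the bounds that
define the second branch. -/
structure BranchSolution {c : ℝ} (hc : 0 < c) (k C β : ℝ) (h A : H2) : Prop where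
  even : refl (d2 0 h) = (1 : ℝ) • d2 0 h
  odd : refl (d2 0 A) = (-1 : ℝ) • d2 0 A
  eq_h : poschl (kap c) 3 h = (1 / 2 : ℝ) • mulL h (d2 0 h) + mulL A (d2 0 A)
  eq_A : poschl (kap c) (nu k) A = β • d2 0 A + k • mulL h (d2 0 A)
  ne_zero : A ≠ 0
  norm_h_le : ‖h‖ ≤ C * |β|
  norm_A_le : ‖A‖ ≤ C * √|β|

theorem isSecondBranch_iff {c k : ℝ} (hc : 0 < c) (hk : 1 / 6 < k) (C Ω : ℝ) (U A : H2) :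
    IsSecondBranch hc k C Ω U A ↔ BranchSolution hc k C (Ω - Ωc2 c k) (U - U₀ hc) A := by
  have hU : refl (d2 0 (U - U₀ hc)) = (1 : ℝ) • d2 0 (U - U₀ hc) ↔ IsEven U := by
    rw [isEven_iff, map_sub, map_sub, refl_U₀, smul_sub, sub_left_inj]
  constructor
  · intro h
    exact ⟨hU.2 h.even, isOdd_iff.1 h.odd, (equation_U_iff hc U A).1 h.eq_U,
      (equation_A_iff hc hk Ω U A).1 h.eq_A, h.coupled, h.near_U, h.near_A⟩
  · intro h
    exact ⟨hU.1 h.even, isOdd_iff.2 h.odd, (equation_U_iff hc U A).2 h.eq_h,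
      (equation_A_iff hc hk Ω U A).2 h.eq_A, h.ne_zero, h.norm_h_le, h.norm_A_le⟩

/-- The component of `A` orthogonal to `g̃` is smaller than `A` by a factor of order `β`. -/
theorem exists_norm_sub_excited_le {c k : ℝ} (hc : 0 < c) (hk : 1 / 6 < k) {C : ℝ} (hC : 0 ≤ C) :
    ∃ K : ℝ, 0 < K ∧ ∀ β h A, BranchSolution hc k C β h A → K * |β| ≤ 1 → ∃ a : ℝ, a ≠ 0 ∧
      |a| ≤ K * √|β| ∧ ‖A - a • gT hc hk‖ ≤ K * |β| * |a| ∧ ‖A‖ ≤ K * |a| := by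
  have hν := nu_sub_one_pos hk
  obtain ⟨K₀, hK₀, hb⟩ := exists_norm_le_norm_poschl (kap_pos hc) hν (by linarith)
  have hTg : poschl (kap c) (nu k) (gT hc hk) = 0 := poschl_excited (kap_pos hc) hν
  have hg0 : d2 0 (gT hc hk) ≠ 0 := excited_ne_zero (kap_pos hc) hν
  change ∀ u : H2, inner ℝ (d2 0 u) (d2 0 (gT hc hk)) = 0 → _ at hb
  generalize gT hc hk = g at *
  set n := ‖d2 0 g‖ with hn
  have hn0 : 0 < n := norm_pos_iff.2 hg0
  set K₁ := K₀ * (1 + |k| * (‖mulL‖ * C)) with hK₁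
  have hK₁0 : 0 ≤ K₁ := by positivity
  refine ⟨2 * K₁ + C / n + 2 * K₁ * ‖g‖ + 2 * ‖g‖ + 1, by positivity, fun β h A hs hβ => ?_⟩
  have hβ0 := abs_nonneg β
  have q₁ : 0 ≤ K₁ * |β| := by positivity
  have q₂ : 0 ≤ C / n * |β| := by positivity
  have q₃ : 0 ≤ K₁ * ‖g‖ * |β| := by positivity
  have q₄ : 0 ≤ ‖g‖ * |β| := by positivity
  have hβ₁ : K₁ * |β| ≤ 1 / 2 := by nlinarith
  set a := inner ℝ (d2 0 A) (d2 0 g) / n ^ 2 with ha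
  have ho : inner ℝ (d2 0 (A - a • g)) (d2 0 g) = 0 := by
    rw [map_sub, map_smul, inner_sub_left, inner_smul_left, real_inner_self_eq_norm_sq, conj_trivial,
      ha, ← hn, div_mul_cancel₀ _ (pow_ne_zero 2 hn0.ne'), sub_self]
  have h₁ : ‖A - a • g‖ ≤ K₁ * |β| * ‖A‖ := by
    refine (hb _ ho).trans ?_
    rw [map_sub, map_smul, hTg, smul_zero, sub_zero, hs.eq_A]
    have m : ‖mulL h (d2 0 A)‖ ≤ ‖mulL‖ * (C * |β|) * ‖A‖ :=
      (norm_mulL_d2_le h A).trans (by gcongr; exact hs.norm_h_le)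
    calc K₀ * ‖β • d2 0 A + k • mulL h (d2 0 A)‖
        ≤ K₀ * (|β| * ‖A‖ + |k| * (‖mulL‖ * (C * |β|) * ‖A‖)) := by
          gcongr
          refine (norm_add_le _ _).trans ?_
          rw [norm_smul, norm_smul, Real.norm_eq_abs, Real.norm_eq_abs]
          gcongr
          exact H2.norm_d2_le 0 A
      _ = K₁ * |β| * ‖A‖ := by rw [hK₁]; ring
  have h₂ : ‖A‖ ≤ 2 * (|a| * ‖g‖) := by
    have t : ‖A‖ ≤ ‖A - a • g‖ + |a| * ‖g‖ := by
      have := norm_add_le (A - a • g) (a • g)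
      rwa [sub_add_cancel, norm_smul, Real.norm_eq_abs] at this
    nlinarith [norm_nonneg A]
  have ha0 : a ≠ 0 := by
    intro h0
    rw [h0, abs_zero, zero_mul, mul_zero] at h₂
    exact hs.ne_zero (norm_le_zero_iff.1 h₂)
  have ha' : |a| ≤ C / n * √|β| := by
    rw [ha, abs_div, abs_of_pos (by positivity : 0 < n ^ 2), div_mul_eq_mul_div,
      div_le_div_iff₀ (by positivity) hn0]
    have h3 : |inner ℝ (d2 0 A) (d2 0 g)| ≤ ‖A‖ * n :=
      (abs_real_inner_le_norm _ _).trans (by gcongr; exact H2.norm_d2_le 0 A)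
    calc |inner ℝ (d2 0 A) (d2 0 g)| * n ≤ (C * √|β| * n) * n := by
          gcongr
          exact h3.trans (by gcongr; exact hs.norm_A_le)
      _ = C * √|β| * n ^ 2 := by ring
  have hap := abs_nonneg a
  refine ⟨a, ha0, ha'.trans ?_, ?_, ?_⟩
  · gcongr
    nlinarith [norm_nonneg g, mul_nonneg hK₁0 (norm_nonneg g)]
  · calc ‖A - a • g‖ ≤ K₁ * |β| * (2 * (|a| * ‖g‖)) := h₁.trans (by gcongr)
      _ = (2 * K₁ * ‖g‖) * |β| * |a| := by ring
      _ ≤ _ := by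
        gcongr
        have : 0 ≤ C / n := by positivity
        nlinarith [norm_nonneg g, mul_nonneg hK₁0 (norm_nonneg g)]
  · calc ‖A‖ ≤ (2 * ‖g‖) * |a| := by linarith
      _ ≤ _ := by
        gcongr
        have : 0 ≤ C / n := by positivity
        nlinarith [norm_nonneg g, mul_nonneg hK₁0 (norm_nonneg g)]

theorem mulL_self_sub (u v : H2) :
    mulL u (d2 0 u) - mulL v (d2 0 v) = mulL (u - v) (d2 0 (u + v)) := by
  simp only [map_sub, map_add, _root_.sub_apply]
  rw [mulL_comm u v]
  abel

/-- To leading order, `U - U₀` is `a² W`, where `a` is the amplitude of `A`. -/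
theorem exists_norm_sub_smul_le {c k : ℝ} (hc : 0 < c) (hk : 1 / 6 < k) {C : ℝ} (hC : 0 ≤ C)
    {W : H2} (hW : refl (d2 0 W) = (1 : ℝ) • d2 0 W)
    (eW : poschl (kap c) 3 W = mulL (gT hc hk) (d2 0 (gT hc hk))) {K : ℝ} (hK : 0 < K) :
    ∃ R : ℝ, 0 < R ∧ ∀ β h A a, BranchSolution hc k C β h A → R * |β| ≤ 1 →
      ‖A - a • gT hc hk‖ ≤ K * |β| * |a| → ‖A‖ ≤ K * |a| →
      ‖h - a ^ 2 • W‖ ≤ R * |β| * a ^ 2 := by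
  obtain ⟨K₀, hK₀, hb⟩ := exists_norm_le_norm_poschl (kap_pos hc) (by norm_num : (0 : ℝ) < 3 - 1)
    (by norm_num)
  have he : ∀ u : H2, refl (d2 0 u) = (1 : ℝ) • d2 0 u → ‖u‖ ≤ K₀ * ‖poschl (kap c) 3 u‖ :=
    fun u hu => hb u (inner_eq_zero_of_parity (s := 1) (by norm_num) hu (refl_excited _ _))
  generalize gT hc hk = g at *
  set M := ‖mulL‖ with hM
  have hM0 : 0 ≤ M := norm_nonneg mulL
  refine ⟨K₀ * M * C + (K₀ * M * C * (K₀ * M * K ^ 2) + K₀ * M * K * (K + ‖g‖)) + 1,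
    by positivity, fun β h A a hs hβ h₁ h₂ => ?_⟩
  have hβ0 := abs_nonneg β
  have q₁ : 0 ≤ K₀ * M * C * (K₀ * M * K ^ 2) + K₀ * M * K * (K + ‖g‖) := by positivity
  have q₂ : K₀ * M * C * |β| ≤ 1 := by nlinarith [mul_nonneg q₁ hβ0]
  have hsq : ‖mulL h (d2 0 h)‖ ≤ M * (C * |β|) * ‖h‖ :=
    (norm_mulL_d2_le h h).trans (by gcongr; exact hs.norm_h_le)
  have hh : ‖h‖ ≤ 2 * (K₀ * M * K ^ 2 * a ^ 2) := by
    have h3 : ‖h‖ ≤ K₀ * (1 / 2 * (M * (C * |β|) * ‖h‖) + M * (K * |a|) * (K * |a|)) := by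
      refine (he h hs.even).trans ?_
      rw [hs.eq_h]
      gcongr
      refine (norm_add_le _ _).trans ?_
      rw [norm_smul, Real.norm_of_nonneg (by norm_num : (0 : ℝ) ≤ 1 / 2)]
      gcongr
      exact (norm_mulL_d2_le A A).trans (by gcongr)
    have h4 : K₀ * (1 / 2 * (M * (C * |β|) * ‖h‖) + M * (K * |a|) * (K * |a|)) =
        1 / 2 * (K₀ * M * C * |β|) * ‖h‖ + K₀ * M * K ^ 2 * |a| ^ 2 := by ring
    rw [h4, sq_abs] at h3
    nlinarith [norm_nonneg h]
  have hag : refl (d2 0 (h - a ^ 2 • W)) = (1 : ℝ) • d2 0 (h - a ^ 2 • W) := by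
    rw [map_sub, map_smul, map_sub, map_smul, hs.even, hW]
    module
  have e : poschl (kap c) 3 (h - a ^ 2 • W) =
      (1 / 2 : ℝ) • mulL h (d2 0 h) + mulL (A - a • g) (d2 0 (A + a • g)) := by
    rw [← mulL_self_sub, map_sub, map_smul, hs.eq_h, eW]
    simp only [map_smul, _root_.smul_apply]
    rw [smul_smul a a, ← sq]
    abel
  have m : ‖mulL (A - a • g) (d2 0 (A + a • g))‖ ≤
      M * (K * |β| * |a|) * (K * |a| + |a| * ‖g‖) := by
    refine (norm_mulL_d2_le _ _).trans ?_
    gcongr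
    refine (norm_add_le _ _).trans ?_
    rw [norm_smul, Real.norm_eq_abs]
    gcongr
  calc ‖h - a ^ 2 • W‖ ≤ K₀ * (1 / 2 * (M * (C * |β|) * (2 * (K₀ * M * K ^ 2 * a ^ 2))) +
        M * (K * |β| * |a|) * (K * |a| + |a| * ‖g‖)) := by
        refine (he _ hag).trans ?_
        rw [e]
        gcongr
        refine (norm_add_le _ _).trans ?_
        rw [norm_smul, Real.norm_of_nonneg (by norm_num : (0 : ℝ) ≤ 1 / 2)]
        gcongr
        exact hsq.trans (by gcongr)
    _ = (K₀ * M * C * (K₀ * M * K ^ 2) * a ^ 2 + K₀ * M * K * (K + ‖g‖) * |a| ^ 2) * |β| := by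
        ring
    _ = (K₀ * M * C * (K₀ * M * K ^ 2) + K₀ * M * K * (K + ‖g‖)) * |β| * a ^ 2 := by
        rw [sq_abs]
        ring
    _ ≤ _ := by
        have : 0 ≤ K₀ * M * C := by positivity
        refine mul_le_mul_of_nonneg_right (mul_le_mul_of_nonneg_right ?_ hβ0) (sq_nonneg a)
        linarith

/-- On the branch, `A = a b` and `U - U₀ = a² w` with `b` near `g̃`, `w` near `W` and `a` small. -/
theorem eventually_branch_expansion {c k : ℝ} (hc : 0 < c) (hk : 1 / 6 < k) {C : ℝ} (hC : 0 ≤ C)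
    {W : H2} (hW : refl (d2 0 W) = (1 : ℝ) • d2 0 W)
    (eW : poschl (kap c) 3 W = mulL (gT hc hk) (d2 0 (gT hc hk))) {ε : ℝ} (hε : 0 < ε) :
    ∀ᶠ β in 𝓝 (0 : ℝ), ∀ h A, BranchSolution hc k C β h A → ∃ (a : ℝ) (b w : H2),
      a ≠ 0 ∧ |a| < ε ∧ A = a • b ∧ h = a ^ 2 • w ∧ ‖b - gT hc hk‖ < ε ∧ ‖w - W‖ < ε := by
  obtain ⟨K, hK, hA⟩ := exists_norm_sub_excited_le hc hk hC
  obtain ⟨R, hR, hh⟩ := exists_norm_sub_smul_le hc hk hC hW eW hK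
  have hsq : ∀ᶠ β in 𝓝 (0 : ℝ), K * √|β| < ε := by
    have h : Tendsto (fun β : ℝ => K * √|β|) (𝓝 0) (𝓝 (K * √|0|)) :=
      (by fun_prop : Continuous fun β : ℝ => K * √|β|).tendsto 0
    rw [abs_zero, Real.sqrt_zero, mul_zero] at h
    exact h.eventually_lt_const hε
  filter_upwards [hsq, eventually_mul_norm_lt K hε, eventually_mul_norm_lt R hε,
    eventually_mul_norm_lt K one_pos, eventually_mul_norm_lt R one_pos] with β h₁ h₂ h₃ h₄ h₅ h A hs
  rw [Real.norm_eq_abs] at h₂ h₃ h₄ h₅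
  obtain ⟨a, ha, ha', e₁, e₂⟩ := hA β h A hs h₄.le
  have e₃ := hh β h A a hs h₅.le e₁ e₂
  refine ⟨a, a⁻¹ • A, (a ^ 2)⁻¹ • h, ha, ha'.trans_lt h₁, ?_, ?_, ?_, ?_⟩
  · rw [smul_smul, mul_inv_cancel₀ ha, one_smul]
  · rw [smul_smul, mul_inv_cancel₀ (pow_ne_zero 2 ha), one_smul]
  · have e : a⁻¹ • A - gT hc hk = a⁻¹ • (A - a • gT hc hk) := by
      rw [smul_sub, smul_smul, inv_mul_cancel₀ ha, one_smul]
    rw [e, norm_smul, norm_inv, Real.norm_eq_abs]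
    refine lt_of_le_of_lt ?_ h₂
    rw [inv_mul_le_iff₀ (abs_pos.2 ha)]
    linarith
  · have ha2 : 0 < a ^ 2 := by positivity
    have e : (a ^ 2)⁻¹ • h - W = (a ^ 2)⁻¹ • (h - a ^ 2 • W) := by
      rw [smul_sub, smul_smul, inv_mul_cancel₀ ha2.ne', one_smul]
    rw [e, norm_smul, norm_inv, Real.norm_of_nonneg ha2.le]
    refine lt_of_le_of_lt ?_ h₃
    rw [inv_mul_le_iff₀ ha2]
    linarith

/-! ### Positivity of the Hessian on the complement of the low modes -/

theorem sq_inner_add_inner_le {H : Type*} [NormedAddCommGroup H] [InnerProductSpace ℝ H]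
    {f q φ : H × H} {ε : ℝ} (hq : ‖q - φ‖ < ε) (h : inner ℝ f.1 q.1 + inner ℝ f.2 q.2 = 0) :
    (inner ℝ f.1 φ.1 + inner ℝ f.2 φ.2) ^ 2 ≤ 2 * ε ^ 2 * (‖f.1‖ ^ 2 + ‖f.2‖ ^ 2) := by
  have h₁ : ‖q.1 - φ.1‖ ≤ ε := (norm_fst_le (q - φ)).trans hq.le
  have h₂ : ‖q.2 - φ.2‖ ≤ ε := (norm_snd_le (q - φ)).trans hq.le
  have e : inner ℝ f.1 φ.1 + inner ℝ f.2 φ.2 =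
      -(inner ℝ f.1 (q.1 - φ.1) + inner ℝ f.2 (q.2 - φ.2)) := by
    rw [inner_sub_right, inner_sub_right]
    linarith
  have hε : 0 ≤ ε := (norm_nonneg _).trans hq.le
  have hb : |inner ℝ f.1 φ.1 + inner ℝ f.2 φ.2| ≤ ε * (‖f.1‖ + ‖f.2‖) := by
    rw [e, abs_neg]
    calc |inner ℝ f.1 (q.1 - φ.1) + inner ℝ f.2 (q.2 - φ.2)|
        ≤ ‖f.1‖ * ‖q.1 - φ.1‖ + ‖f.2‖ * ‖q.2 - φ.2‖ :=
          (abs_add_le _ _).trans (add_le_add (abs_real_inner_le_norm _ _)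
            (abs_real_inner_le_norm _ _))
      _ ≤ ‖f.1‖ * ε + ‖f.2‖ * ε := by gcongr
      _ = _ := by ring
  calc (inner ℝ f.1 φ.1 + inner ℝ f.2 φ.2) ^ 2 ≤ (ε * (‖f.1‖ + ‖f.2‖)) ^ 2 := by
        rw [← sq_abs]
        gcongr
    _ = ε ^ 2 * (‖f.1‖ + ‖f.2‖) ^ 2 := by ring
    _ ≤ ε ^ 2 * (2 * (‖f.1‖ ^ 2 + ‖f.2‖ ^ 2)) := by
        gcongr
        nlinarith [sq_nonneg (‖f.1‖ - ‖f.2‖)]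
    _ = _ := by ring

theorem abs_inner_mulL_le (u : H2) (f g : RealL2) :
    |inner ℝ (mulL u f) g| ≤ ‖mulL‖ * ‖u‖ * ‖f‖ * ‖g‖ :=
  (abs_real_inner_le_norm _ _).trans (by gcongr; exact mulL.le_opNorm₂ u f)

theorem neg_le_inner_pertScalar (a k : ℝ) (p : H2 × H2 × ℝ) (u : H2) :
    -(|a| * (1 + |k| * ‖mulL‖) * ‖p‖ * ‖d2 0 u‖ ^ 2) ≤ inner ℝ (pertScalar a k p u) (d2 0 u) := by
  have h₁ : ‖p.1‖ ≤ ‖p‖ := norm_fst_le p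
  have h₂ : |p.2.2| ≤ ‖p‖ := (norm_snd_le p.2).trans (norm_snd_le p)
  have h₃ : |inner ℝ (mulL p.1 (d2 0 u)) (d2 0 u)| ≤ ‖mulL‖ * ‖p‖ * ‖d2 0 u‖ * ‖d2 0 u‖ :=
    (abs_inner_mulL_le _ _ _).trans (by gcongr)
  have h₄ : |inner ℝ (pertScalar a k p u) (d2 0 u)| ≤
      |a| * (‖p‖ * ‖d2 0 u‖ ^ 2 + |k| * (‖mulL‖ * ‖p‖ * ‖d2 0 u‖ * ‖d2 0 u‖)) := by
    rw [pertScalar_apply, inner_neg_left, abs_neg, inner_smul_left, inner_add_left,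
      inner_smul_left, inner_smul_left, real_inner_self_eq_norm_sq]
    simp only [conj_trivial]
    rw [abs_mul]
    gcongr
    refine (abs_add_le _ _).trans ?_
    rw [abs_mul, abs_mul, abs_of_nonneg (sq_nonneg ‖d2 0 u‖)]
    gcongr
  have := (abs_le.1 h₄).1
  linarith

theorem neg_le_inner_pertBlock (a k : ℝ) (p : H2 × H2 × ℝ) (x : H2 × H2) :
    -(pertConst a k * ‖p‖ * (‖d2 0 x.1‖ ^ 2 + ‖d2 0 x.2‖ ^ 2)) ≤
      inner ℝ (pertBlock a k p x).1 (d2 0 x.1) + inner ℝ (pertBlock a k p x).2 (d2 0 x.2) := by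
  have h₁ : ‖p.1‖ ≤ ‖p‖ := norm_fst_le p
  have h₂ : ‖p.2.1‖ ≤ ‖p‖ := (norm_fst_le p.2).trans (norm_snd_le p)
  have h₃ : |inner ℝ (mulL p.1 (d2 0 x.1)) (d2 0 x.1)| ≤
      ‖mulL‖ * ‖p‖ * ‖d2 0 x.1‖ * ‖d2 0 x.1‖ := (abs_inner_mulL_le _ _ _).trans (by gcongr)
  have h₄ : |inner ℝ (mulL p.2.1 (d2 0 x.2)) (d2 0 x.1)| ≤
      ‖mulL‖ * ‖p‖ * ‖d2 0 x.2‖ * ‖d2 0 x.1‖ := (abs_inner_mulL_le _ _ _).trans (by gcongr)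
  have h₅ : |inner ℝ (mulL p.2.1 (d2 0 x.1)) (d2 0 x.2)| ≤
      ‖mulL‖ * ‖p‖ * ‖d2 0 x.1‖ * ‖d2 0 x.2‖ := (abs_inner_mulL_le _ _ _).trans (by gcongr)
  have h₆ := neg_le_inner_pertScalar a k p x.2
  rw [pertBlock_apply, pertConst, inner_sub_left, inner_neg_left, inner_smul_left, inner_add_left,
    inner_neg_left, inner_smul_left]
  simp only [conj_trivial]
  have h₇ := (abs_le.1 h₃).2
  have h₈ := (abs_le.1 h₄).2
  have h₉ := (abs_le.1 h₅).2
  have q : 0 ≤ ‖mulL‖ * ‖p‖ := by positivity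
  have q₁ := mul_nonneg q (sq_nonneg (‖d2 0 x.1‖ - ‖d2 0 x.2‖))
  have q₂ := mul_nonneg q (sq_nonneg ‖d2 0 x.1‖)
  have q₃ := mul_nonneg q (sq_nonneg ‖d2 0 x.2‖)
  have q₄ : 0 ≤ |a| * (1 + |k| * ‖mulL‖) * ‖p‖ * ‖d2 0 x.1‖ ^ 2 := by positivity
  linarith

theorem exists_small_pos {η K L : ℝ} (hη : 0 < η) :
    ∃ ε : ℝ, 0 < ε ∧ K * ε ^ 2 + L * ε < η := by
  have h : Tendsto (fun ε : ℝ => K * ε ^ 2 + L * ε) (𝓝[>] 0) (𝓝 (K * 0 ^ 2 + L * 0)) :=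
    ((by fun_prop : Continuous fun ε : ℝ => K * ε ^ 2 + L * ε).tendsto 0).mono_left
      nhdsWithin_le_nhds
  rw [zero_pow two_ne_zero, mul_zero, mul_zero, add_zero] at h
  obtain ⟨ε, h₁, h₂⟩ := ((h.eventually_lt_const hη).and self_mem_nhdsWithin).exists
  exact ⟨ε, h₂, h₁⟩

/-- The perturbed scalar operator is positive on the complement of two functions near its low
modes. -/
theorem exists_scalar_form_pos {κ ν a : ℝ} (hκ : 0 < κ) (hν : 0 < ν - 1) (hν' : 0 < ν)
    (ha : 0 < a) (k : ℝ) : ∃ ε : ℝ, 0 < ε ∧ ∀ (p : H2 × H2 × ℝ) (q₁ q₂ : RealL2), ‖p‖ < ε →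
      ‖q₁ - d2 0 (ground hκ hν')‖ < ε → ‖q₂ - d2 0 (excited hκ hν)‖ < ε → ∀ u : H2, u ≠ 0 →
      inner ℝ (d2 0 u) q₁ = 0 → inner ℝ (d2 0 u) q₂ = 0 →
      0 < inner ℝ (a • poschl κ ν u + pertScalar a k p u) (d2 0 u) := by
  obtain ⟨K, hK, hf⟩ := exists_poschl_form_ge hκ hν hν'
  have hη := ladderGap_pos hκ hν
  set η := ladderGap κ (ν - 1)
  obtain ⟨ε, hε, hs⟩ := exists_small_pos (K := a * K * 4) (L := |a| * (1 + |k| * ‖mulL‖))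
    (mul_pos ha hη)
  refine ⟨ε, hε, fun p q₁ q₂ hp h₁ h₂ u hu o₁ o₂ => ?_⟩
  have low : ∀ {q φ : RealL2}, ‖q - φ‖ < ε → inner ℝ (d2 0 u) q = 0 →
      inner ℝ (d2 0 u) φ ^ 2 ≤ 2 * ε ^ 2 * ‖d2 0 u‖ ^ 2 := fun {q φ} hq ho => by
    have := sq_inner_add_inner_le (f := (d2 0 u, (0 : RealL2))) (q := (q, (0 : RealL2)))
      (φ := (φ, (0 : RealL2))) (ε := ε) (by
        rw [Prod.mk_sub_mk, sub_zero, Prod.norm_mk, norm_zero]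
        exact max_lt hq hε) (by simpa using ho)
    simpa using this
  have l₁ := low h₁ o₁
  have l₂ := low h₂ o₂
  have hu0 : 0 < ‖d2 0 u‖ ^ 2 := by
    have : d2 0 u ≠ 0 := fun h => hu (d2_zero_injective (by rw [h, map_zero]))
    have := norm_pos_iff.2 this
    positivity
  have hfu := hf u
  have hpu := neg_le_inner_pertScalar a k p u
  rw [inner_add_left, inner_smul_left, conj_trivial]
  set Q := inner ℝ (poschl κ ν u) (d2 0 u)
  set X := ‖d2 0 u‖ ^ 2
  have b₁ : a * (η * X) ≤ a * (Q + K * (2 * ε ^ 2 * X + 2 * ε ^ 2 * X)) := by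
    gcongr
    exact hfu.trans (by gcongr)
  have b₂ : |a| * (1 + |k| * ‖mulL‖) * ‖p‖ * X ≤ |a| * (1 + |k| * ‖mulL‖) * ε * X := by
    gcongr
  have b₃ := mul_lt_mul_of_pos_right hs hu0
  linarith

theorem sq_norm_add_sq_norm_pos {x : H2 × H2} (hx : x ≠ 0) :
    0 < ‖d2 0 x.1‖ ^ 2 + ‖d2 0 x.2‖ ^ 2 := by
  have e : ∀ u : H2, ‖d2 0 u‖ ^ 2 = 0 → u = 0 := fun u hu =>
    d2_zero_injective ((norm_eq_zero.1 (sq_eq_zero_iff.1 hu)).trans (map_zero (d2 0)).symm)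
  have h₁ := sq_nonneg ‖d2 0 x.1‖
  have h₂ := sq_nonneg ‖d2 0 x.2‖
  by_contra! h
  exact hx (Prod.ext (e _ (by linarith)) (e _ (by linarith)))

/-- The perturbed coupled block is positive on the complement of four pairs near its low modes. -/
theorem exists_block_form_pos {κ ν a : ℝ} (hκ : 0 < κ) (hν : 0 < ν - 1) (hν' : 0 < ν)
    (ha : 0 < a) (k : ℝ) : ∃ ε : ℝ, 0 < ε ∧ ∀ (p : H2 × H2 × ℝ) (q₁ q₂ q₃ q₄ : RealL2 × RealL2),
      ‖p‖ < ε → ‖q₁ - (d2 0 (ground hκ (by norm_num : (0 : ℝ) < 3)), 0)‖ < ε →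
      ‖q₂ - (0, d2 0 (excited hκ hν))‖ < ε →
      ‖q₃ - (d2 0 (excited hκ (by norm_num : (0 : ℝ) < 3 - 1)), 0)‖ < ε →
      ‖q₄ - (0, d2 0 (ground hκ hν'))‖ < ε → ∀ x : H2 × H2, x ≠ 0 →
      inner ℝ (d2 0 x.1) q₁.1 + inner ℝ (d2 0 x.2) q₁.2 = 0 →
      inner ℝ (d2 0 x.1) q₂.1 + inner ℝ (d2 0 x.2) q₂.2 = 0 →
      inner ℝ (d2 0 x.1) q₃.1 + inner ℝ (d2 0 x.2) q₃.2 = 0 →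
      inner ℝ (d2 0 x.1) q₄.1 + inner ℝ (d2 0 x.2) q₄.2 = 0 →
      0 < inner ℝ (block₀ κ ν a x + pertBlock a k p x).1 (d2 0 x.1) +
        inner ℝ (block₀ κ ν a x + pertBlock a k p x).2 (d2 0 x.2) := by
  obtain ⟨K₁, hK₁, hf₁⟩ := exists_poschl_form_ge hκ (by norm_num : (0 : ℝ) < 3 - 1) (by norm_num)
  obtain ⟨K₂, hK₂, hf₂⟩ := exists_poschl_form_ge hκ hν hν'
  have hη₁ := ladderGap_pos hκ (by norm_num : (0 : ℝ) < 3 - 1)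
  have hη₂ := ladderGap_pos hκ hν
  set η₁ := ladderGap κ (3 - 1)
  set η₂ := ladderGap κ (ν - 1)
  set η := min η₁ (a * η₂) with hη
  have hη0 : 0 < η := lt_min hη₁ (mul_pos ha hη₂)
  have hC := pertConst_nonneg a k
  obtain ⟨ε, hε, hs⟩ := exists_small_pos (K := (K₁ + a * K₂) * 4) (L := pertConst a k) hη0
  refine ⟨ε, hε, fun p q₁ q₂ q₃ q₄ hp h₁ h₂ h₃ h₄ x hx o₁ o₂ o₃ o₄ => ?_⟩
  have l₁ := sq_inner_add_inner_le (f := (d2 0 x.1, d2 0 x.2)) h₁ o₁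
  have l₂ := sq_inner_add_inner_le (f := (d2 0 x.1, d2 0 x.2)) h₂ o₂
  have l₃ := sq_inner_add_inner_le (f := (d2 0 x.1, d2 0 x.2)) h₃ o₃
  have l₄ := sq_inner_add_inner_le (f := (d2 0 x.1, d2 0 x.2)) h₄ o₄
  simp only [inner_zero_right, add_zero, zero_add] at l₁ l₂ l₃ l₄
  have f₁ := hf₁ x.1
  have f₂ := hf₂ x.2
  have hpx := neg_le_inner_pertBlock a k p x
  have hX := sq_norm_add_sq_norm_pos hx
  rw [Prod.fst_add, Prod.snd_add, inner_add_left, inner_add_left, block₀_apply]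
  dsimp only
  rw [inner_smul_left, conj_trivial]
  set Q₁ := inner ℝ (poschl κ 3 x.1) (d2 0 x.1)
  set Q₂ := inner ℝ (poschl κ ν x.2) (d2 0 x.2)
  set X₁ := ‖d2 0 x.1‖ ^ 2
  set X₂ := ‖d2 0 x.2‖ ^ 2
  have b₁ : η * X₁ ≤ Q₁ + K₁ * (2 * ε ^ 2 * (X₁ + X₂) + 2 * ε ^ 2 * (X₁ + X₂)) := by
    refine le_trans ?_ (f₁.trans (by gcongr))
    gcongr
    exact min_le_left _ _
  have b₂ : η * X₂ ≤ a * (Q₂ + K₂ * (2 * ε ^ 2 * (X₁ + X₂) + 2 * ε ^ 2 * (X₁ + X₂))) := by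
    have : a * (η₂ * X₂) ≤
        a * (Q₂ + K₂ * (2 * ε ^ 2 * (X₁ + X₂) + 2 * ε ^ 2 * (X₁ + X₂))) := by
      gcongr
      exact f₂.trans (by gcongr)
    refine le_trans ?_ this
    rw [← mul_assoc]
    gcongr
    exact min_le_right _ _
  have b₃ : pertConst a k * ‖p‖ * (X₁ + X₂) ≤ pertConst a k * ε * (X₁ + X₂) := by
    gcongr
  have b₄ := mul_lt_mul_of_pos_right hs hX
  linarith

/-! ### The low modes of the Hessian -/

theorem block_apply (κ ν a k : ℝ) (p : H2 × H2 × ℝ) (x : H2 × H2) :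
    block₀ κ ν a x + pertBlock a k p x =
      (poschl κ 3 x.1 - mulL p.1 (d2 0 x.1) - (2 : ℝ) • mulL p.2.1 (d2 0 x.2),
        a • (poschl κ ν x.2 - (p.2.2 • d2 0 x.2 + k • mulL p.1 (d2 0 x.2))) -
          (2 : ℝ) • mulL p.2.1 (d2 0 x.1)) := by
  rw [block₀_apply, pertBlock_apply, pertScalar_apply, Prod.mk_add_mk]
  congr 1
  · abel
  · module

theorem scalar_apply (κ ν a k : ℝ) (p : H2 × H2 × ℝ) (u : H2) :
    a • poschl κ ν u + pertScalar a k p u =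
      a • (poschl κ ν u - (p.2.2 • d2 0 u + k • mulL p.1 (d2 0 u))) := by
  rw [pertScalar_apply]
  module

theorem inner_scalar (κ ν a k : ℝ) (p : H2 × H2 × ℝ) (u v : H2) :
    inner ℝ (a • poschl κ ν u + pertScalar a k p u) (d2 0 v) =
      inner ℝ (d2 0 u) (a • poschl κ ν v + pertScalar a k p v) := by
  rw [scalar_apply, scalar_apply]
  simp only [inner_smul_left, inner_smul_right, inner_sub_left, inner_sub_right, inner_add_left,
    inner_add_right, inner_poschl, inner_mulL, conj_trivial]

theorem inner_block (κ ν a k : ℝ) (p : H2 × H2 × ℝ) (x y : H2 × H2) :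
    inner ℝ (block₀ κ ν a x + pertBlock a k p x).1 (d2 0 y.1) +
      inner ℝ (block₀ κ ν a x + pertBlock a k p x).2 (d2 0 y.2) =
    inner ℝ (d2 0 x.1) (block₀ κ ν a y + pertBlock a k p y).1 +
      inner ℝ (d2 0 x.2) (block₀ κ ν a y + pertBlock a k p y).2 := by
  rw [block_apply, block_apply]
  simp only [inner_smul_left, inner_smul_right, inner_sub_left, inner_sub_right, inner_add_left,
    inner_add_right, inner_poschl, inner_mulL, conj_trivial]
  ring

/-- Pairing an eigenvector `(ψ, z)` of the block with `(2 (U - U₀), A)`, which the block maps to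
`(-(U - U₀)², -4 A (U - U₀))`, expresses the eigenvalue by the solution. -/
theorem eigenvalue_mul_eq {κ ν a k β : ℝ} {h A : H2}
    (eh : poschl κ 3 h = (1 / 2 : ℝ) • mulL h (d2 0 h) + mulL A (d2 0 A))
    (eA : poschl κ ν A = β • d2 0 A + k • mulL h (d2 0 A)) {x : H2 × H2} {μ : ℝ}
    (hx : block₀ κ ν a x + pertBlock a k (h, A, β) x = μ • incl2 x) :
    μ * (2 * inner ℝ (d2 0 x.1) (d2 0 h) + inner ℝ (d2 0 x.2) (d2 0 A)) =
      -(inner ℝ (d2 0 x.1) (mulL h (d2 0 h)) + 4 * inner ℝ (d2 0 x.2) (mulL h (d2 0 A))) := by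
  have e : block₀ κ ν a ((2 : ℝ) • h, A) + pertBlock a k (h, A, β) ((2 : ℝ) • h, A) =
      (-mulL h (d2 0 h), -((4 : ℝ) • mulL h (d2 0 A))) := by
    have hc := mulL_comm A h
    rw [block_apply]
    simp only [map_smul, eh, eA, hc]
    congr 1 <;> module
  have hs := inner_block κ ν a k (h, A, β) x ((2 : ℝ) • h, A)
  rw [e, hx, incl2_apply] at hs
  simp only [Prod.smul_mk, map_smul, inner_smul_left, inner_smul_right, inner_neg_right,
    conj_trivial] at hs
  linarith

theorem eigenvalue_mul_eq_of_expansion {κ ν a k β α : ℝ} {b w : H2} (hα : α ≠ 0)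
    (eh : poschl κ 3 (α ^ 2 • w) = (1 / 2 : ℝ) • mulL (α ^ 2 • w) (d2 0 (α ^ 2 • w)) +
      mulL (α • b) (d2 0 (α • b)))
    (eA : poschl κ ν (α • b) = β • d2 0 (α • b) + k • mulL (α ^ 2 • w) (d2 0 (α • b)))
    {x : H2 × H2} {μ : ℝ}
    (hx : block₀ κ ν a x + pertBlock a k (α ^ 2 • w, α • b, β) x = μ • incl2 x) :
    μ * (inner ℝ (d2 0 x.2) (d2 0 b) + 2 * α * inner ℝ (d2 0 x.1) (d2 0 w)) =
      -(α ^ 2 * (4 * inner ℝ (d2 0 x.2) (mulL w (d2 0 b)) +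
        α * inner ℝ (d2 0 x.1) (mulL w (d2 0 w)))) := by
  have h := eigenvalue_mul_eq eh eA hx
  simp only [map_smul, _root_.smul_apply, inner_smul_right] at h
  refine mul_left_cancel₀ hα ?_
  linear_combination h

/-- Positivity of the leading coefficients in `eigenvalue_mul_eq_of_expansion`. -/
theorem exists_forall_near_pos {X H : Type*} [NormedAddCommGroup X] [NormedSpace ℝ X]
    [NormedAddCommGroup H] [InnerProductSpace ℝ H] (d : X →L[ℝ] H) (m : X →L[ℝ] H →L[ℝ] H)
    {g W : X} (hg : d g ≠ 0) {P : ℝ} (hP : P = inner ℝ (d g) (m W (d g))) (hP0 : P ≠ 0) :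
    ∃ ε : ℝ, 0 < ε ∧ ∀ (x : X × X) (b w : X) (α : ℝ), ‖x - (0, g)‖ < ε → ‖b - g‖ < ε →
      ‖w - W‖ < ε → |α| < ε →
      0 < inner ℝ (d x.2) (d b) + 2 * α * inner ℝ (d x.1) (d w) ∧
      0 < P * (4 * inner ℝ (d x.2) (m w (d b)) + α * inner ℝ (d x.1) (m w (d w))) := by
  have c₁ : Continuous fun y : (X × X) × X × X × ℝ =>
      inner ℝ (d y.1.2) (d y.2.1) + 2 * y.2.2.2 * inner ℝ (d y.1.1) (d y.2.2.1) := by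
    fun_prop
  have c₂ : Continuous fun y : (X × X) × X × X × ℝ =>
      P * (4 * inner ℝ (d y.1.2) (m y.2.2.1 (d y.2.1)) +
        y.2.2.2 * inner ℝ (d y.1.1) (m y.2.2.1 (d y.2.2.1))) := by
    fun_prop
  have p₁ : 0 < inner ℝ (d g) (d g) + 2 * 0 * inner ℝ (d (0 : X)) (d W) := by
    rw [mul_zero, zero_mul, add_zero]
    exact real_inner_self_pos.2 hg
  have p₂ : 0 < P * (4 * inner ℝ (d g) (m W (d g)) + 0 * inner ℝ (d (0 : X)) (m W (d W))) := by
    rw [zero_mul, add_zero, ← hP]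
    have : 0 < P ^ 2 := by positivity
    linarith
  have e₁ := (c₁.tendsto ((0, g), g, W, 0)).eventually_const_lt p₁
  have e₂ := (c₂.tendsto ((0, g), g, W, 0)).eventually_const_lt p₂
  obtain ⟨ε, hε, hb⟩ := Metric.eventually_nhds_iff.1 (e₁.and e₂)
  refine ⟨ε, hε, fun x b w α h₁ h₂ h₃ h₄ => ?_⟩
  refine hb (y := (x, b, w, α)) ?_
  have e : (x, b, w, α) - ((0, g), g, W, 0) = (x - (0, g), b - g, w - W, α) :=
    Prod.ext rfl (Prod.ext rfl (Prod.ext rfl (sub_zero α)))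
  rw [dist_eq_norm, e]
  exact max_lt h₁ (max_lt h₂ (max_lt h₃ h₄))

/-- The derivative of the soliton is proportional to the excited state of `L₁`. -/
theorem d2_one_U₀ {c : ℝ} (hc : 0 < c) : d2 1 (U₀ hc) =
    (-(3 * c * √c)) • d2 0 (excited (kap_pos hc) (by norm_num : (0 : ℝ) < 3 - 1)) := by
  refine Lp.ext ?_
  filter_upwards [(coeFn_U₀ hc).2.1,
    (coeFn_excited (kap_pos hc) (by norm_num : (0 : ℝ) < 3 - 1)).1,
    Lp.coeFn_smul (-(3 * c * √c)) (d2 0 (excited (kap_pos hc) (by norm_num : (0 : ℝ) < 3 - 1)))]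
    with x h₁ h₂ h₃
  rw [h₁, h₃, Pi.smul_apply, h₂, soliton', soliton, sechTanh, kap, smul_eq_mul,
    show (3 : ℝ) - 1 = (2 : ℕ) by norm_num, Real.rpow_natCast]
  ring

/-- Translation invariance: `(U', A')` is in the kernel of the block. -/
theorem exists_translation_mode {c k : ℝ} (hc : 0 < c) (hk : 1 / 6 < k) {β : ℝ} {h A : H2}
    (even : refl (d2 0 h) = (1 : ℝ) • d2 0 h) (odd : refl (d2 0 A) = (-1 : ℝ) • d2 0 A)
    (eh : poschl (kap c) 3 h = (1 / 2 : ℝ) • mulL h (d2 0 h) + mulL A (d2 0 A))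
    (eA : poschl (kap c) (nu k) A = β • d2 0 A + k • mulL h (d2 0 A)) :
    ∃ x ∈ sectorH2 (-1), d2 0 x.1 = d2 1 (U₀ hc + h) ∧ d2 0 x.2 = d2 1 A ∧
      block₀ (kap c) (nu k) (2 / k) x + pertBlock (2 / k) k (h, A, β) x = 0 := by
  have hk0 : k ≠ 0 := by linarith
  have e₁ := defect_U_eq hc (U₀ hc + h) A
  have e₂ := defect_A_eq hc hk (β + Ωc2 c k) (U₀ hc + h) A
  rw [add_sub_cancel_left, eh, sub_self] at e₁
  rw [add_sub_cancel_left, add_sub_cancel_right, eA, sub_self] at e₂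
  have evenU : refl (d2 0 (U₀ hc + h)) = (1 : ℝ) • d2 0 (U₀ hc + h) := by
    rw [map_add, map_add, refl_U₀, even, smul_add]
  have hU : h = (U₀ hc + h) - U₀ hc := (add_sub_cancel_left _ _).symm
  generalize U₀ hc + h = U at *
  have w₁ : HasWeakDeriv (d2 2 U) (c • d2 1 U + ((-1 / 2 : ℝ) • (mulL U (d2 1 U) + mulL U (d2 1 U))
      + (-1 : ℝ) • (mulL A (d2 1 A) + mulL A (d2 1 A))) : RealL2) := by
    have e : d2 2 U = c • d2 0 U + ((-1 / 2 : ℝ) • mulL U (d2 0 U) + (-1 : ℝ) • mulL A (d2 0 A)) := by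
      rw [← sub_eq_zero, ← e₁]
      module
    rw [e]
    exact ((H2.hasWeakDeriv₁ U).smul c).add
      (((hasWeakDeriv_mulL U U).smul _).add ((hasWeakDeriv_mulL A A).smul _))
  have w₂ : HasWeakDeriv (d2 2 A) ((-(β + Ωc2 c k)) • d2 1 A +
      (-k) • (mulL U (d2 1 A) + mulL A (d2 1 U)) : RealL2) := by
    have e : d2 2 A = (-(β + Ωc2 c k)) • d2 0 A + (-k) • mulL U (d2 0 A) := by
      rw [← sub_eq_zero, ← e₂]
      module
    rw [e]
    exact ((H2.hasWeakDeriv₁ A).smul _).add ((hasWeakDeriv_mulL U A).smul _)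
  refine ⟨(H2.mk' _ _ _ (H2.hasWeakDeriv₂ U) w₁, H2.mk' _ _ _ (H2.hasWeakDeriv₂ A) w₂),
    mem_sectorH2.2 ⟨refl_d2_one evenU, refl_d2_one odd⟩, rfl, rfl, ?_⟩
  rw [block_apply]
  simp only [poschl_three hc, poschl_nu hc hk, d2_zero_mk', d2_two_mk', hU, map_sub,
    _root_.sub_apply]
  refine Prod.ext ?_ ?_
  · change _ = (0 : RealL2)
    dsimp only
    module
  · change _ = (0 : RealL2)
    dsimp only
    match_scalars <;> field_simp <;> ring

/-! ### The Morse index and the nullity -/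

/-- The direct sum of an operator on pairs and a scalar operator, with values in `L²(ℝ)³`. -/
def directSum (B : (H2 × H2) →L[ℝ] RealL2 × RealL2) (S : H2 →L[ℝ] RealL2) :
    (H2 × H2 × H2) →ₗ[ℝ] PiLp 2 (fun _ : Fin 3 => RealL2) where
  toFun v := WithLp.toLp 2 ![(B (v.1, v.2.1)).1, (B (v.1, v.2.1)).2, S v.2.2]
  map_add' v w := by
    have e := B.map_add (v.1, v.2.1) (w.1, w.2.1)
    ext i : 1
    fin_cases i
    · exact congrArg Prod.fst e
    · exact congrArg Prod.snd e
    · exact S.map_add v.2.2 w.2.2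
  map_smul' r v := by
    have e := B.map_smul r (v.1, v.2.1)
    ext i : 1
    fin_cases i
    · exact congrArg Prod.fst e
    · exact congrArg Prod.snd e
    · exact S.map_smul r v.2.2

theorem inner_directSum (B B' : (H2 × H2) →L[ℝ] RealL2 × RealL2) (S S' : H2 →L[ℝ] RealL2)
    (v w : H2 × H2 × H2) : inner ℝ (directSum B S v) (directSum B' S' w) =
      inner ℝ (B (v.1, v.2.1)).1 (B' (w.1, w.2.1)).1 +
      inner ℝ (B (v.1, v.2.1)).2 (B' (w.1, w.2.1)).2 + inner ℝ (S v.2.2) (S' w.2.2) := by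
  rw [PiLp.inner_apply, Fin.sum_univ_three]
  rfl

theorem directSum_eq_smul_iff {B B' : (H2 × H2) →L[ℝ] RealL2 × RealL2} {S S' : H2 →L[ℝ] RealL2}
    {μ : ℝ} {v : H2 × H2 × H2} : directSum B S v = μ • directSum B' S' v ↔
      B (v.1, v.2.1) = μ • B' (v.1, v.2.1) ∧ S v.2.2 = μ • S' v.2.2 := by
  constructor
  · intro h
    exact ⟨Prod.ext (congrArg (fun f => f 0) h) (congrArg (fun f => f 1) h),
      congrArg (fun f => f 2) h⟩
  · rintro ⟨h₁, h₂⟩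
    ext i : 1
    fin_cases i
    · exact congrArg Prod.fst h₁
    · exact congrArg Prod.snd h₁
    · exact h₂

theorem directSum_incl_injective : Function.Injective (directSum incl2 (d2 0)) := by
  rw [← LinearMap.ker_eq_bot, LinearMap.ker_eq_bot']
  intro v hv
  have e : ∀ u : H2, d2 0 u = 0 → u = 0 := fun u hu =>
    d2_zero_injective (hu.trans (map_zero (d2 0)).symm)
  exact Prod.ext (e _ (congrArg (fun f => f 0) hv)) (Prod.ext (e _ (congrArg (fun f => f 1) hv))
    (e _ (congrArg (fun f => f 2) hv)))

theorem coe_L₁ {c : ℝ} (hc : 0 < c) (h u : H2) :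
    L₁ c (U₀ hc + h) u = ((poschl (kap c) 3 u - mulL h (d2 0 u) : RealL2) : RealL0) := by
  have e : poschl (kap c) 3 u - mulL h (d2 0 u) =
      -d2 2 u + c • d2 0 u - mulL (U₀ hc + h) (d2 0 u) := by
    rw [poschl_three hc, map_add, _root_.add_apply]
    abel
  have h := coe_mulL (U₀ hc + h) (d2 0 u)
  rw [e]
  change -D 2 u + c • D 0 u - D 0 _ * D 0 u = _
  rw [D_eq 0 u, ← h]
  rfl

theorem coe_L₂ {c k : ℝ} (hc : 0 < c) (hk : 1 / 6 < k) (β : ℝ) (h A u : H2) :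
    L₂ k (Ωc2 c k + β) (U₀ hc + h) u =
      (((2 / k) • poschl (kap c) (nu k) u + pertScalar (2 / k) k (h, A, β) u : RealL2) :
        RealL0) := by
  have e : (2 / k) • poschl (kap c) (nu k) u + pertScalar (2 / k) k (h, A, β) u =
      (2 / k) • (-d2 2 u - (Ωc2 c k + β) • d2 0 u - k • mulL (U₀ hc + h) (d2 0 u)) := by
    rw [scalar_apply, poschl_nu hc hk, map_add, _root_.add_apply]
    module
  have h := coe_mulL (U₀ hc + h) (d2 0 u)
  rw [e]
  change (2 / k) • (-D 2 u - (Ωc2 c k + β) • D 0 u - k • (D 0 _ * D 0 u)) = _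
  rw [D_eq 0 u, ← h]
  rfl

theorem mem_eigenspace_iff {c k : ℝ} (hc : 0 < c) (hk : 1 / 6 < k) (β : ℝ) (h A : H2) (μ : ℝ)
    (v : H2 × H2 × H2) : v ∈ eigenspace c k (Ωc2 c k + β) (U₀ hc + h) A μ ↔
      directSum (block₀ (kap c) (nu k) (2 / k) + pertBlock (2 / k) k (h, A, β))
        ((2 / k) • poschl (kap c) (nu k) + pertScalar (2 / k) k (h, A, β)) v =
      μ • directSum incl2 (d2 0) v := by
  have e₀ := coe_L₁ hc h v.1
  have e₁ := coe_L₂ hc hk β h A v.2.1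
  have e₂ := coe_L₂ hc hk β h A v.2.2
  have m₁ := coe_mulL A (d2 0 v.2.1)
  have m₂ := coe_mulL A (d2 0 v.1)
  rw [directSum_eq_smul_iff, eigenspace, LinearMap.mem_ker, LinearMap.sub_apply, sub_eq_zero]
  have hH : hessian c k (Ωc2 c k + β) (U₀ hc + h) A v =
      (((poschl (kap c) 3 v.1 - mulL h (d2 0 v.1) - (2 : ℝ) • mulL A (d2 0 v.2.1) : RealL2) :
        RealL0),
      ((-((2 : ℝ) • mulL A (d2 0 v.1)) + ((2 / k) • poschl (kap c) (nu k) v.2.1 +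
        pertScalar (2 / k) k (h, A, β) v.2.1) : RealL2) : RealL0),
      (((2 / k) • poschl (kap c) (nu k) v.2.2 + pertScalar (2 / k) k (h, A, β) v.2.2 : RealL2) :
        RealL0)) := by
    change (L₁ c (U₀ hc + h) v.1 - (2 : ℝ) • (D 0 A * D 0 v.2.1),
      -((2 : ℝ) • (D 0 A * D 0 v.1)) + L₂ k (Ωc2 c k + β) (U₀ hc + h) v.2.1,
      L₂ k (Ωc2 c k + β) (U₀ hc + h) v.2.2) = _
    rw [e₀, e₁, e₂, D_eq 0 v.2.1, D_eq 0 v.1, ← m₁, ← m₂]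
    rfl
  have hB : (block₀ (kap c) (nu k) (2 / k) + pertBlock (2 / k) k (h, A, β)) (v.1, v.2.1) =
      (poschl (kap c) 3 v.1 - mulL h (d2 0 v.1) - (2 : ℝ) • mulL A (d2 0 v.2.1),
        -((2 : ℝ) • mulL A (d2 0 v.1)) + ((2 / k) • poschl (kap c) (nu k) v.2.1 +
        pertScalar (2 / k) k (h, A, β) v.2.1)) := by
    rw [_root_.add_apply, block_apply, scalar_apply]
    refine Prod.ext rfl ?_
    dsimp only
    abel
  rw [hH, hB]
  constructor
  · intro h
    exact ⟨Prod.ext (coe_L2_injective (congrArg Prod.fst h))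
      (coe_L2_injective (congrArg (fun f => f.2.1) h)),
      coe_L2_injective (congrArg (fun f => f.2.2) h)⟩
  · rintro ⟨h₁, h₂⟩
    exact Prod.ext (congrArg (fun f => ((f.1 : RealL2) : RealL0)) h₁)
      (Prod.ext (congrArg (fun f => ((f.2 : RealL2) : RealL0)) h₁)
        (congrArg (fun f : RealL2 => (f : RealL0)) h₂))

/-- The eigenspaces at the nonpositive eigenvalues are spanned by the given eigenvectors, so that
they are counted by these. -/
theorem finrank_eigenspaces {X H ι : Type*} [AddCommGroup X] [Module ℝ X] [NormedAddCommGroup H]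
    [InnerProductSpace ℝ H] [Fintype ι] {T j : X →ₗ[ℝ] H} (hj : Function.Injective j)
    (hT : ∀ x y, inner ℝ (T x) (j y) = inner ℝ (j x) (T y))
    {v : ι → X} {μ : ι → ℝ} (hv : ∀ i, T (v i) = μ i • j (v i)) (hv0 : ∀ i, v i ≠ 0)
    (ho : Pairwise fun i k => inner ℝ (j (v i)) (j (v k)) = 0)
    (hpos : ∀ x, x ≠ 0 → (∀ i, inner ℝ (j x) (j (v i)) = 0) → 0 < inner ℝ (T x) (j x))
    {E : ℝ → Submodule ℝ X} (hE : ∀ r x, x ∈ E r ↔ T x = r • j x) :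
    Module.finrank ℝ ↥(⨆ r : Set.Iio (0 : ℝ), E r) = (Finset.univ.filter fun i => μ i < 0).card ∧
      Module.finrank ℝ ↥(E 0) = (Finset.univ.filter fun i => μ i = 0).card := by
  classical
  have hs : ∀ r ≤ 0, E r = Submodule.span ℝ (v '' {i | μ i = r}) := fun r hr => by
    refine le_antisymm (fun x hx => mem_span_of_eigenvector hj hT hv hv0 ho hpos hr ((hE r x).1 hx))
      (Submodule.span_le.2 ?_)
    rintro _ ⟨i, rfl, rfl⟩
    exact (hE _ _).2 (hv i)
  have hl := linearIndependent_of_orthogonal hj hv0 ho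
  constructor
  · rw [← finrank_span_image hl]
    have e : (⨆ r : Set.Iio (0 : ℝ), E r) = ⨆ r : Set.Iio (0 : ℝ),
        Submodule.span ℝ (v '' {i | μ i = r}) := iSup_congr fun r => hs r r.2.le
    have e' : v '' ((Finset.univ.filter fun i => μ i < 0 : Finset ι) : Set ι) =
        ⋃ r : Set.Iio (0 : ℝ), v '' {i | μ i = r} := by
      ext x
      simp
    rw [e, e', Submodule.span_iUnion]
  · have e : ((Finset.univ.filter fun i => μ i = 0 : Finset ι) : Set ι) = {i | μ i = 0} := by
      ext x
      simp
    rw [← finrank_span_image hl, hs 0 le_rfl, e]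

theorem inner_eq_zero_of_ne_eigenvalue {κ ν a k : ℝ} {p : H2 × H2 × ℝ} {x y : H2 × H2} {μ μ' : ℝ}
    (hx : block₀ κ ν a x + pertBlock a k p x = μ • incl2 x)
    (hy : block₀ κ ν a y + pertBlock a k p y = μ' • incl2 y) (hμ : μ ≠ μ') :
    inner ℝ (d2 0 x.1) (d2 0 y.1) + inner ℝ (d2 0 x.2) (d2 0 y.2) = 0 := by
  have h := inner_block κ ν a k p x y
  rw [hx, hy, Prod.smul_fst, Prod.smul_snd, Prod.smul_fst, Prod.smul_snd, inner_smul_left,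
    inner_smul_left, inner_smul_right, inner_smul_right, incl2_apply, incl2_apply, conj_trivial] at h
  refine (mul_eq_zero.1 ?_).resolve_left (sub_ne_zero.2 hμ)
  linear_combination h

theorem inner_eq_zero_of_sector {x y : H2 × H2} (hx : x ∈ sectorH2 1) (hy : y ∈ sectorH2 (-1)) :
    inner ℝ (d2 0 x.1) (d2 0 y.1) + inner ℝ (d2 0 x.2) (d2 0 y.2) = 0 := by
  rw [mem_sectorH2] at hx hy
  rw [inner_eq_zero_of_parity (by norm_num) hx.1 hy.1,
    inner_eq_zero_of_parity (by norm_num) hx.2 (by rw [hy.2]), add_zero]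

theorem inner_eq_zero_of_ne_eigenvalue_scalar {κ ν a k : ℝ} {p : H2 × H2 × ℝ} {u v : H2} {μ μ' : ℝ}
    (hu : a • poschl κ ν u + pertScalar a k p u = μ • d2 0 u)
    (hv : a • poschl κ ν v + pertScalar a k p v = μ' • d2 0 v) (hμ : μ ≠ μ') :
    inner ℝ (d2 0 u) (d2 0 v) = 0 := by
  have h := inner_scalar κ ν a k p u v
  rw [hu, hv, inner_smul_left, inner_smul_right, conj_trivial] at h
  refine (mul_eq_zero.1 ?_).resolve_left (sub_ne_zero.2 hμ)
  linear_combination h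

/-- The indices of the Hessian, when six orthogonal eigenvectors are known on whose complement it is
positive. The first two are in the sector of the branch, the third and fourth in the other
sector, the last two are those of the scalar operator. -/
theorem indices_of_eigenvectors {c k : ℝ} (hc : 0 < c) (hk : 1 / 6 < k) {β : ℝ} {h A : H2}
    {B : (H2 × H2) →L[ℝ] RealL2 × RealL2} {S : H2 →L[ℝ] RealL2}
    (hB : B = block₀ (kap c) (nu k) (2 / k) + pertBlock (2 / k) k (h, A, β))
    (hS : S = (2 / k) • poschl (kap c) (nu k) + pertScalar (2 / k) k (h, A, β))
    {x₁ x₂ x₃ x₄ : H2 × H2} {u₅ u₆ : H2} {μ₁ μ₂ μ₄ μ₅ : ℝ}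
    (m₁ : x₁ ∈ sectorH2 1) (m₂ : x₂ ∈ sectorH2 1) (m₃ : x₃ ∈ sectorH2 (-1))
    (m₄ : x₄ ∈ sectorH2 (-1)) (e₁ : B x₁ = μ₁ • incl2 x₁) (e₂ : B x₂ = μ₂ • incl2 x₂)
    (e₃ : B x₃ = (0 : ℝ) • incl2 x₃) (e₄ : B x₄ = μ₄ • incl2 x₄)
    (e₅ : S u₅ = μ₅ • d2 0 u₅) (e₆ : S u₆ = (0 : ℝ) • d2 0 u₆)
    (n₁ : x₁ ≠ 0) (n₂ : x₂ ≠ 0) (n₃ : x₃ ≠ 0) (n₄ : x₄ ≠ 0) (n₅ : u₅ ≠ 0) (n₆ : u₆ ≠ 0)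
    (h₁₂ : μ₁ < μ₂) (h₁ : μ₁ < 0) (h₂ : μ₂ ≠ 0) (h₄ : μ₄ < 0) (h₅ : μ₅ < 0)
    (posB : ∀ x : H2 × H2, x ≠ 0 →
      inner ℝ (d2 0 x.1) (d2 0 x₁.1) + inner ℝ (d2 0 x.2) (d2 0 x₁.2) = 0 →
      inner ℝ (d2 0 x.1) (d2 0 x₂.1) + inner ℝ (d2 0 x.2) (d2 0 x₂.2) = 0 →
      inner ℝ (d2 0 x.1) (d2 0 x₃.1) + inner ℝ (d2 0 x.2) (d2 0 x₃.2) = 0 →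
      inner ℝ (d2 0 x.1) (d2 0 x₄.1) + inner ℝ (d2 0 x.2) (d2 0 x₄.2) = 0 →
      0 < inner ℝ (B x).1 (d2 0 x.1) + inner ℝ (B x).2 (d2 0 x.2))
    (posS : ∀ u : H2, u ≠ 0 → inner ℝ (d2 0 u) (d2 0 u₅) = 0 → inner ℝ (d2 0 u) (d2 0 u₆) = 0 →
      0 < inner ℝ (S u) (d2 0 u)) :
    (μ₂ < 0 → morseIndex c k (Ωc2 c k + β) (U₀ hc + h) A = 4) ∧
    (0 < μ₂ → morseIndex c k (Ωc2 c k + β) (U₀ hc + h) A = 3) ∧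
    nullityIndex c k (Ωc2 c k + β) (U₀ hc + h) A = 2 := by
  have o₁₂ : inner ℝ (d2 0 x₁.1) (d2 0 x₂.1) + inner ℝ (d2 0 x₁.2) (d2 0 x₂.2) = 0 := by
    rw [hB] at e₁ e₂
    exact inner_eq_zero_of_ne_eigenvalue e₁ e₂ h₁₂.ne
  have o₃₄ : inner ℝ (d2 0 x₃.1) (d2 0 x₄.1) + inner ℝ (d2 0 x₃.2) (d2 0 x₄.2) = 0 := by
    rw [hB] at e₃ e₄
    exact inner_eq_zero_of_ne_eigenvalue e₃ e₄ h₄.ne'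
  have o₅₆ : inner ℝ (d2 0 u₅) (d2 0 u₆) = 0 := by
    rw [hS] at e₅ e₆
    exact inner_eq_zero_of_ne_eigenvalue_scalar e₅ e₆ h₅.ne
  have o₁₃ := inner_eq_zero_of_sector m₁ m₃
  have o₁₄ := inner_eq_zero_of_sector m₁ m₄
  have o₂₃ := inner_eq_zero_of_sector m₂ m₃
  have o₂₄ := inner_eq_zero_of_sector m₂ m₄
  set v : Fin 6 → H2 × H2 × H2 := ![(x₁.1, x₁.2, 0), (x₂.1, x₂.2, 0), (x₃.1, x₃.2, 0),
    (x₄.1, x₄.2, 0), (0, 0, u₅), (0, 0, u₆)] with hv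
  set μ : Fin 6 → ℝ := ![μ₁, μ₂, 0, μ₄, μ₅, 0] with hμ
  have hinner : ∀ x y, inner ℝ (directSum incl2 (d2 0) x) (directSum incl2 (d2 0) y) =
      inner ℝ (d2 0 x.1) (d2 0 y.1) + inner ℝ (d2 0 x.2.1) (d2 0 y.2.1) +
        inner ℝ (d2 0 x.2.2) (d2 0 y.2.2) := fun x y => inner_directSum _ _ _ _ x y
  have hsymm : ∀ x y, inner ℝ (directSum B S x) (directSum incl2 (d2 0) y) =
      inner ℝ (directSum incl2 (d2 0) x) (directSum B S y) := fun x y => by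
    rw [inner_directSum, inner_directSum, hB, hS]
    exact congrArg₂ (· + ·) (inner_block _ _ _ _ _ (x.1, x.2.1) (y.1, y.2.1))
      (inner_scalar _ _ _ _ _ x.2.2 y.2.2)
  have heig : ∀ i, directSum B S (v i) = μ i • directSum incl2 (d2 0) (v i) := by
    have l : ∀ {x : H2 × H2} {r : ℝ}, B x = r • incl2 x →
        directSum B S (x.1, x.2, 0) = r • directSum incl2 (d2 0) (x.1, x.2, 0) := fun hx =>
      directSum_eq_smul_iff.2 ⟨hx, by rw [map_zero, map_zero, smul_zero]⟩
    have l' : ∀ {u : H2} {r : ℝ}, S u = r • d2 0 u →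
        directSum B S (0, 0, u) = r • directSum incl2 (d2 0) (0, 0, u) := fun {u r} hu =>
      directSum_eq_smul_iff.2 ⟨by
        change B 0 = r • incl2 0
        rw [map_zero, map_zero, smul_zero], hu⟩
    intro i
    fin_cases i
    exacts [l e₁, l e₂, l e₃, l e₄, l' e₅, l' e₆]
  have hne : ∀ i, v i ≠ 0 := by
    have l : ∀ {x : H2 × H2}, x ≠ 0 → ((x.1, x.2, 0) : H2 × H2 × H2) ≠ 0 := fun hx h0 =>
      hx (Prod.ext (congrArg (fun f : H2 × H2 × H2 => f.1) h0)
        (congrArg (fun f : H2 × H2 × H2 => f.2.1) h0))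
    have l' : ∀ {u : H2}, u ≠ 0 → ((0, 0, u) : H2 × H2 × H2) ≠ 0 := fun hu h0 =>
      hu (congrArg (fun f : H2 × H2 × H2 => f.2.2) h0)
    intro i
    fin_cases i
    exacts [l n₁, l n₂, l n₃, l n₄, l' n₅, l' n₆]
  have hlt : ∀ i j, i < j →
      inner ℝ (directSum incl2 (d2 0) (v i)) (directSum incl2 (d2 0) (v j)) = 0 := by
    intro i j hij
    rw [hinner]
    fin_cases i <;> fin_cases j <;>
      first
      | exact absurd hij (by decide)
      | simp [hv, o₁₂, o₃₄, o₅₆, o₁₃, o₁₄, o₂₃, o₂₄]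
  have hpos : ∀ x, x ≠ 0 → (∀ i, inner ℝ (directSum incl2 (d2 0) x)
      (directSum incl2 (d2 0) (v i)) = 0) →
      0 < inner ℝ (directSum B S x) (directSum incl2 (d2 0) x) := by
    intro x hx ho
    have q : ∀ y : H2 × H2, inner ℝ (directSum incl2 (d2 0) x)
        (directSum incl2 (d2 0) (y.1, y.2, 0)) = 0 →
        inner ℝ (d2 0 x.1) (d2 0 y.1) + inner ℝ (d2 0 x.2.1) (d2 0 y.2) = 0 := fun y hy => by
      simpa [hinner] using hy
    have q' : ∀ u : H2, inner ℝ (directSum incl2 (d2 0) x)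
        (directSum incl2 (d2 0) (0, 0, u)) = 0 → inner ℝ (d2 0 x.2.2) (d2 0 u) = 0 := fun u hu => by
      simpa [hinner] using hu
    have pB := fun hx => posB (x.1, x.2.1) hx (q x₁ (ho 0)) (q x₂ (ho 1)) (q x₃ (ho 2)) (q x₄ (ho 3))
    have pS := fun hx => posS x.2.2 hx (q' u₅ (ho 4)) (q' u₆ (ho 5))
    rw [inner_directSum]
    change 0 < inner ℝ (B (x.1, x.2.1)).1 (d2 0 x.1) + inner ℝ (B (x.1, x.2.1)).2 (d2 0 x.2.1) +
      inner ℝ (S x.2.2) (d2 0 x.2.2)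
    by_cases hx₁ : ((x.1, x.2.1) : H2 × H2) = 0
    · have hx₂ : x.2.2 ≠ 0 := fun h0 =>
        hx (Prod.ext (congrArg (fun f : H2 × H2 => f.1) hx₁)
          (Prod.ext (congrArg (fun f : H2 × H2 => f.2) hx₁) h0))
      rw [hx₁, map_zero]
      simpa using pS hx₂
    · have := pB hx₁
      by_cases hx₂ : x.2.2 = 0
      · rw [hx₂, map_zero, inner_zero_left, add_zero]
        exact this
      · exact add_pos this (pS hx₂)
  obtain ⟨c₁, c₂⟩ := finrank_eigenspaces directSum_incl_injective hsymm heig hne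
    (fun i j hij => hij.lt_or_gt.elim (hlt i j) fun h => (real_inner_comm _ _).trans (hlt j i h)) hpos
    (E := eigenspace c k (Ωc2 c k + β) (U₀ hc + h) A)
    (fun r x => by rw [hB, hS]; exact mem_eigenspace_iff hc hk β h A r x)
  rw [morseIndex, nullityIndex, c₁, c₂]
  refine ⟨fun h0 => ?_, fun h0 => ?_, ?_⟩
  · rw [Finset.card_filter, Fin.sum_univ_six]
    simp [hμ, h₁, h0, h₄, h₅]
  · rw [Finset.card_filter, Fin.sum_univ_six]
    simp [hμ, h₁, h0.le, h₄, h₅]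
  · rw [Finset.card_filter, Fin.sum_univ_six]
    simp [hμ, h₁.ne, h₂, h₄.ne, h₅.ne]

/-! ### The indices near the bifurcation point -/

theorem setOf_near_mem_nhds {X : Type*} [NormedAddCommGroup X] {φ : X} {μ₀ ε r : ℝ} (hφ : φ ≠ 0)
    (hε : 0 < ε) (hr : 0 < r) :
    {y : X × ℝ | ‖y.1 - φ‖ < ε ∧ y.1 ≠ 0 ∧ |y.2 - μ₀| < r} ∈ 𝓝 (φ, μ₀) := by
  have c₁ : Continuous fun y : X × ℝ => ‖y.1 - φ‖ := by fun_prop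
  have c₂ : Continuous fun y : X × ℝ => |y.2 - μ₀| := by fun_prop
  refine IsOpen.mem_nhds ?_ ⟨by simpa using hε, hφ, by simpa using hr⟩
  exact (isOpen_lt c₁ continuous_const).inter
    ((isOpen_ne.preimage continuous_fst).inter (isOpen_lt c₂ continuous_const))

theorem incl2_inl (u : H2) : incl2 (u, 0) = (d2 0 u, 0) :=
  Prod.ext rfl (map_zero (d2 0))

theorem incl2_inr (u : H2) : incl2 (0, u) = (0, d2 0 u) :=
  Prod.ext (map_zero (d2 0)) rfl

theorem norm_incl2_sub_le (x y : H2 × H2) : ‖incl2 x - incl2 y‖ ≤ ‖x - y‖ := by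
  rw [← map_sub, incl2_apply]
  exact max_le ((H2.norm_d2_le 0 _).trans (norm_fst_le (x - y)))
    ((H2.norm_d2_le 0 _).trans (norm_snd_le (x - y)))

/-- The four low modes that are not explicit, with the location of their eigenvalues. -/
theorem eventually_exists_modes {κ ν a : ℝ} (hκ : 0 < κ) (hν : 0 < ν - 1) (hν' : 0 < ν) (ha : 0 < a)
    (k : ℝ) {ε : ℝ} (hε : 0 < ε) : ∀ᶠ p in 𝓝 (0 : H2 × H2 × ℝ),
      refl (d2 0 p.1) = (1 : ℝ) • d2 0 p.1 → refl (d2 0 p.2.1) = (-1 : ℝ) • d2 0 p.2.1 →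
      ∃ (x₁ x₂ x₄ : H2 × H2) (u₅ : H2) (μ₁ μ₂ μ₄ μ₅ : ℝ),
        (x₁ ∈ sectorH2 1 ∧ block₀ κ ν a x₁ + pertBlock a k p x₁ = μ₁ • incl2 x₁ ∧ x₁ ≠ 0 ∧
          ‖x₁ - (ground hκ (by norm_num : (0 : ℝ) < 3), 0)‖ < ε) ∧
        (x₂ ∈ sectorH2 1 ∧ block₀ κ ν a x₂ + pertBlock a k p x₂ = μ₂ • incl2 x₂ ∧ x₂ ≠ 0 ∧
          ‖x₂ - (0, excited hκ hν)‖ < ε) ∧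
        (x₄ ∈ sectorH2 (-1) ∧ block₀ κ ν a x₄ + pertBlock a k p x₄ = μ₄ • incl2 x₄ ∧ x₄ ≠ 0 ∧
          ‖x₄ - (0, ground hκ hν')‖ < ε) ∧
        (a • poschl κ ν u₅ + pertScalar a k p u₅ = μ₅ • d2 0 u₅ ∧ u₅ ≠ 0 ∧
          ‖u₅ - ground hκ hν'‖ < ε) ∧
        μ₁ < μ₂ ∧ μ₁ < 0 ∧ μ₄ < 0 ∧ μ₅ < 0 := by
  have h3 : (0 : ℝ) < 3 := by norm_num
  have hE := energy_neg hκ (by norm_num : (0 : ℝ) < 3 - 1)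
  have hE' := mul_neg_of_pos_of_neg ha (energy_neg hκ hν)
  have z : ∀ {u : H2}, d2 0 u ≠ 0 → u ≠ 0 := fun hu h => hu (by rw [h, map_zero])
  have g₁ := z (ground_ne_zero hκ h3)
  have g₂ := z (excited_ne_zero hκ hν)
  have g₃ := z (ground_ne_zero hκ hν')
  have f₁ : ((ground hκ h3, 0) : H2 × H2) ≠ 0 := fun h => g₁ (congrArg (fun f : H2 × H2 => f.1) h)
  have f₂ : ((0, excited hκ hν) : H2 × H2) ≠ 0 := fun h => g₂ (congrArg (fun f : H2 × H2 => f.2) h)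
  have f₃ : ((0, ground hκ hν') : H2 × H2) ≠ 0 := fun h => g₃ (congrArg (fun f : H2 × H2 => f.2) h)
  filter_upwards [
    eventually_exists_ground_fst hκ hν ha k
      (setOf_near_mem_nhds f₁ hε (by linarith : 0 < -energy κ 3 / 2)),
    eventually_exists_excited_snd hκ hν ha k
      (setOf_near_mem_nhds f₂ hε (by linarith : 0 < -energy κ 3 / 2)),
    eventually_exists_ground_snd hκ hν hν' ha k
      (setOf_near_mem_nhds f₃ hε (by linarith : 0 < -(a * energy κ ν))),
    eventually_exists_ground_scalar hκ hν hν' ha k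
      (setOf_near_mem_nhds g₃ hε (by linarith : 0 < -(a * energy κ ν)))]
    with p h₁ h₂ h₄ h₅ even odd
  obtain ⟨x₁, μ₁, ⟨c₁, n₁, l₁⟩, m₁, e₁⟩ := h₁ even odd
  obtain ⟨x₂, μ₂, ⟨c₂, n₂, l₂⟩, m₂, e₂⟩ := h₂ even odd
  obtain ⟨x₄, μ₄, ⟨c₄, n₄, l₄⟩, m₄, e₄⟩ := h₄ even odd
  obtain ⟨⟨u₅, μ₅⟩, ⟨c₅, n₅, l₅⟩, e₅⟩ := h₅
  dsimp only at c₁ c₂ c₄ c₅ n₁ n₂ n₄ n₅ l₁ l₂ l₄ l₅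
  rw [abs_lt] at l₁ l₂ l₄ l₅
  exact ⟨x₁, x₂, x₄, u₅, μ₁, μ₂, μ₄, μ₅, ⟨m₁, e₁, n₁, c₁⟩, ⟨m₂, e₂, n₂, c₂⟩, ⟨m₄, e₄, n₄, c₄⟩,
    ⟨e₅, n₅, c₅⟩, by linarith, by linarith, by linarith, by linarith⟩

/-- The translation mode, normalized so that it is near the excited state of `L₁`. -/
theorem exists_translation_mode_near {c k : ℝ} (hc : 0 < c) (hk : 1 / 6 < k) {ε : ℝ} (hε : 0 < ε) :
    ∃ r : ℝ, 0 < r ∧ ∀ C β h A, BranchSolution hc k C β h A → ‖h‖ < r → ‖A‖ < r →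
      ∃ x ∈ sectorH2 (-1), x ≠ 0 ∧
        block₀ (kap c) (nu k) (2 / k) x + pertBlock (2 / k) k (h, A, β) x = (0 : ℝ) • incl2 x ∧
        ‖incl2 x - (d2 0 (excited (kap_pos hc) (by norm_num : (0 : ℝ) < 3 - 1)), 0)‖ < ε := by
  have hφ := excited_ne_zero (kap_pos hc) (by norm_num : (0 : ℝ) < 3 - 1)
  have hU := d2_one_U₀ hc
  set φ := excited (kap_pos hc) (by norm_num : (0 : ℝ) < 3 - 1)
  set s := -(3 * c * √c) with hs
  have hs0 : 0 < |s| := by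
    rw [hs, abs_neg, abs_pos]
    positivity
  have hn : 0 < ‖d2 0 φ‖ := norm_pos_iff.2 hφ
  refine ⟨|s| * min ε ‖d2 0 φ‖, by positivity, fun C β h A sol hh hA => ?_⟩
  obtain ⟨x, hx, x₁, x₂, e⟩ := exists_translation_mode hc hk sol.even sol.odd sol.eq_h sol.eq_A
  have hd : ‖incl2 (s⁻¹ • x) - (d2 0 φ, 0)‖ < min ε ‖d2 0 φ‖ := by
    have e' : incl2 (s⁻¹ • x) - (d2 0 φ, 0) = s⁻¹ • (d2 1 h, d2 1 A) := by
      rw [map_smul, incl2_apply, x₁, x₂, map_add, hU]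
      refine Prod.ext ?_ ?_
      · change s⁻¹ • (s • d2 0 φ + d2 1 h) - d2 0 φ = s⁻¹ • d2 1 h
        rw [smul_add, smul_smul, inv_mul_cancel₀ (abs_pos.1 hs0), one_smul, add_sub_cancel_left]
      · change s⁻¹ • d2 1 A - 0 = s⁻¹ • d2 1 A
        rw [sub_zero]
    rw [e', norm_smul, norm_inv, Real.norm_eq_abs, inv_mul_lt_iff₀ hs0]
    exact max_lt ((H2.norm_d2_le 1 h).trans_lt hh) ((H2.norm_d2_le 1 A).trans_lt hA)
  refine ⟨s⁻¹ • x, Submodule.smul_mem _ _ hx, fun h0 => ?_, ?_, hd.trans_le (min_le_left _ _)⟩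
  · rw [h0, map_zero, zero_sub, norm_neg] at hd
    exact absurd ((norm_fst_le _).trans_lt (hd.trans_le (min_le_right _ _))) (lt_irrefl _)
  · rw [map_smul, map_smul, ← smul_add, e, smul_zero, zero_smul]

/-- The indices of the Hessian at the solutions of the branch: the eigenvalue that bifurcates from
the kernel of `L₂` has the sign of `-P`. -/
theorem eventually_indices {c k : ℝ} (hc : 0 < c) (hk : 1 / 6 < k) {C : ℝ} (hC : 0 ≤ C) {W : H2}
    (hW : refl (d2 0 W) = (1 : ℝ) • d2 0 W)
    (eW : poschl (kap c) 3 W = mulL (gT hc hk) (d2 0 (gT hc hk))) {P : ℝ}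
    (hP : P = inner ℝ (mulL W (d2 0 (gT hc hk))) (d2 0 (gT hc hk))) (hP0 : P ≠ 0) :
    ∀ᶠ β in 𝓝 (0 : ℝ), ∀ h A, BranchSolution hc k C β h A →
      (P < 0 → morseIndex c k (Ωc2 c k + β) (U₀ hc + h) A = 3) ∧
      (0 < P → morseIndex c k (Ωc2 c k + β) (U₀ hc + h) A = 4) ∧
      nullityIndex c k (Ωc2 c k + β) (U₀ hc + h) A = 2 := by
  have hκ := kap_pos hc
  have hν := nu_sub_one_pos hk
  have hν' : 0 < nu k := by linarith
  have ha : 0 < 2 / k := by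
    have : 0 < k := by linarith
    positivity
  have hg0 : d2 0 (gT hc hk) ≠ 0 := excited_ne_zero hκ hν
  obtain ⟨ε₁, hε₁, posB⟩ := exists_block_form_pos hκ hν hν' ha k
  obtain ⟨ε₂, hε₂, posS⟩ := exists_scalar_form_pos hκ hν hν' ha k
  obtain ⟨ε₃, hε₃, sgn⟩ := exists_forall_near_pos (d2 0) mulL (g := gT hc hk) (W := W) hg0
    (hP.trans (real_inner_comm _ _)) hP0
  set ε := min ε₁ (min ε₂ ε₃) with hε_def
  have hε : 0 < ε := lt_min hε₁ (lt_min hε₂ hε₃)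
  have l₁ : ε ≤ ε₁ := min_le_left _ _
  have l₂ : ε ≤ ε₂ := (min_le_right _ _).trans (min_le_left _ _)
  have l₃ : ε ≤ ε₃ := (min_le_right _ _).trans (min_le_right _ _)
  obtain ⟨ρ, hρ, modes⟩ := Metric.eventually_nhds_iff.1
    (eventually_exists_modes hκ hν hν' ha k hε)
  obtain ⟨r, hr, trans⟩ := exists_translation_mode_near hc hk hε
  set τ := min (min ρ ε) r with hτ
  have hτ0 : 0 < τ := lt_min (lt_min hρ hε) hr
  have hsq : ∀ᶠ β in 𝓝 (0 : ℝ), C * √|β| < τ := by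
    have h : Tendsto (fun β : ℝ => C * √|β|) (𝓝 0) (𝓝 (C * √|0|)) :=
      (by fun_prop : Continuous fun β : ℝ => C * √|β|).tendsto 0
    rw [abs_zero, Real.sqrt_zero, mul_zero] at h
    exact h.eventually_lt_const hτ0
  filter_upwards [hsq, eventually_mul_norm_lt C hτ0, eventually_mul_norm_lt 1 hτ0,
    eventually_branch_expansion hc hk hC hW eW hε] with β b₁ b₂ b₃ hexp h A sol
  rw [Real.norm_eq_abs] at b₂ b₃
  have hh := sol.norm_h_le.trans_lt b₂
  have hA := sol.norm_A_le.trans_lt b₁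
  have hp : ‖((h, A, β) : H2 × H2 × ℝ)‖ < τ := max_lt hh (max_lt hA (by simpa using b₃))
  have tρ : τ ≤ ρ := (min_le_left _ _).trans (min_le_left _ _)
  have tε : τ ≤ ε := (min_le_left _ _).trans (min_le_right _ _)
  have tr : τ ≤ r := min_le_right _ _
  obtain ⟨x₁, x₂, x₄, u₅, μ₁, μ₂, μ₄, μ₅, ⟨m₁, e₁, n₁, d₁⟩, ⟨m₂, e₂, n₂, d₂⟩, ⟨m₄, e₄, n₄, d₄⟩,
    ⟨e₅, n₅, d₅⟩, h₁₂, h₁, h₄, h₅⟩ := modes (y := (h, A, β))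
      (by rw [dist_zero_right]; exact hp.trans_le tρ) sol.even sol.odd
  obtain ⟨x₃, m₃, n₃, e₃, d₃⟩ := trans C β h A sol (hh.trans_le tr) (hA.trans_le tr)
  obtain ⟨α, b, w, hα, dα, rfl, rfl, db, dw⟩ := hexp h A sol
  obtain ⟨s₁, s₂⟩ := sgn x₂ b w α (d₂.trans_le l₃) (db.trans_le l₃) (dw.trans_le l₃)
    (dα.trans_le l₃)
  have hsign : μ₂ * P < 0 := by
    have e := eigenvalue_mul_eq_of_expansion hα sol.eq_h sol.eq_A e₂
    have q : μ₂ * P * (inner ℝ (d2 0 x₂.2) (d2 0 b) + 2 * α * inner ℝ (d2 0 x₂.1) (d2 0 w)) < 0 := by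
      have hα2 : 0 < α ^ 2 := by positivity
      have := mul_pos hα2 s₂
      linear_combination this + P * e
    exact neg_of_mul_neg_left q s₁.le
  have hb0 : b ≠ 0 := fun h0 => sol.ne_zero (by rw [h0, smul_zero])
  have e₆ : (2 / k) • poschl (kap c) (nu k) b + pertScalar (2 / k) k (α ^ 2 • w, α • b, β) b =
      (0 : ℝ) • d2 0 b := by
    have e := sol.eq_A
    rw [map_smul, map_smul, map_smul] at e
    have e' : poschl (kap c) (nu k) b = β • d2 0 b + k • mulL (α ^ 2 • w) (d2 0 b) :=
      smul_right_injective _ hα (by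
        dsimp only
        rw [e]
        module)
    rw [scalar_apply, e', sub_self, smul_zero, zero_smul]
  have key := indices_of_eigenvectors hc hk rfl rfl m₁ m₂ m₃ m₄ e₁ e₂ e₃ e₄ e₅ e₆ n₁ n₂ n₃ n₄ n₅ hb0
    h₁₂ h₁ (left_ne_zero_of_mul hsign.ne) h₄ h₅
    (posB _ (incl2 x₁) (incl2 x₂) (incl2 x₃) (incl2 x₄) (hp.trans_le (tε.trans l₁)) ?_ ?_
      (d₃.trans_le l₁) ?_)
    (posS _ (d2 0 u₅) (d2 0 b) (hp.trans_le (tε.trans l₂)) ?_ ?_)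
  · refine ⟨fun hP1 => key.2.1 ?_, fun hP1 => key.1 ?_, key.2.2⟩
    · exact pos_of_mul_neg_left hsign hP1.le
    · exact neg_of_mul_neg_left hsign hP1.le
  · have := (norm_incl2_sub_le x₁ (ground hκ (by norm_num : (0 : ℝ) < 3), 0)).trans_lt
      (d₁.trans_le l₁)
    rwa [incl2_inl] at this
  · have := (norm_incl2_sub_le x₂ (0, excited hκ hν)).trans_lt (d₂.trans_le l₁)
    rwa [incl2_inr] at this
  · have := (norm_incl2_sub_le x₄ (0, ground hκ hν')).trans_lt (d₄.trans_le l₁)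
    rwa [incl2_inr] at this
  · rw [← map_sub]
    exact (H2.norm_d2_le 0 _).trans_lt (d₅.trans_le l₂)
  · change ‖d2 0 b - d2 0 (gT hc hk)‖ < ε₂
    rw [← map_sub]
    exact (H2.norm_d2_le 0 _).trans_lt (db.trans_le l₂)

end KdVLS

end

theorem mainTheorem7 (c k : ℝ) (hc : 0 < c) (hk : 1 / 6 < k) :
    (∃! W : KdVLS.H2, KdVLS.IsInvGTildeSq hc k W) ∧
    ∀ W : KdVLS.H2, KdVLS.IsInvGTildeSq hc k W → KdVLS.pairing c k W ≠ 0 →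
      ∃ C₀ : ℝ, 0 < C₀ ∧ ∀ C : ℝ, C₀ ≤ C → ∃ δ : ℝ, 0 < δ ∧
        ∀ Ω : ℝ, |Ω - KdVLS.Ωc2 c k| < δ →
          SignType.sign (Ω - KdVLS.Ωc2 c k) = -SignType.sign (KdVLS.pairing c k W) →
            (∃ U A : KdVLS.H2, KdVLS.IsSecondBranch hc k C Ω U A) ∧
            ∀ U A : KdVLS.H2, KdVLS.IsSecondBranch hc k C Ω U A →
              (KdVLS.pairing c k W < 0 → KdVLS.morseIndex c k Ω U A = 3) ∧
              (0 < KdVLS.pairing c k W → KdVLS.morseIndex c k Ω U A = 4) ∧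
              KdVLS.nullityIndex c k Ω U A = 2 := by
  have hunique := KdVLS.existsUnique_isInvGTildeSq hc hk
  refine ⟨hunique, fun W hW hP0 => ?_⟩
  obtain ⟨hWe, eW⟩ := (KdVLS.isInvGTildeSq_iff hc hk W).1 hW
  have hP := KdVLS.pairing_eq hc hk W
  obtain ⟨C₀, hC₀, hex⟩ := KdVLS.exists_branch hc hk hWe eW hP hP0
  refine ⟨C₀, hC₀, fun C hC => ?_⟩
  have hind := KdVLS.eventually_indices hc hk (hC₀.le.trans hC) hWe eW hP hP0
  obtain ⟨δ, hδ, hb⟩ := Metric.eventually_nhds_iff.1 (hex.and hind)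
  refine ⟨δ, hδ, fun Ω hΩ hsign => ?_⟩
  obtain ⟨hex, hind⟩ := hb (y := Ω - KdVLS.Ωc2 c k) (by simpa using hΩ)
  have hβP : (Ω - KdVLS.Ωc2 c k) * KdVLS.pairing c k W < 0 := by
    rw [← sign_eq_neg_one_iff, sign_mul, hsign]
    rcases lt_or_gt_of_ne hP0 with h | h
    · rw [sign_neg h]
      rfl
    · rw [sign_pos h]
      rfl
  constructor
  · obtain ⟨h, A, even, odd, eq_h, eq_A, hA, nh, nA⟩ := hex hβP
    refine ⟨KdVLS.U₀ hc + h, A, (KdVLS.isSecondBranch_iff hc hk C Ω _ A).2 ?_⟩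
    rw [add_sub_cancel_left]
    exact ⟨even, odd, eq_h, eq_A, hA, nh.trans (by gcongr), nA.trans (by gcongr)⟩
  · intro U A hUA
    have h := hind _ A ((KdVLS.isSecondBranch_iff hc hk C Ω U A).1 hUA)
    rwa [add_sub_cancel, add_sub_cancel] at h
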